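/- **Setting.** Let $\mathsf A$ and $\mathsf B$ be systems of $n$ and $m$ qubits with $n+m\ge 1$, $d_{\mathsf A}=2^n$, $d_{\mathsf B}=2^m$. Let $U_\rho,U_\sigma$ be unitaries on $n+m$ qubits, and put $|\rho\rangle^{\mathsf{AB}}=U_\rho|0\rangle$, $|\sigma\rangle^{\mathsf{AB}}=U_\sigma|0\rangle$, $\rho^{\mathsf A}=\mathrm{tr}_{\mathsf B}|\rho\rangle\langle\rho|$, $\sigma^{\mathsf A}=\mathrm{tr}_{\mathsf B}|\sigma\rangle\langle\sigma|$. Assume $\sqrt{\sigma^{\mathsf A}}\sqrt{\rho^{\mathsf A}}\neq 0$, and let $s_{\min}$ and $r$ be its minimum non-zero singular value and its rank. Write $\mathrm F(\omega,\tau)=\|\sqrt\omega\sqrt\tau\|_1^2$. For a matrix with singular value decomposition $M=\sum_j s_j|\eta_j\rangle\langle\xi_j|$ and an odd function $f$ let $f^{(\mathrm{SV})}(M)=\sum_j f(s_j)|\eta_j\rangle\langle\xi_j|$. The Uhlmann partial isometry is $V^{\mathsf B}=\mathrm{sgn}^{(\mathrm{SV})}\big(\mathrm{tr}_{\mathsf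 A}|\sigma\rangle\langle\rho|^{\mathsf{AB}}\big)$; it is a partial isometry with $\mathrm F(V^{\mathsf B}|\rho\rangle^{\mathsf{AB}},|\sigma\rangle^{\mathsf{AB}})=\mathrm F(\rho^{\mathsf A},\sigma^{\mathsf A})$. A unitary $U$ on a system together with an ancilla register block-encodes $(\langle 0|\otimes I)U(|0\rangle\otimes I)$, where $|0\rangle$ is the all-zero state of the ancilla register. Circuits consist of one- and two-qubit gates and queries to oracles and their inverses, and may use work qubits that start in $|0\rangle$ and are returned to $|0\rangle$. **Algorithm.** $\mathtt{QSVTSIGN}(U,U^\dagger;\delta_1,\beta)$, for $\delta_1\in(0,1/2)$, $\beta\in(0,1]$ and numbers $b$, $a$ of system and ancilla qubits, is a circuit, depending only on $b,a,\delta_1,\beta$, that queries a unitary $U$ on $b+a$ qubits and its inverse and performs, for every $U$, a unitary on $b+(a+1)$ qubits that block-encodes $P^{(\mathrm{SV})}(M)$, where $M$ is the operator block-encoded by $U$, and $P$ is an odd real polynomial (depending only on $b,a,\delta_1,\beta$) whose degree is the number of queries, with $|P(x)|\le1$ for $|x|\le1$ and $|P(x)-\mathrm{sgn}(x)|\le\delta_1$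 for $\beta\le|x|\le1$. Given such a subroutine, a parameter $\delta\in(0,1)$ and a criterion $\chi\in\{\diamond,\mathtt F\}$, let $$W^{\mathsf{B\hat A\hat B}}=(U_\rho^{\mathsf{\hat A\hat B}})^\dagger\,(I^{\mathsf{\hat A}}\otimes F^{\mathsf{B\hat B}})\,U_\sigma^{\mathsf{\hat A\hat B}},$$ with $F^{\mathsf{B\hat B}}$ the swap operator, and let $\mathtt{UhlmannPurifiedQuery}(U_\rho,U_\sigma;\delta,\chi)$ be the unitary $\tilde W_\chi^{\mathsf{BD}}=\mathtt{QSVTSIGN}(W,W^\dagger;\delta_1,\beta)$ on $\mathsf B$ and an $(n+m+1)$-qubit system $\mathsf D$, where $\delta_1=(\delta/3)^2$, $\beta=s_{\min}$ if $\chi=\diamond$, and $\delta_1=\delta/4$, $\beta=\max\{s_{\min},\delta_1/(2r)\}$ if $\chi=\mathtt F$. The circuit depends on $U_\rho,U_\sigma$ only through $s_{\min}$ and $r$. **Theorem.** There are a subroutine $\mathtt{QSVTSIGN}$ as above and a universal constant $C>0$ such that for all $n,m,U_\rho,U_\sigma$ as above and all $\delta\in(0,1)$ the following hold. 1. There is a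 unitary $\tilde U_{\rm ideal}^{\mathsf{BD}}$ that is an exact block-encoding of $V^{\mathsf B}$ and satisfies $$\tfrac12\big\|\tilde{\mathcal W}_\diamond^{\mathsf{BD}}\circ\mathcal P_{|0\rangle}^{\mathbb C\to\mathsf D}-\tilde{\mathcal U}_{\rm ideal}^{\mathsf{BD}}\circ\mathcal P_{|0\rangle}^{\mathbb C\to\mathsf D}\big\|_\diamond\le\delta,$$ where $\mathcal P_{|0\rangle}^{\mathbb C\to\mathsf D}$ prepares $|0\rangle\langle0|$ on $\mathsf D$ and calligraphic letters denote the channels $X\mapsto UXU^\dagger$. The algorithm uses $u_\diamond\le C\,\frac1{s_{\min}}\log\frac2\delta$ queries to $U_\rho$, $U_\sigma$ and their inverses. 2. With $\mathcal T^{\mathsf B}=\mathrm{tr}_{\mathsf D}\circ\tilde{\mathcal W}_{\mathtt F}^{\mathsf{BD}}\circ\mathcal P_{|0\rangle}^{\mathbb C\to\mathsf D}$, $$\mathrm F\big(\mathcal T^{\mathsf B}(|\rho\rangle\langle\rho|^{\mathsf{AB}}),|\sigma\rangle^{\mathsf{AB}}\big)\ge\mathrm F(\rho^{\mathsf A},\sigma^{\mathsf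 A})-\delta .$$ The algorithm uses $u_{\mathtt F}\le C\min\{\frac1{s_{\min}},\frac r\delta\}\log\frac2\delta$ queries to $U_\rho$, $U_\sigma$ and their inverses. 3. For both $\chi\in\{\diamond,\mathtt F\}$ the circuit consists, besides the queries, of at most $C\,u_\chi\log(d_{\mathsf A}d_{\mathsf B})$ one- and two-qubit gates, and uses at most $C\log(d_{\mathsf A}d_{\mathsf B})$ auxiliary qubits (including those of $\mathsf D$). (For $\delta\le1/2$ one has $\log\frac2\delta\le2\log\frac1\delta$, so these are the bounds $O(\frac1{s_{\min}}\log\frac1\delta)$ and $O(\min\{\frac1{s_{\min}},\frac r\delta\}\log\frac1\delta)$.) -/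

import Mathlib

namespace Uhlmann

open Matrix Polynomial
open scoped ENNReal

noncomputable section

/-! ### Qubit registers and circuits with oracle queries -/

/-- Labels of the computational basis of a register whose qubits are indexed by `Q`. -/
abbrev Bits (Q : Type) : Type := Q → Bool

/-- Operators on the register `(ℂ²)^{⊗ Q}`, as matrices in the computational basis. -/
abbrev Op (Q : Type) : Type := Matrix (Bits Q) (Bits Q) ℂ

/-- Unitary operators on the register `(ℂ²)^{⊗ Q}`. -/
abbrev UOp (Q : Type) [Fintype Q] [DecidableEq Q] : Type := Matrix.unitaryGroup (Bits Q) ℂ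

/-- The label of the basis state `|0…0⟩`. -/
def zeroBits (Q : Type) : Bits Q := fun _ => false

open Classical in
/-- `M ⊗ I`: the operator `M` acts on the wires `e r`, the identity on all other wires. -/
def onWires {R Q : Type} (e : R ↪ Q) (M : Op R) : Op Q := Matrix.of fun x y =>
  if ∀ q, q ∉ Set.range e → x q = y q then M (fun r => x (e r)) (fun r => y (e r)) else 0

/-- One step of a circuit on the wires `Q`: a one-qubit gate, a two-qubit gate, or a query to the
oracle with label `i` (to its inverse if `inv = true`) on the wires singled out by `e`. -/
inductive Instr (ι R Q : Type) : Type
  | gate1 (e : Fin 1 ↪ Q) (u : UOp (Fin 1))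
  | gate2 (e : Fin 2 ↪ Q) (u : UOp (Fin 2))
  | query (i : ι) (inv : Bool) (e : R ↪ Q)

/-- A circuit is the list of its steps; the head of the list is executed first. Circuits only
contain oracle labels: they do not depend on the oracles themselves. -/
abbrev QCircuit (ι R Q : Type) : Type := List (Instr ι R Q)

namespace Instr

variable {ι R Q Q' : Type}

/-- The operator performed by a step when the oracles are `O`. -/
def op [Fintype R] [DecidableEq R] (O : ι → UOp R) : Instr ι R Q → Op Q
  | gate1 e u => onWires e u.1
  | gate2 e u => onWires e u.1
  | query i inv e => onWires e (if inv then ((O i).1)ᴴ else (O i).1)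

/-- The inverse step. -/
def inverse : Instr ι R Q → Instr ι R Q
  | gate1 e u => gate1 e u⁻¹
  | gate2 e u => gate2 e u⁻¹
  | query i inv e => query i (!inv) e

/-- Relabelling of the wires. -/
def mapWires (f : Q ↪ Q') : Instr ι R Q → Instr ι R Q'
  | gate1 e u => gate1 (e.trans f) u
  | gate2 e u => gate2 (e.trans f) u
  | query i inv e => query i inv (e.trans f)

/-- Whether a step is an oracle query. -/
def isQuery : Instr ι R Q → Bool
  | query _ _ _ => true
  | _ => false

end Instr

namespace QCircuit

variable {ι κ R R' Q Q' : Type}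

/-- The operator performed by a circuit when the oracles are `O`. -/
def eval [Fintype R] [DecidableEq R] [Fintype Q] [DecidableEq Q] (O : ι → UOp R) :
    QCircuit ι R Q → Op Q
  | [] => 1
  | g :: c => eval O c * g.op O

/-- The number of oracle queries (to the oracles and to their inverses). -/
def queries (c : QCircuit ι R Q) : ℕ := c.countP fun g => g.isQuery

/-- The number of one- and two-qubit gates. -/
def gates (c : QCircuit ι R Q) : ℕ := c.countP fun g => !g.isQuery

/-- The inverse circuit. -/
def inverse (c : QCircuit ι R Q) : QCircuit ι R Q := (c.map Instr.inverse).reverse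

/-- Relabelling of the wires. -/
def mapWires (f : Q ↪ Q') (c : QCircuit ι R Q) : QCircuit ι R Q' := c.map (Instr.mapWires f)

/-- Replace every query to a single oracle on `R` by the circuit `w` on `R`, and every query to its
inverse by the inverse circuit. -/
def subst (w : QCircuit κ R' R) (c : QCircuit Unit R Q) : QCircuit κ R' Q :=
  c.flatMap fun g => match g with
    | .gate1 e u => [.gate1 e u]
    | .gate2 e u => [.gate2 e u]
    | .query _ inv e => mapWires e (if inv then inverse w else w)

end QCircuit

/-- A circuit on the qubits `Q` and `work` further work qubits. -/
structure Routine (ι R Q : Type) where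
  work : ℕ
  circuit : QCircuit ι R (Q ⊕ Fin work)

/-- The routine performs `V` on the qubits `Q`: with the work qubits initialized in `|0…0⟩` it maps
`|y⟩|0…0⟩` to `(V|y⟩)|0…0⟩`, so that the work qubits are returned in their initial state. -/
def Routine.Performs {ι R Q : Type} [Fintype R] [DecidableEq R] [Fintype Q] [DecidableEq Q]
    (c : Routine ι R Q) (O : ι → UOp R) (V : Op Q) : Prop :=
  ∀ (x y : Bits Q) (z : Bits (Fin c.work)),
    c.circuit.eval O (Sum.elim x z) (Sum.elim y (zeroBits _)) =
      if z = zeroBits _ then V x y else 0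

/-! ### Matrices: square root, trace norm, singular values -/

section Matrices

variable {α β : Type} [Fintype α] [DecidableEq α] [Fintype β] [DecidableEq β]

/-- The square root of a positive semidefinite matrix. -/
def sqrtm (M : Matrix α α ℂ) : Matrix α α ℂ := cfc Real.sqrt M

/-- The trace norm `tr √(M† M)`. -/
def traceNorm (M : Matrix α α ℂ) : ℝ := (sqrtm (Mᴴ * M)).trace.re

/-- The singular values of `M`, with multiplicity: square roots of the eigenvalues of `M† M`. -/
def singVal (M : Matrix α α ℂ) (j : α) : ℝ :=
  √((isHermitian_conjTranspose_mul_self M).eigenvalues j)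

/-- The right singular vectors `|ξ_j⟩`: an orthonormal eigenbasis of `M† M`. -/
def rightSing (M : Matrix α α ℂ) (j : α) : α → ℂ :=
  ⇑((isHermitian_conjTranspose_mul_self M).eigenvectorBasis j)

/-- The left singular vectors `|η_j⟩ = M|ξ_j⟩ / s_j` for `s_j ≠ 0` (and `0` if `s_j = 0`). -/
def leftSing (M : Matrix α α ℂ) (j : α) : α → ℂ :=
  ((singVal M j : ℂ)⁻¹) • (M *ᵥ rightSing M j)

/-- `f^{(SV)}(M) = ∑_j f(s_j) |η_j⟩⟨ξ_j|` for a function `f` with `f 0 = 0`, where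
`M = ∑_j s_j |η_j⟩⟨ξ_j|` is a singular value decomposition. -/
def svTransform (f : ℝ → ℝ) (M : Matrix α α ℂ) : Matrix α α ℂ :=
  ∑ j, (f (singVal M j) : ℂ) • vecMulVec (leftSing M j) (star (rightSing M j))

/-- The minimum non-zero singular value of a matrix `M ≠ 0`. -/
def minSingVal (M : Matrix α α ℂ) : ℝ := sInf {s | s ≠ 0 ∧ ∃ j, singVal M j = s}

/-- The (squared) fidelity `‖√ρ √σ‖₁²`. -/
def fidelity (ρ σ : Matrix α α ℂ) : ℝ := traceNorm (sqrtm ρ * sqrtm σ) ^ 2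

/-- The rank-one operator `|ψ⟩⟨φ|`. -/
def ketbra (ψ φ : α → ℂ) : Matrix α α ℂ := vecMulVec ψ (star φ)

/-- The partial trace over the first factor. -/
def traceFst (M : Matrix (α × β) (α × β) ℂ) : Matrix β β ℂ := .of fun b b' => ∑ a, M (a, b) (a, b')

/-- The partial trace over the second factor. -/
def traceSnd (M : Matrix (α × β) (α × β) ℂ) : Matrix α α ℂ := .of fun a a' => ∑ b, M (a, b) (a', b)

/-- The map `id_γ ⊗ T`. -/
def idTensor (γ : Type) (T : Matrix α α ℂ →ₗ[ℂ] Matrix β β ℂ) (M : Matrix (γ × α) (γ × α) ℂ) :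
    Matrix (γ × β) (γ × β) ℂ :=
  .of fun p q => T (.of fun a a' => M (p.1, a) (q.1, a')) p.2 q.2

/-- The diamond norm: the supremum of `‖(id ⊗ T)(M)‖₁` over reference systems of every dimension
and all operators `M` with `‖M‖₁ ≤ 1`. -/
def diamondNorm (T : Matrix α α ℂ →ₗ[ℂ] Matrix β β ℂ) : ℝ≥0∞ :=
  ⨆ (d : ℕ) (M : Matrix (Fin d × α) (Fin d × α) ℂ) (_ : traceNorm M ≤ 1),
    ENNReal.ofReal (traceNorm (idTensor (Fin d) T M))

/-- The channel `X ↦ V X V†`. -/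
def conjChannel (V : Matrix α α ℂ) : Matrix α α ℂ →ₗ[ℂ] Matrix α α ℂ where
  toFun X := V * X * Vᴴ
  map_add' X Y := by rw [Matrix.mul_add, Matrix.add_mul]
  map_smul' c X := by simp

end Matrices

section Registers

variable {S D : Type} [Fintype S] [DecidableEq S] [Fintype D] [DecidableEq D]

/-- The channel `X ↦ X ⊗ |0⟩⟨0|` that adds the register `D` in the state `|0…0⟩`. -/
def prepZero (S D : Type) [DecidableEq D] [Fintype D] : Op S →ₗ[ℂ] Op (S ⊕ D) where
  toFun X := .of fun x y =>
    if x ∘ Sum.inr = zeroBits D ∧ y ∘ Sum.inr = zeroBits D then X (x ∘ Sum.inl) (y ∘ Sum.inl) else 0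
  map_add' X Y := by ext x y; simp only [Matrix.add_apply, Matrix.of_apply]; split_ifs <;> simp
  map_smul' c X := by ext x y; simp

/-- The partial trace over the register `D`. -/
def traceOut (S D : Type) [DecidableEq D] [Fintype D] : Op (S ⊕ D) →ₗ[ℂ] Op S where
  toFun X := .of fun x y => ∑ d : Bits D, X (Sum.elim x d) (Sum.elim y d)
  map_add' X Y := by ext x y; simp [Finset.sum_add_distrib]
  map_smul' c X := by ext x y; simp [Finset.mul_sum]

/-- The block `(⟨0|_D ⊗ I) U (|0⟩_D ⊗ I)`, i.e. the operator that `U` block-encodes. -/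
def topBlock (U : Op (S ⊕ D)) : Op S :=
  .of fun x y => U (Sum.elim x (zeroBits D)) (Sum.elim y (zeroBits D))

end Registers

/-! ### QSVT with the sign function -/

/-- Routines that query a unitary on `b + a` qubits (the last `a` of which carry the
block-encoding) and act on the `b` system qubits and `a + 1` ancilla qubits. -/
abbrev SignRoutine (b a : ℕ) : Type := Routine Unit (Fin b ⊕ Fin a) (Fin b ⊕ Fin (a + 1))

/-- The routine is a QSVT with the sign function, with error `δ` and threshold `β`: there is an odd
real polynomial `P`, with `|P| ≤ 1` on `[-1, 1]` and `|P - sgn| ≤ δ` for `β ≤ |x| ≤ 1`, whose degree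
is the number of uses of `U` and `U†`, such that for every unitary `U` the routine performs a
unitary that block-encodes `P^{(SV)}(M)`, where `M` is the operator block-encoded by `U`. -/
def IsSignQSVT {b a : ℕ} (δ β : ℝ) (c : SignRoutine b a) : Prop :=
  ∃ P : ℝ[X], P.natDegree = c.circuit.queries ∧ P.comp (-X) = -P ∧
    (∀ x : ℝ, |x| ≤ 1 → |P.eval x| ≤ 1) ∧
    (∀ x : ℝ, β ≤ |x| → |x| ≤ 1 → |P.eval x - Real.sign x| ≤ δ) ∧
    ∀ U : UOp (Fin b ⊕ Fin a), ∃ V : UOp (Fin b ⊕ Fin (a + 1)),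
      c.Performs (fun _ => U) V.1 ∧
        topBlock V.1 = svTransform (fun x => P.eval x) (topBlock U.1)

/-! ### The Uhlmann transformation algorithm -/

/-- The two state-preparation oracles `U_ρ` and `U_σ`. -/
inductive Prep : Type
  | rho
  | sigma

/-- The oracles `U_ρ`, `U_σ` as a family. -/
def prepOracles {N : ℕ} (Uρ Uσ : UOp (Fin N)) : Prep → UOp (Fin N)
  | .rho => Uρ
  | .sigma => Uσ

/-- The two criteria: diamond norm and fidelity difference. -/
inductive Criterion : Type
  | diamond
  | fidelity

/-- The two-qubit swap gate. -/
def swapGate : UOp (Fin 2) :=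
  ⟨.of fun x y => if x 0 = y 1 ∧ x 1 = y 0 then 1 else 0, by
    rw [Matrix.mem_unitaryGroup_iff]
    ext x y
    rw [Matrix.mul_apply, Finset.sum_eq_single (fun i => x (1 - i))]
    · simp only [Matrix.star_apply, Matrix.one_apply, Matrix.of_apply]
      by_cases h : x = y
      · subst h; simp
      · have : ¬ (y 0 = x 0 ∧ y 1 = x 1) := fun hh => h (by
          ext i; fin_cases i
          · exact hh.1.symm ▸ rfl
          · exact hh.2.symm ▸ rfl)
        simp [h, this]
    · intro z _ hz
      have : ¬ (x 0 = z 1 ∧ x 1 = z 0) := fun hh => hz (by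
        ext i; fin_cases i
        · exact hh.2.symm ▸ rfl
        · exact hh.1.symm ▸ rfl)
      simp [this]
    · simp⟩

/-- The wires of the `i`-th qubit of `B` and the `i`-th qubit of `B̂`. -/
def swapWires (n m : ℕ) (i : Fin m) : Fin 2 ↪ Fin m ⊕ Fin (n + m) where
  toFun j := if j = 0 then Sum.inl i else Sum.inr (Fin.natAdd n i)
  inj' j k h := by fin_cases j <;> fin_cases k <;> simp_all

/-- The circuit for `W = U_ρ† (I ⊗ F) U_σ` on `B Â B̂`, where `F` swaps `B` and `B̂`. The register
`B` is `Fin m`; in `Fin (n + m)` the first `n` qubits are `Â`, the last `m` are `B̂`. -/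
def wCircuit (n m : ℕ) : QCircuit Prep (Fin (n + m)) (Fin m ⊕ Fin (n + m)) :=
  [.query .sigma false Function.Embedding.inr] ++
    List.ofFn (fun i : Fin m => .gate2 (swapWires n m i) swapGate) ++
    [.query .rho true Function.Embedding.inr]

/-- The accuracy parameter handed to the QSVT. -/
def innerError (δ : ℝ) : Criterion → ℝ
  | .diamond => (δ / 3) ^ 2
  | .fidelity => δ / 4

/-- The threshold handed to the QSVT. -/
def threshold (δ s : ℝ) (r : ℕ) : Criterion → ℝ
  | .diamond => s
  | .fidelity => max s (innerError δ .fidelity / (2 * r))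

/-- The Uhlmann transformation algorithm: the QSVT with the sign function applied to `W`. It acts on
`B` (`m` qubits) and `D` (`n + m + 1` qubits), and as a circuit it depends on `U_ρ`, `U_σ` only
through the parameters `s` and `r`. -/
def uhlmannPurifiedQuery (qsvtSign : (b a : ℕ) → ℝ → ℝ → SignRoutine b a) (n m : ℕ) (δ : ℝ)
    (χ : Criterion) (s : ℝ) (r : ℕ) :
    Routine Prep (Fin (n + m)) (Fin m ⊕ Fin (n + m + 1)) where
  work := (qsvtSign m (n + m) (innerError δ χ) (threshold δ s r χ)).work
  circuit := QCircuit.subst (wCircuit n m)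
    (qsvtSign m (n + m) (innerError δ χ) (threshold δ s r χ)).circuit

/-! ### The states -/

/-- The state `U|0⟩` on `AB`, where `A` consists of `n` and `B` of `m` qubits. -/
def prepared (n m : ℕ) (U : UOp (Fin (n + m))) : Bits (Fin n) × Bits (Fin m) → ℂ :=
  fun p => U.1 (Fin.append p.1 p.2) (zeroBits _)

/-- The reduced state on `A` of a pure state on `AB`. -/
def reducedA {n m : ℕ} (ψ : Bits (Fin n) × Bits (Fin m) → ℂ) : Op (Fin n) :=
  traceSnd (ketbra ψ ψ)

/-- The operator `√σ^A √ρ^A`. -/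
def overlapA {n m : ℕ} (ρ σ : Bits (Fin n) × Bits (Fin m) → ℂ) : Op (Fin n) :=
  sqrtm (reducedA σ) * sqrtm (reducedA ρ)

/-- The Uhlmann partial isometry `V^B = sgn^{(SV)}(tr_A |σ⟩⟨ρ|)`. -/
def uhlmannIsometry {n m : ℕ} (ρ σ : Bits (Fin n) × Bits (Fin m) → ℂ) : Op (Fin m) :=
  svTransform Real.sign (traceFst (ketbra σ ρ))

end

end Uhlmann

/-! Write M for tr_A |σ⟩⟨ρ|. Three facts turn the theorem into a statement about the sign of the
singular values s_j of M. First, W block-encodes M (`topBlock_wCircuit`). Second, the Gram matrices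
of M and of √σ^A √ρ^A are, up to transposition and cyclic reordering, the same product, so both
operators have the same non-zero singular values (`charpoly_overlap`); hence s_min, r and F(ρ^A,
σ^A) = ‖M‖₁² can all be read off M. Third, ⟨σ|(I ⊗ K)|ρ⟩ = tr(M†K) (`dotProduct_localOp_mulVec`),
and this trace equals ‖M‖₁ when K is the polar isometry of M, which is V.

The subroutine needs a polynomial and a circuit. The polynomial x p(x²) is the normalized primitive
of a high even power of sin((2k+1)θ)/sin θ, as a function of x = sin θ: the kernel is concentrated
near 0, so its primitive is a steep step (`exists_sign_polynomial`). For the circuit, Lukács'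
theorem on [0, 1] (`weightedSquares_of_nonneg`) gives 1 - y p² = y B² + (1 - y) D². Then p + iB and
D satisfy the normalization identity of an alternating sequence of phases and queries, and the
phases are found by removing one layer at a time, a suitable phase making the leading coefficients
cancel (`exists_even_layer`, `exists_odd_layer`, `realizable`). The sequence is followed inside an
algebra with a projection e (`EvenState`, `OddState`), so no decomposition into two-dimensional
invariant subspaces is used. A flag qubit selects between the sequences for p + iB and p - iB;
Hadamard gates on it average the two blocks and leave p (`exists_signRoutine`).

For the diamond norm, the ideal unitary is chosen to agree with the implemented one off the support
of M, so that on the zero ancilla state the squared distance is governed by the numbers 2(1 -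
P(s_j)) with s_j ≠ 0 (`exists_unitary_diamondNorm_le`); this is why the inner error is of order δ².
For the fidelity, only the Kraus operator given by the block matters (`sq_norm_trace_le_fidelity`),
and ∑ s_j P(s_j) has to be compared with ∑ s_j: at most r singular values lie below the threshold β
and each costs at most 2β (`sum_sub_le_sum_mul`), so a threshold of order δ/r is enough. -/

namespace Uhlmann

open Matrix Polynomial
open scoped ENNReal Kronecker ComplexOrder

noncomputable section

/-! ### Operators on a subset of the wires -/

section OnWires

variable {R Q Q' : Type}

open Classical in
/-- Overwrite the bits of `x` on the wires `e r` by `u`. -/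
def overwrite (e : R ↪ Q) (x : Bits Q) (u : Bits R) : Bits Q := fun q =>
  if h : q ∈ Set.range e then u h.choose else x q

lemma overwrite_apply (e : R ↪ Q) (x : Bits Q) (u : Bits R) (r : R) :
    overwrite e x u (e r) = u r := by
  have h : e r ∈ Set.range e := ⟨r, rfl⟩
  rw [overwrite, dif_pos h]
  exact congrArg u (e.injective h.choose_spec)

lemma overwrite_of_notMem (e : R ↪ Q) (x : Bits Q) (u : Bits R) {q : Q} (h : q ∉ Set.range e) :
    overwrite e x u q = x q := by
  rw [overwrite, dif_neg h]

/-- The splitting of the bits of `Q` into those on the wires `e r` and the others. -/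
def splitWires (e : R ↪ Q) : Bits Q ≃ Bits R × Bits {q // q ∉ Set.range e} where
  toFun x := (fun r => x (e r), fun q => x q)
  invFun p := overwrite e (open Classical in fun q =>
    if h : q ∉ Set.range e then p.2 ⟨q, h⟩ else false) p.1
  left_inv x := by
    funext q
    beta_reduce
    by_cases h : q ∈ Set.range e
    · obtain ⟨r, rfl⟩ := h
      rw [overwrite_apply]
    · rw [overwrite_of_notMem _ _ _ h, dif_pos h]
  right_inv p := by
    refine Prod.ext (funext fun r => ?_) (funext fun q => ?_)
    · dsimp only
      rw [overwrite_apply]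
    · dsimp only
      rw [overwrite_of_notMem _ _ _ q.2, dif_pos q.2]

/-- Sorting the wires into acted-on and idle ones turns the action into a Kronecker product with the
identity. Multiplicativity, and with it unitarity, is inherited from there. -/
lemma onWires_eq (e : R ↪ Q) [DecidableEq (Bits {q // q ∉ Set.range e})] (M : Op R) :
    onWires e M = (M ⊗ₖ (1 : Op {q // q ∉ Set.range e})).submatrix (splitWires e)
      (splitWires e) := by
  classical
  ext x y
  simp only [onWires, of_apply, submatrix_apply, splitWires, Equiv.coe_fn_mk, kroneckerMap_apply,
    one_apply, mul_ite, mul_one, mul_zero]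
  refine if_congr ?_ rfl rfl
  constructor
  · intro h
    funext q
    exact h q q.2
  · intro h q hq
    exact congrFun h ⟨q, hq⟩

lemma onWires_one [DecidableEq (Bits R)] [DecidableEq (Bits Q)] (e : R ↪ Q) :
    onWires e (1 : Op R) = 1 := by
  classical
  ext x y
  simp only [onWires, of_apply, one_apply, ← ite_and]
  refine if_congr ⟨fun ⟨h, h'⟩ => ?_, fun h => by simp [h]⟩ rfl rfl
  funext q
  by_cases hq : q ∈ Set.range e
  · obtain ⟨r, rfl⟩ := hq
    exact congrFun h' r
  · exact h q hq

lemma onWires_conjTranspose (e : R ↪ Q) (M : Op R) : onWires e Mᴴ = (onWires e M)ᴴ := by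
  classical
  ext x y
  simp only [onWires, of_apply, conjTranspose_apply, apply_ite (star : ℂ → ℂ), star_zero]
  exact if_congr (by simp only [eq_comm]) rfl rfl

lemma onWires_trans (e : R ↪ Q) (f : Q ↪ Q') (M : Op R) :
    onWires (e.trans f) M = onWires f (onWires e M) := by
  classical
  ext x y
  simp only [onWires, of_apply, Function.Embedding.trans_apply, ← ite_and]
  refine if_congr ⟨fun h => ⟨fun q hq => h q ?_, fun r hr => h _ ?_⟩, fun h q hq => ?_⟩ rfl rfl
  · rintro ⟨r, rfl⟩
    exact hq ⟨e r, rfl⟩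
  · rintro ⟨r', h'⟩
    exact hr ⟨r', f.injective h'⟩
  · by_cases hf : q ∈ Set.range f
    · obtain ⟨r, rfl⟩ := hf
      refine h.2 r ?_
      rintro ⟨r', rfl⟩
      exact hq ⟨r', rfl⟩
    · exact h.1 q hf

lemma onWires_mul [Fintype R] [DecidableEq R] [Fintype Q] [DecidableEq Q] (e : R ↪ Q)
    (M N : Op R) : onWires e (M * N) = onWires e M * onWires e N := by
  classical
  rw [onWires_eq, onWires_eq, onWires_eq, submatrix_mul_equiv, ← mul_kronecker_mul, Matrix.mul_one]

lemma onWires_mem_unitary [Fintype R] [DecidableEq R] [Fintype Q] [DecidableEq Q] (e : R ↪ Q)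
    {M : Op R} (hM : M ∈ unitaryGroup (Bits R) ℂ) : onWires e M ∈ unitaryGroup (Bits Q) ℂ := by
  rw [mem_unitaryGroup_iff, star_eq_conjTranspose, ← onWires_conjTranspose, ← onWires_mul,
    ← star_eq_conjTranspose, mem_unitaryGroup_iff.1 hM, onWires_one]

/-- A computational basis state. -/
def ket {Q : Type} (x : Bits Q) : Bits Q → ℂ := fun y => open Classical in if y = x then 1 else 0

lemma mulVec_ket [Fintype Q] [DecidableEq Q] (M : Op Q) (x : Bits Q) :
    M *ᵥ ket x = fun y => M y x := by
  funext y
  simp [mulVec, dotProduct, ket]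

/-- Explicit circuits are evaluated below on basis states rather than entrywise; this is the rule
for one gate. -/
lemma onWires_mulVec_ket [Fintype R] [DecidableEq R] [Fintype Q] [DecidableEq Q] (e : R ↪ Q)
    (M : Op R) (x : Bits Q) :
    onWires e M *ᵥ ket x = ∑ u, M u (fun r => x (e r)) • ket (overwrite e x u) := by
  classical
  rw [mulVec_ket]
  funext y
  simp only [onWires, of_apply, Finset.sum_apply, Pi.smul_apply, ket, smul_eq_mul, mul_ite,
    mul_one, mul_zero]
  split_ifs with h
  · rw [Finset.sum_eq_single (fun r => y (e r)), if_pos]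
    · funext q
      by_cases hq : q ∈ Set.range e
      · obtain ⟨r, rfl⟩ := hq
        rw [overwrite_apply]
      · rw [overwrite_of_notMem _ _ _ hq, h q hq]
    · intro u _ hu
      rw [if_neg]
      rintro rfl
      exact hu (funext fun r => (overwrite_apply e x u r).symm)
    · simp
  · refine (Finset.sum_eq_zero fun u _ => if_neg ?_).symm
    rintro rfl
    exact h fun q hq => overwrite_of_notMem _ _ _ hq

end OnWires

/-! ### Semantics and size of circuits -/

namespace Instr

variable {ι R Q Q' : Type} [Fintype R] [DecidableEq R] [Fintype Q] [DecidableEq Q]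

lemma op_mem_unitary (O : ι → UOp R) (g : Instr ι R Q) : g.op O ∈ unitaryGroup (Bits Q) ℂ := by
  cases g with
  | gate1 e u => exact onWires_mem_unitary e u.2
  | gate2 e u => exact onWires_mem_unitary e u.2
  | query i inv e =>
    refine onWires_mem_unitary e ?_
    cases inv
    · exact (O i).2
    · exact Unitary.star_mem (O i).2

omit [Fintype Q] [DecidableEq Q] in
lemma op_inverse (O : ι → UOp R) (g : Instr ι R Q) : g.inverse.op O = (g.op O)ᴴ := by
  cases g with
  | gate1 e u => exact onWires_conjTranspose e u.1
  | gate2 e u => exact onWires_conjTranspose e u.1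
  | query i inv e =>
    simp only [inverse, op, ← onWires_conjTranspose]
    cases inv <;> simp

omit [Fintype Q] [DecidableEq Q] in
lemma op_mapWires (O : ι → UOp R) (f : Q ↪ Q') (g : Instr ι R Q) :
    (g.mapWires f).op O = onWires f (g.op O) := by
  cases g <;> exact onWires_trans _ _ _

end Instr

namespace QCircuit

variable {ι κ R R' Q Q' : Type} [Fintype R] [DecidableEq R] [Fintype R'] [DecidableEq R']
  [Fintype Q] [DecidableEq Q] [Fintype Q'] [DecidableEq Q']

lemma eval_append (O : ι → UOp R) (c c' : QCircuit ι R Q) :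
    eval O (c ++ c') = eval O c' * eval O c := by
  induction c with
  | nil => simp [eval]
  | cons g c ih => rw [List.cons_append, eval, eval, ih, Matrix.mul_assoc]

lemma eval_singleton (O : ι → UOp R) (g : Instr ι R Q) : eval O [g] = g.op O := by
  simp [eval]

lemma eval_mem_unitary (O : ι → UOp R) (c : QCircuit ι R Q) :
    eval O c ∈ unitaryGroup (Bits Q) ℂ := by
  induction c with
  | nil => exact one_mem _
  | cons g c ih => exact mul_mem ih (g.op_mem_unitary O)

lemma eval_inverse (O : ι → UOp R) (c : QCircuit ι R Q) : eval O c.inverse = (eval O c)ᴴ := by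
  induction c with
  | nil => simp [inverse, eval]
  | cons g c ih =>
    have : inverse (g :: c) = inverse c ++ [g.inverse] := by simp [inverse]
    rw [this, eval_append, eval_singleton, ih, g.op_inverse, eval, conjTranspose_mul]

lemma eval_mapWires (O : ι → UOp R) (f : Q ↪ Q') (c : QCircuit ι R Q) :
    eval O (c.mapWires f) = onWires f (eval O c) := by
  induction c with
  | nil => simp [mapWires, eval, onWires_one]
  | cons g c ih =>
    have : mapWires f (g :: c) = g.mapWires f :: mapWires f c := rfl
    rw [this, eval, ih, g.op_mapWires, eval, onWires_mul]

/-- A subroutine sees only the unitary performed by `w`, and the inverse circuit performs the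
adjoint. A guarantee valid for every queried unitary therefore applies to a circuit put in place of
the oracle. -/
lemma eval_subst (O : κ → UOp R') (w : QCircuit κ R' R) (c : QCircuit Unit R Q) :
    eval O (subst w c) = eval (fun _ => ⟨eval O w, eval_mem_unitary O w⟩) c := by
  induction c with
  | nil => rfl
  | cons g c ih =>
    rw [subst, List.flatMap_cons, eval_append, eval, ← ih]
    refine congrArg (_ * ·) ?_
    cases g with
    | gate1 e u => exact eval_singleton _ _
    | gate2 e u => exact eval_singleton _ _
    | query i inv e =>
      simp only [Instr.op]
      rw [eval_mapWires]
      cases inv <;> simp [eval_inverse]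

omit [Fintype R] [DecidableEq R] [Fintype Q] [DecidableEq Q]

lemma queries_append (c c' : QCircuit ι R Q) : queries (c ++ c') = queries c + queries c' :=
  List.countP_append

lemma gates_append (c c' : QCircuit ι R Q) : gates (c ++ c') = gates c + gates c' :=
  List.countP_append

omit [Fintype Q'] [DecidableEq Q'] in
lemma queries_mapWires (f : Q ↪ Q') (c : QCircuit ι R Q) : queries (c.mapWires f) = queries c := by
  rw [queries, mapWires, List.countP_map]
  refine List.countP_congr fun g _ => ?_
  cases g <;> rfl

omit [Fintype Q'] [DecidableEq Q'] in
lemma gates_mapWires (f : Q ↪ Q') (c : QCircuit ι R Q) : gates (c.mapWires f) = gates c := by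
  rw [gates, mapWires, List.countP_map]
  refine List.countP_congr fun g _ => ?_
  cases g <;> rfl

lemma queries_inverse (c : QCircuit ι R Q) : queries c.inverse = queries c := by
  rw [queries, inverse, List.countP_reverse, List.countP_map]
  refine List.countP_congr fun g _ => ?_
  cases g <;> rfl

lemma gates_inverse (c : QCircuit ι R Q) : gates c.inverse = gates c := by
  rw [gates, inverse, List.countP_reverse, List.countP_map]
  refine List.countP_congr fun g _ => ?_
  cases g <;> rfl

omit [Fintype R'] [DecidableEq R'] in
lemma queries_subst (w : QCircuit κ R' R) (c : QCircuit Unit R Q) :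
    queries (subst w c) = queries c * queries w := by
  induction c with
  | nil => simp [subst, queries]
  | cons g c ih =>
    rw [subst, List.flatMap_cons, queries_append, ← subst, ih, ← List.singleton_append,
      queries_append, add_mul]
    congr 1
    cases g with
    | gate1 e u => simp [queries, Instr.isQuery]
    | gate2 e u => simp [queries, Instr.isQuery]
    | query i inv e =>
      have : queries [(Instr.query i inv e : Instr Unit R Q)] = 1 := rfl
      rw [this, one_mul]
      cases inv <;> simp [queries_mapWires, queries_inverse]

omit [Fintype R'] [DecidableEq R'] in
lemma gates_subst (w : QCircuit κ R' R) (c : QCircuit Unit R Q) :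
    gates (subst w c) = gates c + queries c * gates w := by
  induction c with
  | nil => simp [subst, queries, gates]
  | cons g c ih =>
    rw [subst, List.flatMap_cons, gates_append, ← subst, ih, ← List.singleton_append (l := c),
      queries_append, gates_append, add_mul]
    rw [show gates [g] + gates c + (queries [g] * gates w + queries c * gates w) =
      (gates [g] + queries [g] * gates w) + (gates c + queries c * gates w) by ring]
    congr 1
    cases g with
    | gate1 e u => simp [queries, gates, Instr.isQuery]
    | gate2 e u => simp [queries, gates, Instr.isQuery]
    | query i inv e =>
      have h1 : queries [(Instr.query i inv e : Instr Unit R Q)] = 1 := rfl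
      have h0 : gates [(Instr.query i inv e : Instr Unit R Q)] = 0 := rfl
      rw [h1, h0, one_mul, zero_add]
      cases inv <;> simp [gates_mapWires, gates_inverse]

end QCircuit

/-! ### Polynomials that are nonnegative on `[0, 1]` -/

section Degree

variable {F : Type*} [CommRing F]

/-- Strict bounds on `degree` are used instead of bounds on `natDegree` because the case `b = 0`
then forces `q = 0`; this is how the missing second square in degree 0 is handled uniformly. -/
lemma degree_mul_lt_add {p q : F[X]} {a b : ℕ} (hp : p.degree < (a + 1 : ℕ)) (hq : q.degree < b) :
    (p * q).degree < ((a + b : ℕ) : WithBot ℕ) := by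
  rw [degree_lt_iff_coeff_zero] at hp hq ⊢
  intro m hm
  rw [coeff_mul]
  refine Finset.sum_eq_zero fun x hx => ?_
  rw [Finset.HasAntidiagonal.mem_antidiagonal] at hx
  by_cases h : a + 1 ≤ x.1
  · rw [hp _ h, zero_mul]
  · rw [hq _ (by omega), mul_zero]

lemma degree_add_lt {p q : F[X]} {a : ℕ} (hp : p.degree < a) (hq : q.degree < a) :
    (p + q).degree < (a : WithBot ℕ) :=
  (degree_add_le _ _).trans_lt (max_lt hp hq)

lemma degree_sub_lt_of_lt {p q : F[X]} {a : ℕ} (hp : p.degree < a) (hq : q.degree < a) :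
    (p - q).degree < (a : WithBot ℕ) :=
  (degree_sub_le _ _).trans_lt (max_lt hp hq)

lemma degree_X_lt : (X : F[X]).degree < ((1 + 1 : ℕ) : WithBot ℕ) :=
  degree_X_le.trans_lt (by norm_cast)

lemma degree_C_lt {c : F} {k : ℕ} : (C c : F[X]).degree < ((k + 1 : ℕ) : WithBot ℕ) :=
  degree_C_le.trans_lt (by norm_cast; omega)

lemma degree_one_sub_X_lt : (1 - X : F[X]).degree < ((1 + 1 : ℕ) : WithBot ℕ) :=
  degree_sub_lt_of_lt (degree_one_le.trans_lt (by norm_cast)) degree_X_lt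

lemma degree_lt_add_of_lt {p : F[X]} {a b : ℕ} (hp : p.degree < a) (h : a ≤ b) :
    p.degree < (b : WithBot ℕ) :=
  hp.trans_le (by exact_mod_cast h)

end Degree

/-- The sums of weighted squares of degree at most `d`: `S = B² + y (1 - y) D²` with
`deg B ≤ l`, `deg D < l` if `d = 2 l`, and `S = y B² + (1 - y) D²` with `deg B ≤ l`, `deg D ≤ l` if
`d = 2 l + 1`. -/
def WeightedSquares (d : ℕ) (S : ℝ[X]) : Prop :=
  (∃ l, d = 2 * l ∧ ∃ B D : ℝ[X], B.degree < (l + 1 : ℕ) ∧ D.degree < l ∧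
    S = B ^ 2 + X * (1 - X) * D ^ 2) ∨
  ∃ l, d = 2 * l + 1 ∧ ∃ B D : ℝ[X], B.degree < (l + 1 : ℕ) ∧ D.degree < (l + 1 : ℕ) ∧
    S = X * B ^ 2 + (1 - X) * D ^ 2

namespace WeightedSquares

/-- The two forms are |B + i√(y(1-y)) D|² and |√y B + i√(1-y) D|². Absolute values multiply, and
expanding the product of one factor with the conjugate of the other gives the new pair of squares,
with the parity of the degree deciding the form. -/
lemma mul_of_one {f g : ℝ[X]} {d : ℕ} (hf : WeightedSquares 1 f) (hg : WeightedSquares d g) :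
    WeightedSquares (d + 1) (f * g) := by
  obtain ⟨l, hl, -⟩ | ⟨l, hl, B, D, hB, hD, rfl⟩ := hf
  · omega
  obtain rfl : l = 0 := by omega
  obtain ⟨l, rfl, B', D', hB', hD', rfl⟩ | ⟨l, rfl, B', D', hB', hD', rfl⟩ := hg
  · refine .inr ⟨l, rfl, B * B' + (1 - X) * (D * D'), D * B' - X * (B * D'), ?_, ?_, by ring⟩
    · refine degree_add_lt ?_ ?_
      · exact degree_lt_add_of_lt (degree_mul_lt_add hB hB') (by omega)
      · exact degree_lt_add_of_lt (degree_mul_lt_add degree_one_sub_X_lt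
          (degree_mul_lt_add hD hD')) (by omega)
    · refine degree_sub_lt_of_lt ?_ ?_
      · exact degree_lt_add_of_lt (degree_mul_lt_add hD hB') (by omega)
      · exact degree_lt_add_of_lt (degree_mul_lt_add degree_X_lt
          (degree_mul_lt_add hB hD')) (by omega)
  · refine .inl ⟨l + 1, by ring, X * (B * B') + (1 - X) * (D * D'), B * D' - D * B', ?_, ?_,
      by ring⟩
    · refine degree_add_lt ?_ ?_
      · exact degree_lt_add_of_lt (degree_mul_lt_add degree_X_lt
          (degree_mul_lt_add hB hB')) (by omega)
      · exact degree_lt_add_of_lt (degree_mul_lt_add degree_one_sub_X_lt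
          (degree_mul_lt_add hD hD')) (by omega)
    · refine degree_sub_lt_of_lt ?_ ?_
      · exact degree_lt_add_of_lt (degree_mul_lt_add hB hD') (by omega)
      · exact degree_lt_add_of_lt (degree_mul_lt_add hD hB') (by omega)

lemma mul_of_two {f g : ℝ[X]} {d : ℕ} (hf : WeightedSquares 2 f) (hg : WeightedSquares d g) :
    WeightedSquares (d + 2) (f * g) := by
  obtain ⟨l, hl, B, D, hB, hD, rfl⟩ | ⟨l, hl, -⟩ := hf
  swap
  · omega
  obtain rfl : l = 1 := by omega
  obtain ⟨l, rfl, B', D', hB', hD', rfl⟩ | ⟨l, rfl, B', D', hB', hD', rfl⟩ := hg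
  · refine .inl ⟨l + 1, by ring, B * B' + X * ((1 - X) * (D * D')), D * B' - B * D', ?_, ?_,
      by ring⟩
    · refine degree_add_lt ?_ ?_
      · exact degree_lt_add_of_lt (degree_mul_lt_add hB hB') (by omega)
      · exact degree_lt_add_of_lt (degree_mul_lt_add degree_X_lt (degree_mul_lt_add
          degree_one_sub_X_lt (degree_mul_lt_add (a := 0) (by simpa using hD) hD'))) (by omega)
    · refine degree_sub_lt_of_lt ?_ ?_
      · exact degree_lt_add_of_lt (degree_mul_lt_add (a := 0) (by simpa using hD) hB') (by omega)
      · exact degree_lt_add_of_lt (degree_mul_lt_add hB hD') (by omega)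
  · refine .inr ⟨l + 1, by ring, B * B' + (1 - X) * (D * D'), B * D' - X * (D * B'), ?_, ?_,
      by ring⟩
    · refine degree_add_lt ?_ ?_
      · exact degree_lt_add_of_lt (degree_mul_lt_add hB hB') (by omega)
      · exact degree_lt_add_of_lt (degree_mul_lt_add
          degree_one_sub_X_lt (degree_mul_lt_add (a := 0) (by simpa using hD) hD')) (by omega)
    · refine degree_sub_lt_of_lt ?_ ?_
      · exact degree_lt_add_of_lt (degree_mul_lt_add hB hD') (by omega)
      · exact degree_lt_add_of_lt (degree_mul_lt_add degree_X_lt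
          (degree_mul_lt_add (a := 0) (by simpa using hD) hB')) (by omega)

lemma linear {a b : ℝ} (ha : 0 ≤ a) (hb : 0 ≤ b) : WeightedSquares 1 (C a * X + C b * (1 - X)) :=
  .inr ⟨0, rfl, C √a, C √b, degree_C_lt, degree_C_lt, by
    rw [← C_pow, ← C_pow, Real.sq_sqrt ha, Real.sq_sqrt hb]; ring⟩

lemma const {a : ℝ} (ha : 0 ≤ a) : WeightedSquares 0 (C a) :=
  .inl ⟨0, rfl, C √a, 0, degree_C_lt, by simp, by
    rw [← C_pow, Real.sq_sqrt ha]; ring⟩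

lemma sq_linear (r : ℝ) : WeightedSquares 2 ((X - C r) ^ 2) :=
  .inl ⟨1, rfl, X - C r, 0, degree_sub_lt_of_lt degree_X_lt degree_C_lt, by simp, by ring⟩

/-- Here s and t are the distances of the root a + ib to 0 and to 1. The linear polynomial with
values -s at 0 and t at 1 has the right square at both end points, so the remainder is a multiple of
y(1-y). Its coefficient (s+t)² - 1 is non-negative because s + t ≥ 1, the triangle inequality. -/
lemma quadratic (a b : ℝ) : WeightedSquares 2 ((X - C a) ^ 2 + C (b ^ 2)) := by
  set s := √(a ^ 2 + b ^ 2) with hs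
  set t := √((1 - a) ^ 2 + b ^ 2) with ht
  have hs2 : s ^ 2 = a ^ 2 + b ^ 2 := Real.sq_sqrt (by positivity)
  have ht2 : t ^ 2 = (1 - a) ^ 2 + b ^ 2 := Real.sq_sqrt (by positivity)
  have hsa : a ≤ s := Real.le_sqrt_of_sq_le (by nlinarith [sq_nonneg b])
  have hta : 1 - a ≤ t := Real.le_sqrt_of_sq_le (by nlinarith [sq_nonneg b])
  have hc : 0 ≤ (s + t) ^ 2 - 1 := by nlinarith
  have hc2 : √((s + t) ^ 2 - 1) ^ 2 = (s + t) ^ 2 - 1 := Real.sq_sqrt hc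
  refine .inl ⟨1, rfl, C (s + t) * X - C s, C √((s + t) ^ 2 - 1), ?_, by
    simpa using degree_C_lt (F := ℝ) (k := 0), ?_⟩
  · exact degree_sub_lt_of_lt (degree_lt_add_of_lt
      (degree_mul_lt_add (a := 0) degree_C_lt degree_X_lt) (by omega)) degree_C_lt
  · rw [← C_pow, hc2]
    refine Polynomial.funext fun y => ?_
    simp only [eval_add, eval_sub, eval_mul, eval_pow, eval_X, eval_C, eval_one]
    linear_combination (y - 1) * hs2 - y * ht2

end WeightedSquares

/-- After division by a factor that vanishes at r the sign of the quotient is known only away from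
r; continuity supplies the missing point. -/
lemma eval_nonneg_of_forall_ne {g : ℝ[X]} {r : ℝ}
    (h : ∀ y ∈ Set.Icc (0 : ℝ) 1, y ≠ r → 0 ≤ g.eval y) {y : ℝ} (hy : y ∈ Set.Icc (0 : ℝ) 1) :
    0 ≤ g.eval y := by
  have hcl : y ∈ closure (Set.Ioo (0 : ℝ) 1 ∩ {r}ᶜ) := by
    have hd : Dense ({r}ᶜ : Set ℝ) := dense_compl_singleton r
    have := closure_mono (hd.open_subset_closure_inter (isOpen_Ioo (a := (0 : ℝ)) (b := 1)))
    rw [closure_closure, closure_Ioo zero_ne_one] at this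
    exact this hy
  have hc : IsClosed {y | 0 ≤ g.eval y} := isClosed_le continuous_const g.continuous
  refine closure_minimal ?_ hc hcl
  rintro z ⟨hz, hzr⟩
  exact h z (Set.Ioo_subset_Icc_self hz) hzr

/-- Lukács' theorem, by induction on the degree: split off a monic irreducible factor. A real root
outside (0, 1) gives a linear factor of constant sign, a root inside (0, 1) must be at least double,
and a factor without real roots is a positive quadratic. Each of these is a weighted square, and
weighted squares multiply. -/
theorem weightedSquares_of_nonneg (d : ℕ) : ∀ S : ℝ[X], S.natDegree ≤ d →
    (∀ y ∈ Set.Icc (0 : ℝ) 1, 0 ≤ S.eval y) → WeightedSquares d S := by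
  induction d using Nat.strong_induction_on with
  | _ d ih =>
  intro S hd hS
  rcases Nat.eq_zero_or_pos d with rfl | hd0
  · obtain ⟨c, rfl⟩ := natDegree_eq_zero.1 (Nat.le_zero.1 hd)
    exact .const (by simpa using hS 0 (by simp))
  obtain ⟨d, rfl⟩ : ∃ k, d = k + 1 := ⟨d - 1, by omega⟩
  -- The identity 1 = y + (1 - y) raises the formal degree by one when S has smaller degree than
  -- allowed.
  have one : WeightedSquares 1 (1 : ℝ[X]) := by
    simpa using WeightedSquares.linear zero_le_one zero_le_one
  by_cases hlt : S.natDegree ≤ d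
  · simpa using one.mul_of_one (ih d (by omega) S hlt hS)
  have hdeg : S.natDegree = d + 1 := by omega
  have hS0 : S ≠ 0 := by rintro rfl; simp at hdeg
  have hunit : ¬ IsUnit S := fun h => by rw [natDegree_eq_zero_of_isUnit h] at hdeg; omega
  obtain ⟨f, hfm, hfi, g, rfl⟩ := exists_monic_irreducible_factor S hunit
  have hg0 : g ≠ 0 := right_ne_zero_of_mul hS0
  have hadd : f.natDegree + g.natDegree = d + 1 := by
    rw [← hdeg, natDegree_mul hfm.ne_zero hg0]
  have hf2 : f.natDegree ≤ 2 := natDegree_le_of_degree_le hfi.degree_le_two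
  have hf1 : 0 < f.natDegree := hfi.natDegree_pos
  rcases (by omega : f.natDegree = 1 ∨ f.natDegree = 2) with h1 | h2
  · obtain ⟨r, rfl⟩ : ∃ r, f = X - C r := ⟨-f.coeff 0, by
      rw [C_neg, sub_neg_eq_add, ← hfm.eq_X_add_C h1]⟩
    simp only [eval_mul, eval_sub, eval_X, eval_C] at hS
    rcases le_or_gt r 0 with hr | hr
    · have hX : (X - C r : ℝ[X]) = C (1 - r) * X + C (-r) * (1 - X) := by
        simp only [C_sub, C_neg, C_1]; ring
      rw [hX]
      refine (WeightedSquares.linear (by linarith) (by linarith)).mul_of_one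
        (ih d (by omega) g (by omega) fun y hy => eval_nonneg_of_forall_ne (r := r) ?_ hy)
      intro y hy hne
      have : 0 < y - r := lt_of_le_of_ne (by linarith [hy.1]) (sub_ne_zero.2 hne).symm
      exact nonneg_of_mul_nonneg_right (hS y hy) this
    rcases le_or_gt 1 r with hr1 | hr1
    · have hX : (X - C r) * g = (C (r - 1) * X + C r * (1 - X)) * (-g) := by
        simp only [C_sub, C_1]; ring
      rw [hX]
      refine (WeightedSquares.linear (by linarith) (by linarith)).mul_of_one
        (ih d (by omega) (-g) (by rw [natDegree_neg]; omega)
          fun y hy => eval_nonneg_of_forall_ne (r := r) ?_ hy)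
      intro y hy hne
      have : 0 < r - y := lt_of_le_of_ne (by linarith [hy.2]) (sub_ne_zero.2 hne.symm).symm
      refine nonneg_of_mul_nonneg_right (a := r - y) ?_ this
      rw [eval_neg]
      linarith [hS y hy]
    -- The factor y - r changes sign at the interior point r while the product does not, so the
    -- cofactor is ≤ 0 just below r and ≥ 0 just above it.
    · have hgr : g.eval r = 0 := by
        refine le_antisymm ?_ ?_
        · by_contra! hpos
          have hev : ∀ᶠ y in nhds r, 0 < g.eval y ∧ 0 < y :=
            (g.continuous.continuousAt.eventually (lt_mem_nhds hpos)).and (lt_mem_nhds hr)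
          obtain ⟨y, ⟨hy1, hy0⟩, hyr⟩ := (hev.filter_mono nhdsWithin_le_nhds |>.and
            (self_mem_nhdsWithin (s := Set.Iio r))).exists
          have hyr' : y < r := hyr
          nlinarith [hS y ⟨hy0.le, by linarith⟩]
        · by_contra! hneg
          have hev : ∀ᶠ y in nhds r, g.eval y < 0 ∧ y < 1 :=
            (g.continuous.continuousAt.eventually (gt_mem_nhds hneg)).and (gt_mem_nhds hr1)
          obtain ⟨y, ⟨hy1, hy0⟩, hyr⟩ := (hev.filter_mono nhdsWithin_le_nhds |>.and
            (self_mem_nhdsWithin (s := Set.Ioi r))).exists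
          have hyr' : r < y := hyr
          nlinarith [hS y ⟨by linarith, hy0.le⟩]
      obtain ⟨h, rfl⟩ := dvd_iff_isRoot.2 hgr
      have hh0 : h ≠ 0 := right_ne_zero_of_mul hg0
      rw [natDegree_mul (X_sub_C_ne_zero r) hh0, natDegree_X_sub_C] at hadd
      rw [← mul_assoc, ← sq]
      obtain ⟨e, rfl⟩ : ∃ e, d = e + 1 := ⟨d - 1, by omega⟩
      refine (WeightedSquares.sq_linear r).mul_of_two
        (ih e (by omega) h (by omega) fun y hy => eval_nonneg_of_forall_ne (r := r) ?_ hy)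
      intro y hy hne
      have hp : 0 < (y - r) ^ 2 := by have := sub_ne_zero.2 hne; positivity
      refine nonneg_of_mul_nonneg_right (a := (y - r) ^ 2) ?_ hp
      have := hS y hy
      simp only [eval_mul, eval_sub, eval_X, eval_C] at this
      linarith
  · have hfe : f = X ^ 2 + C (f.coeff 1) * X + C (f.coeff 0) := by
      conv_lhs => rw [hfm.as_sum, h2]
      simp [Finset.sum_range_succ]
      ring
    have hno : ∀ y, f.eval y ≠ 0 := fun y hy =>
      hfi.not_isRoot_of_natDegree_ne_one (by omega) hy
    set p := f.coeff 1
    set q := f.coeff 0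
    have hdisc : 0 < q - (p / 2) ^ 2 := by
      by_contra! hle
      refine hno (-(p / 2) + √((p / 2) ^ 2 - q)) ?_
      rw [hfe]
      simp only [eval_add, eval_mul, eval_pow, eval_X, eval_C]
      linear_combination Real.sq_sqrt (show 0 ≤ (p / 2) ^ 2 - q by linarith)
    have hfq : f = (X - C (-(p / 2))) ^ 2 + C (√(q - (p / 2) ^ 2) ^ 2) := by
      rw [Real.sq_sqrt hdisc.le]
      refine Polynomial.funext fun y => ?_
      rw [hfe]
      simp only [eval_add, eval_sub, eval_mul, eval_pow, eval_X, eval_C]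
      ring
    have hfpos : ∀ y, 0 < f.eval y := by
      intro y
      rw [hfe]
      simp only [eval_add, eval_mul, eval_pow, eval_X, eval_C]
      nlinarith [sq_nonneg (y + p / 2)]
    obtain ⟨e, rfl⟩ : ∃ e, d = e + 1 := ⟨d - 1, by omega⟩
    have hgn : ∀ y ∈ Set.Icc (0 : ℝ) 1, 0 ≤ g.eval y := fun y hy => by
      have := hS y hy
      rw [eval_mul] at this
      exact nonneg_of_mul_nonneg_right this (hfpos y)
    rw [hfq]
    exact (WeightedSquares.quadratic _ _).mul_of_two (ih e (by omega) g (by omega) hgn)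

/-! ### Odd polynomials that approximate the sign function -/

/-- The polynomials with `sin θ · r_k(sin² θ) = sin ((2 k + 1) θ)`. -/
def sinePoly : ℕ → ℝ[X]
  | 0 => 1
  | 1 => C 3 - C 4 * X
  | k + 2 => (C 2 - C 4 * X) * sinePoly (k + 1) - sinePoly k

lemma sin_mul_eval_sinePoly (θ : ℝ) : ∀ k : ℕ,
    Real.sin θ * (sinePoly k).eval (Real.sin θ ^ 2) = Real.sin ((2 * k + 1) * θ)
  | 0 => by simp [sinePoly]
  | 1 => by
    have := Real.sin_three_mul θ
    simp only [sinePoly, eval_sub, eval_mul, eval_C, eval_X]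
    rw [show ((2 * ((1 : ℕ) : ℝ) + 1) * θ) = 3 * θ by push_cast; ring, this]
    ring
  | k + 2 => by
    have h1 := sin_mul_eval_sinePoly θ (k + 1)
    have h0 := sin_mul_eval_sinePoly θ k
    have hs : Real.sin ((2 * (k + 2 : ℕ) + 1) * θ) + Real.sin ((2 * (k : ℕ) + 1) * θ) =
        2 * Real.sin ((2 * (k + 1 : ℕ) + 1) * θ) * Real.cos (2 * θ) := by
      rw [show ((2 * ((k + 2 : ℕ) : ℝ) + 1) * θ) = (2 * (k + 1 : ℕ) + 1) * θ + 2 * θ by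
        push_cast; ring, show ((2 * (k : ℝ) + 1) * θ) = (2 * (k + 1 : ℕ) + 1) * θ - 2 * θ by
        push_cast; ring, Real.sin_add, Real.sin_sub]
      ring
    have hc : Real.cos (2 * θ) = 1 - 2 * Real.sin θ ^ 2 := by
      rw [Real.cos_two_mul, Real.cos_sq']; ring
    simp only [sinePoly, eval_sub, eval_mul, eval_C, eval_X]
    rw [hc] at hs
    linear_combination (2 - 4 * Real.sin θ ^ 2) * h1 - h0 - hs

lemma sinePoly_degree : ∀ k : ℕ, (sinePoly k).degree < ((k + 1 : ℕ) : WithBot ℕ) ∧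
    (sinePoly k).coeff k = (-4) ^ k
  | 0 => by simp [sinePoly]
  | 1 => by
    refine ⟨degree_sub_lt_of_lt degree_C_lt (degree_lt_add_of_lt
      (degree_mul_lt_add (a := 0) degree_C_lt degree_X_lt) le_rfl), ?_⟩
    simp [sinePoly, coeff_C]
  | k + 2 => by
    obtain ⟨hd, hc⟩ := sinePoly_degree (k + 1)
    obtain ⟨hd', -⟩ := sinePoly_degree k
    have hl : (C 2 - C 4 * X : ℝ[X]).degree < ((1 + 1 : ℕ) : WithBot ℕ) :=
      degree_sub_lt_of_lt degree_C_lt (degree_lt_add_of_lt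
        (degree_mul_lt_add (a := 0) degree_C_lt degree_X_lt) le_rfl)
    refine ⟨degree_sub_lt_of_lt (degree_lt_add_of_lt (degree_mul_lt_add hl hd) (by omega))
      (degree_lt_add_of_lt hd' (by omega)), ?_⟩
    rw [degree_lt_iff_coeff_zero] at hd hd'
    rw [sinePoly, coeff_sub, sub_mul, coeff_sub, coeff_C_mul, mul_assoc, coeff_C_mul,
      coeff_X_mul, hc, hd _ le_rfl, hd' _ (by omega)]
    ring

lemma natDegree_sinePoly (k : ℕ) : (sinePoly k).natDegree = k := by
  obtain ⟨hd, hc⟩ := sinePoly_degree k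
  refine natDegree_eq_of_le_of_coeff_ne_zero ?_ (by rw [hc]; positivity)
  rw [degree_lt_iff_coeff_zero] at hd
  exact natDegree_le_iff_coeff_eq_zero.2 fun m hm => hd m hm

/-- The polynomial `p` such that `x p(x²)` is the antiderivative of `k(x²)`. -/
def oddAntideriv (k : ℝ[X]) : ℝ[X] :=
  ∑ i ∈ Finset.range (k.natDegree + 1), monomial i (k.coeff i / (2 * i + 1))

lemma coeff_oddAntideriv (k : ℝ[X]) (i : ℕ) :
    (oddAntideriv k).coeff i = k.coeff i / (2 * i + 1) := by
  rw [oddAntideriv, finsetSum_coeff]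
  simp only [coeff_monomial, Finset.sum_ite_eq', Finset.mem_range]
  split_ifs with h
  · rfl
  · rw [coeff_eq_zero_of_natDegree_lt (by omega), zero_div]

lemma natDegree_oddAntideriv (k : ℝ[X]) : (oddAntideriv k).natDegree = k.natDegree := by
  by_cases hk : k = 0
  · simp [hk, oddAntideriv]
  refine natDegree_eq_of_le_of_coeff_ne_zero ?_ ?_
  · exact natDegree_le_iff_coeff_eq_zero.2 fun m hm => by
      rw [coeff_oddAntideriv, coeff_eq_zero_of_natDegree_lt hm, zero_div]
  · rw [coeff_oddAntideriv]
    exact div_ne_zero (leadingCoeff_ne_zero.2 hk) (by positivity)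

/-- With y = x², the derivative of x p(x²) is p(y) + 2y p'(y); this is the coefficientwise check
that it equals k(y). -/
lemma oddAntideriv_add_derivative (k : ℝ[X]) :
    oddAntideriv k + 2 * X * derivative (oddAntideriv k) = k := by
  ext i
  rw [coeff_add, mul_assoc, coeff_ofNat_mul, coeff_oddAntideriv]
  cases i with
  | zero => simp
  | succ i =>
    rw [coeff_X_mul, coeff_derivative, coeff_oddAntideriv]
    push_cast
    field_simp
    ring

lemma hasDerivAt_oddAntideriv (k : ℝ[X]) (x : ℝ) :
    HasDerivAt (fun x => x * (oddAntideriv k).eval (x ^ 2)) (k.eval (x ^ 2)) x := by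
  have h1 : HasDerivAt (fun x : ℝ => (oddAntideriv k).eval (x ^ 2))
      ((derivative (oddAntideriv k)).eval (x ^ 2) * (2 * x)) x := by
    have := ((oddAntideriv k).hasDerivAt (x ^ 2)).comp x (hasDerivAt_pow 2 x)
    simpa [Function.comp_def] using this
  have h2 := (hasDerivAt_id x).mul h1
  refine h2.congr_deriv ?_
  conv_rhs => rw [← oddAntideriv_add_derivative k]
  simp
  ring

lemma abs_mul_eval_sinePoly_le (k : ℕ) {t : ℝ} (ht : |t| ≤ 1) :
    |t * (sinePoly k).eval (t ^ 2)| ≤ 1 := by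
  obtain ⟨h1, h2⟩ := abs_le.1 ht
  rw [← Real.sin_arcsin h1 h2, sin_mul_eval_sinePoly]
  exact Real.abs_sin_le_one _

/-- Jordan's inequality sin u ≥ 2u/π is used twice: first for θ = arcsin t, to see that (2k+1)θ is
still at most π/2, and then for (2k+1)θ itself. The bound π ≤ 4 turns 2/π into 1/2. -/
lemma le_eval_sinePoly (k : ℕ) {t : ℝ} (ht : 0 < t) (ht' : t * (2 * k + 1) ≤ 1) :
    (2 * k + 1 : ℝ) / 2 ≤ (sinePoly k).eval (t ^ 2) := by
  have hk : (1 : ℝ) ≤ 2 * k + 1 := by linarith [(Nat.cast_nonneg k : (0 : ℝ) ≤ k)]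
  have ht1 : t ≤ 1 := by nlinarith
  set θ := Real.arcsin t with hθ
  have hs : Real.sin θ = t := Real.sin_arcsin (by linarith) ht1
  have hθ0 : 0 < θ := Real.arcsin_pos.2 ht
  have hpi := Real.pi_pos
  have h4 := Real.pi_le_four
  have h1 : 2 / Real.pi * θ ≤ t := hs ▸ Real.mul_le_sin hθ0.le (Real.arcsin_le_pi_div_two t)
  have hle : (2 * k + 1) * θ ≤ Real.pi / 2 := by
    have : θ ≤ Real.pi / 2 * t := by
      rw [div_mul_eq_mul_div, div_le_iff₀ hpi] at h1
      linarith
    nlinarith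
  have h2 := Real.mul_le_sin (x := (2 * k + 1) * θ) (by positivity) hle
  have h3 := sin_mul_eval_sinePoly θ k
  rw [hs] at h3
  have h5 : t ≤ θ := hs ▸ Real.sin_le hθ0.le
  have h6 : 1 / 2 ≤ 2 / Real.pi := by
    rw [div_le_div_iff₀ two_pos hpi]; linarith
  have h7 : t * ((2 * k + 1) / 2) ≤ t * (sinePoly k).eval (t ^ 2) := by
    rw [h3]
    refine le_trans ?_ h2
    calc t * ((2 * k + 1) / 2) ≤ θ * ((2 * k + 1) / 2) := by gcongr
      _ = 1 / 2 * ((2 * k + 1) * θ) := by ring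
      _ ≤ _ := by gcongr
  exact le_of_mul_le_mul_left h7 ht

/-- An unnormalized odd polynomial with a steep step at the origin. -/
def stepFun (k i : ℕ) (x : ℝ) : ℝ :=
  x * (oddAntideriv (sinePoly k ^ (2 * i + 2))).eval (x ^ 2)

lemma hasDerivAt_stepFun (k i : ℕ) (x : ℝ) :
    HasDerivAt (stepFun k i) ((sinePoly k).eval (x ^ 2) ^ (2 * i + 2)) x := by
  have := hasDerivAt_oddAntideriv (sinePoly k ^ (2 * i + 2)) x
  rwa [eval_pow] at this

lemma differentiable_stepFun (k i : ℕ) : Differentiable ℝ (stepFun k i) :=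
  fun x => (hasDerivAt_stepFun k i x).differentiableAt

lemma stepFun_monotone (k i : ℕ) : Monotone (stepFun k i) :=
  monotone_of_deriv_nonneg (differentiable_stepFun k i) fun x => by
    rw [(hasDerivAt_stepFun k i x).deriv]
    exact Even.pow_nonneg ⟨i + 1, by ring⟩ _

lemma stepFun_zero (k i : ℕ) : stepFun k i 0 = 0 := by simp [stepFun]

lemma stepFun_neg (k i : ℕ) (x : ℝ) : stepFun k i (-x) = -stepFun k i x := by
  simp [stepFun]

/-- Only the peak is counted: with N = 2k + 1 the kernel is at least N/2 on (0, 1/N), and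
monotonicity extends the resulting increase to the point 1. -/
lemma le_stepFun_one (k i : ℕ) :
    1 / 2 * ((2 * k + 1 : ℝ) / 2) ^ (2 * i + 1) ≤ stepFun k i 1 := by
  have hk : (1 : ℝ) ≤ 2 * k + 1 := by linarith [(Nat.cast_nonneg k : (0 : ℝ) ≤ k)]
  set N : ℝ := 2 * k + 1 with hN
  have hN1 : 1 / N ≤ 1 := by rw [div_le_one (by positivity)]; exact hk
  have h := (convex_Icc (0 : ℝ) (1 / N)).mul_sub_le_image_sub_of_le_deriv
    (f := stepFun k i) (C := (N / 2) ^ (2 * i + 2))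
    (differentiable_stepFun k i).continuous.continuousOn
    (differentiable_stepFun k i).differentiableOn (fun t ht => ?_)
    0 ⟨le_rfl, by positivity⟩ (1 / N) ⟨by positivity, le_rfl⟩ (by positivity)
  · rw [stepFun_zero, sub_zero, sub_zero] at h
    refine le_trans (le_of_eq ?_) (h.trans (stepFun_monotone k i hN1))
    rw [pow_succ _ (2 * i + 1)]
    field_simp
  · rw [interior_Icc] at ht
    rw [(hasDerivAt_stepFun k i t).deriv]
    have := le_eval_sinePoly k ht.1 (by
      have := ht.2.le
      rwa [le_div_iff₀ (by positivity)] at this)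
    gcongr

/-- On [β, 1] the derivative is at most t^-(2i+2) ≤ β^-(2i) t^-2. Adding β^-(2i)/t, a primitive of
the negative of this bound, makes the step function antitone, which replaces an integral estimate.
-/
lemma stepFun_one_sub_le (k i : ℕ) {β x : ℝ} (hβ : 0 < β) (hx : β ≤ x) (hx1 : x ≤ 1) :
    stepFun k i 1 - stepFun k i x ≤ (1 / β) ^ (2 * i + 1) := by
  set c : ℝ := (1 / β) ^ (2 * i) with hc
  have hc0 : 0 < c := by positivity
  have hd : ∀ t : ℝ, β ≤ t → HasDerivAt (fun t => stepFun k i t + c * t⁻¹)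
      ((sinePoly k).eval (t ^ 2) ^ (2 * i + 2) + c * (-(t ^ 2)⁻¹)) t := fun t ht =>
    (hasDerivAt_stepFun k i t).add ((hasDerivAt_inv (by linarith)).const_mul c)
  have hanti : AntitoneOn (fun t => stepFun k i t + c * t⁻¹) (Set.Icc β 1) := by
    refine antitoneOn_of_deriv_nonpos (convex_Icc _ _)
      (fun t ht => (hd t ht.1).continuousAt.continuousWithinAt)
      (fun t ht => ?_) fun t ht => ?_
    · rw [interior_Icc] at ht
      exact (hd t ht.1.le).differentiableAt.differentiableWithinAt
    · rw [interior_Icc] at ht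
      have ht0 : 0 < t := hβ.trans ht.1
      rw [(hd t ht.1.le).deriv]
      have h1 : |(sinePoly k).eval (t ^ 2)| ≤ 1 / t := by
        have := abs_mul_eval_sinePoly_le k (t := t) (by rw [abs_of_pos ht0]; exact ht.2.le)
        rw [abs_mul, abs_of_pos ht0] at this
        rw [le_div_iff₀ ht0]
        linarith
      have h2 : (sinePoly k).eval (t ^ 2) ^ (2 * i + 2) ≤ (1 / t) ^ (2 * i + 2) := by
        rw [← Even.pow_abs ⟨i + 1, by ring⟩]
        gcongr
      have h3 : (1 / t) ^ (2 * i + 2) ≤ c * (t ^ 2)⁻¹ := by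
        rw [pow_add, hc]
        have : (1 / t) ^ 2 = (t ^ 2)⁻¹ := by rw [one_div, inv_pow]
        rw [this]
        gcongr
        exact ht.1.le
      linarith
  have h := hanti ⟨hx, hx1⟩ ⟨hx.trans hx1, le_rfl⟩ hx1
  simp only [inv_one, mul_one] at h
  have h4 : c * x⁻¹ ≤ (1 / β) ^ (2 * i + 1) := by
    rw [pow_succ, ← hc, one_div]
    gcongr
  linarith

/-- An odd polynomial `x p(x²)` of degree `O(1/β log(1/δ))` that is bounded by `1` on `[-1, 1]` and
`δ`-close to the sign function for `β ≤ |x| ≤ 1`. -/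
theorem exists_sign_polynomial {δ β : ℝ} (hδ : 0 < δ) (hδ2 : δ < 1 / 2) (hβ : 0 < β)
    (hβ1 : β ≤ 1) :
    ∃ p : ℝ[X], p ≠ 0 ∧ (2 * p.natDegree + 1 : ℝ) ≤ 100 * (1 / β * Real.log (1 / δ)) ∧
      (∀ x : ℝ, |x| ≤ 1 → |x * p.eval (x ^ 2)| ≤ 1) ∧
      ∀ x : ℝ, β ≤ |x| → |x| ≤ 1 → |x * p.eval (x ^ 2) - Real.sign x| ≤ δ := by
  -- This k makes the peak height (2k+1)/2 at least 2/β, twice the base of the tail bound. Each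
  -- power thus gains a factor 2, and i ≥ log(1/δ) powers of 4 beat 1/δ because e ≤ 4.
  set k := ⌈2 / β⌉₊ with hk
  set L := Real.log (1 / δ) with hL
  set i := ⌈L⌉₊ with hi
  have hL0 : 1 / 2 < L := by
    have h2 : Real.log 2 ≤ L :=
      Real.log_le_log two_pos (by rw [le_div_iff₀ hδ]; linarith)
    linarith [Real.log_two_gt_d9]
  have hk1 : 2 / β ≤ k := Nat.le_ceil _
  have hk2 : (k : ℝ) < 2 / β + 1 := Nat.ceil_lt_add_one (by positivity)
  have hi1 : L ≤ i := Nat.le_ceil _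
  have hi2 : (i : ℝ) < L + 1 := Nat.ceil_lt_add_one (by linarith)
  have hβ' : 1 ≤ 1 / β := by rw [le_div_iff₀ hβ]; linarith
  set A := stepFun k i 1 with hA
  have hA1 := le_stepFun_one k i
  have hA0 : 0 < A := lt_of_lt_of_le (by positivity) hA1
  have htail : (1 / β) ^ (2 * i + 1) ≤ δ * A := by
    have hu : 2 * (1 / β) ≤ (2 * k + 1 : ℝ) / 2 := by
      rw [show 2 * (1 / β) = 2 / β by ring]; linarith
    have h1 : (2 * (1 / β)) ^ (2 * i + 1) ≤ ((2 * k + 1 : ℝ) / 2) ^ (2 * i + 1) := by gcongr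
    have h2 : 1 ≤ δ * 4 ^ i := by
      have h3 : Real.exp L ≤ 4 ^ i := by
        calc Real.exp L ≤ Real.exp i := Real.exp_le_exp.2 hi1
          _ = Real.exp 1 ^ i := by rw [← Real.exp_nat_mul, mul_one]
          _ ≤ 4 ^ i := by gcongr; linarith [Real.exp_one_lt_d9]
      rw [hL, Real.exp_log (by positivity)] at h3
      calc (1 : ℝ) = δ * (1 / δ) := by field_simp
        _ ≤ _ := by gcongr
    calc (1 / β) ^ (2 * i + 1) ≤ (δ * 4 ^ i) * (1 / β) ^ (2 * i + 1) :=
          le_mul_of_one_le_left (by positivity) h2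
      _ = δ * (1 / 2 * (2 * (1 / β)) ^ (2 * i + 1)) := by
          rw [mul_pow 2, pow_succ (2 : ℝ), pow_mul]; norm_num; ring
      _ ≤ δ * (1 / 2 * ((2 * k + 1 : ℝ) / 2) ^ (2 * i + 1)) := by gcongr
      _ ≤ δ * A := by gcongr
  have heval : ∀ x : ℝ, x * (C A⁻¹ * oddAntideriv (sinePoly k ^ (2 * i + 2))).eval (x ^ 2) =
      stepFun k i x / A := fun x => by
    rw [eval_mul, eval_C, stepFun]; field_simp
  have hdeg : (C A⁻¹ * oddAntideriv (sinePoly k ^ (2 * i + 2))).natDegree = (2 * i + 2) * k := by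
    rw [natDegree_C_mul (inv_ne_zero hA0.ne'), natDegree_oddAntideriv, natDegree_pow,
      natDegree_sinePoly]
  have hmain : ∀ x, β ≤ x → x ≤ 1 → |stepFun k i x / A - 1| ≤ δ := fun x hx hx1 => by
    have h1 := stepFun_one_sub_le k i hβ hx hx1
    have h2 := stepFun_monotone k i hx1
    rw [div_sub_one hA0.ne', abs_div, abs_of_pos hA0, div_le_iff₀ hA0, abs_sub_comm,
      abs_of_nonneg (sub_nonneg.2 h2)]
    linarith
  refine ⟨C A⁻¹ * oddAntideriv (sinePoly k ^ (2 * i + 2)), ?_, ?_, fun x hx => ?_,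
    fun x hx hx1 => ?_⟩
  · intro h0
    have := heval 1
    rw [h0, eval_zero, mul_zero, ← hA, div_self hA0.ne'] at this
    exact zero_ne_one this
  · rw [hdeg]
    push_cast
    have h1 : (k : ℝ) ≤ 3 * (1 / β) := by
      have : 2 / β = 2 * (1 / β) := by ring
      linarith
    -- Since i < L + 1, this needs 4 ≤ 8L, that is L ≥ 1/2, which comes from δ < 1/2.
    have h2 : (2 * i + 2 : ℝ) ≤ 10 * L := by linarith
    have h3 : (2 * i + 2 : ℝ) * k ≤ 10 * L * (3 * (1 / β)) := by gcongr
    have h4 : L ≤ 1 / β * L := le_mul_of_one_le_left (by linarith) hβ'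
    nlinarith
  · rw [heval, abs_div, abs_of_pos hA0, div_le_one hA0]
    obtain ⟨h1, h2⟩ := abs_le.1 hx
    refine abs_le.2 ⟨?_, stepFun_monotone k i h2⟩
    rw [hA, ← stepFun_neg]
    exact stepFun_monotone k i h1
  · rw [heval]
    rcases lt_or_ge x 0 with hneg | hpos
    · rw [abs_of_neg hneg] at hx hx1
      have := hmain (-x) hx hx1
      rw [stepFun_neg] at this
      rw [Real.sign_of_neg hneg, ← abs_neg]
      convert this using 2
      ring
    · rw [abs_of_nonneg hpos] at hx hx1
      rw [Real.sign_of_pos (hβ.trans_le hx)]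
      exact hmain x hx hx1

/-! ### Signal processing in an algebra with a projection -/

section Signal

variable {A : Type*} [Ring A] [Algebra ℂ A]

/-- The phase operator `z e + w (1 - e)`. -/
def phaseOp (e : A) (z w : ℂ) : A := z • e + w • (1 - e)

/-- The signal operator, compressed by the projection `e`. -/
def signal (u u' e : A) : A := e * u' * e * u * e

variable {u u' e G : A} {P Q : ℂ[X]}

/-- The form of `G e` after an even number of signal operators; `OddState` is the form after an odd
number of them. -/
def EvenState (u u' e G : A) (P Q : ℂ[X]) : Prop :=
  G * e = e * aeval (signal u u' e) P +
    (1 - e) * u' * e * u * e * aeval (signal u u' e) Q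

def OddState (u u' e G : A) (p q : ℂ[X]) : Prop :=
  G * e = e * u * e * aeval (signal u u' e) p + (1 - e) * u * e * aeval (signal u u' e) q

/-- The first summand of the state lies in the range of e and the second in that of 1 - e, so the
phase operator multiplies the two polynomials by separate scalars. -/
lemma EvenState.phase (he : e * e = e) (h : EvenState u u' e G P Q) (z w : ℂ) :
    EvenState u u' e (phaseOp e z w * G) (C z * P) (C w * Q) := by
  have h1 : e * (1 - e) = 0 := by rw [mul_sub, mul_one, he, sub_self]
  have h2 : (1 - e) * e = 0 := by rw [sub_mul, one_mul, he, sub_self]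
  have h3 : (1 - e) * (1 - e) = 1 - e := by rw [mul_sub, mul_one, h2, sub_zero]
  unfold EvenState at *
  rw [mul_assoc, h, phaseOp]
  simp only [map_mul, aeval_C, Algebra.algebraMap_eq_smul_one, smul_mul_assoc, one_mul,
    mul_smul_comm, add_mul, mul_add, ← mul_assoc, he, h1, h2, h3, smul_zero, add_zero,
    zero_add]

lemma OddState.phase (he : e * e = e) (h : OddState u u' e G P Q) (z w : ℂ) :
    OddState u u' e (phaseOp e z w * G) (C z * P) (C w * Q) := by
  have h1 : e * (1 - e) = 0 := by rw [mul_sub, mul_one, he, sub_self]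
  have h2 : (1 - e) * e = 0 := by rw [sub_mul, one_mul, he, sub_self]
  have h3 : (1 - e) * (1 - e) = 1 - e := by rw [mul_sub, mul_one, h2, sub_zero]
  unfold OddState at *
  rw [mul_assoc, h, phaseOp]
  simp only [map_mul, aeval_C, Algebra.algebraMap_eq_smul_one, smul_mul_assoc, one_mul,
    mul_smul_comm, add_mul, mul_add, ← mul_assoc, he, h1, h2, h3, smul_zero, add_zero,
    zero_add]

/-- Since u u' = 1, the complement satisfies u(1-e)u' = 1 - u e u'. So u maps (1-e)u'eue back to eue
minus ue times the signal, and splitting ue by e leaves again two polynomials in the signal. The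
update rule does not depend on u. -/
lemma EvenState.apply (he : e * e = e) (hu : u * u' = 1) (h : EvenState u u' e G P Q) :
    OddState u u' e (u * G) (P + (1 - X) * Q) (P - X * Q) := by
  unfold EvenState at h
  unfold OddState
  rw [mul_assoc, h]
  simp only [map_add, map_sub, map_mul, map_one, aeval_X]
  set y := signal u u' e with hy
  set p := aeval y P
  set q := aeval y Q
  have h1 : u * (1 - e) * u' * e * u * e = e * u * e - u * e * y := by
    rw [hy, signal]
    simp only [mul_sub, sub_mul, mul_one, ← mul_assoc, hu, one_mul]
    rw [mul_assoc u e e, he]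
  have h2 : u * ((1 - e) * u' * e * u * e * q) = (u * (1 - e) * u' * e * u * e) * q := by
    simp only [mul_assoc]
  rw [mul_add, h2, h1]
  simp only [mul_sub, sub_mul, mul_add, one_mul, ← mul_assoc]
  abel

/-- The same computation with u' u = 1; here eu'eue is the signal itself, which produces the factor
X. -/
lemma OddState.apply (he : e * e = e) (hu : u' * u = 1) (h : OddState u u' e G P Q) :
    EvenState u u' e (u' * G) (X * P + (1 - X) * Q) (P - Q) := by
  unfold OddState at h
  unfold EvenState
  rw [mul_assoc, h]
  simp only [map_add, map_sub, map_mul, map_one, aeval_X]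
  set y := signal u u' e with hy
  set p := aeval y P
  set q := aeval y Q
  have hey : e * y = y := by
    rw [hy, signal]; simp only [← mul_assoc, he]
  have h1 : (1 - e) * u' * e * u * e = u' * e * u * e - y := by
    rw [hy, signal]
    simp only [sub_mul, one_mul]
  have h2 : u' * (e * u * e * p + (1 - e) * u * e * q) =
      (u' * e * u * e) * p + (u' * u * e - u' * e * u * e) * q := by
    simp only [mul_assoc, mul_add, sub_mul, mul_sub, one_mul]
  rw [h2, h1, hu]
  simp only [mul_sub, sub_mul, mul_add, one_mul, ← mul_assoc, hey]
  abel

lemma EvenState.one : EvenState u u' e 1 1 0 := by simp [EvenState]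

end Signal

/-! ### Removal of one layer of a signal processing sequence -/

/-- The polynomial with conjugated coefficients. -/
abbrev conjPoly (P : ℂ[X]) : ℂ[X] := P.map (starRingEnd ℂ)

/-- The hypothesis says |a| = |c|, and z is a square root of a/c: turning a by z̄ and c by z makes
them equal. -/
lemma exists_phase_eq {a c : ℂ} (h : a * star a = c * star c) :
    ∃ z : ℂ, star z * z = 1 ∧ star z * a = z * c := by
  have hn : ‖a‖ = ‖c‖ := by
    have h1 : ((‖a‖ ^ 2 : ℝ) : ℂ) = ((‖c‖ ^ 2 : ℝ) : ℂ) := by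
      push_cast
      rw [← Complex.mul_conj', ← Complex.mul_conj']
      exact h
    have h2 : ‖a‖ ^ 2 = ‖c‖ ^ 2 := by exact_mod_cast h1
    exact (sq_eq_sq₀ (norm_nonneg _) (norm_nonneg _)).1 h2
  by_cases hc : c = 0
  · subst hc
    rw [norm_zero, norm_eq_zero] at hn
    exact ⟨1, by simp, by simp [hn]⟩
  obtain ⟨z, hz⟩ := IsAlgClosed.exists_pow_nat_eq (a / c) two_pos
  have hz1 : ‖z‖ = 1 := by
    have : ‖z‖ ^ 2 = 1 := by
      rw [← norm_pow, hz, norm_div, hn, div_self (norm_ne_zero_iff.2 hc)]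
    exact (pow_eq_one_iff_of_nonneg (norm_nonneg _) two_ne_zero).1 this
  have hzz : star z * z = 1 := by
    have := Complex.conj_mul' z
    rw [hz1] at this
    simpa using this
  refine ⟨z, hzz, ?_⟩
  have ha : a = z ^ 2 * c := by rw [hz, div_mul_cancel₀ _ hc]
  rw [ha]
  linear_combination z * c * hzz

lemma degree_lt_of_coeff_eq_zero {p : ℂ[X]} {k : ℕ} (h : p.degree < ((k + 1 : ℕ) : WithBot ℕ))
    (hk : p.coeff k = 0) : p.degree < (k : WithBot ℕ) := by
  rw [degree_lt_iff_coeff_zero] at h ⊢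
  intro m hm
  rcases hm.eq_or_lt with rfl | hlt
  · exact hk
  · exact h m hlt

lemma natDegree_le_of_degree_lt_succ {p : ℂ[X]} {k : ℕ}
    (h : p.degree < ((k + 1 : ℕ) : WithBot ℕ)) : p.natDegree ≤ k := by
  rw [degree_lt_iff_coeff_zero] at h
  exact natDegree_le_iff_coeff_eq_zero.2 fun m hm => h m hm

lemma coeff_mul_conjPoly {p : ℂ[X]} {k : ℕ} (h : p.natDegree ≤ k) :
    (p * conjPoly p).coeff (k + k) = p.coeff k * star (p.coeff k) := by
  rw [coeff_mul_add_eq_of_natDegree_le h (natDegree_map_le.trans h), coeff_map]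
  rfl

lemma conjPoly_C (z : ℂ) : conjPoly (C z) = C (star z) := by simp [conjPoly]

/-- Comparing coefficients of degree 2l + 2 in the normalization shows that the top coefficients of
P and Q have equal modulus, so a phase can align them. Inverting the update of `OddState.apply`
followed by that phase gives q = z̄P - X·zQ and p = q + zQ; alignment is exactly what makes the top
coefficient of q vanish. The normalization carries over because the update respects it. -/
lemma exists_even_layer {l : ℕ} {P Q : ℂ[X]} (hP : P.degree < ((l + 2 : ℕ) : WithBot ℕ))
    (hQ : Q.degree < ((l + 1 : ℕ) : WithBot ℕ))
    (h : P * conjPoly P + X * (1 - X) * (Q * conjPoly Q) = 1) :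
    ∃ (z : ℂ) (p q : ℂ[X]), star z * z = 1 ∧ p.degree < ((l + 1 : ℕ) : WithBot ℕ) ∧
      q.degree < ((l + 1 : ℕ) : WithBot ℕ) ∧
      X * (p * conjPoly p) + (1 - X) * (q * conjPoly q) = 1 ∧
      P = C z * (X * p + (1 - X) * q) ∧ Q = C (star z) * (p - q) := by
  have hP' := natDegree_le_of_degree_lt_succ hP
  have hQ' := natDegree_le_of_degree_lt_succ hQ
  have htop : P.coeff (l + 1) * star (P.coeff (l + 1)) = Q.coeff l * star (Q.coeff l) := by
    have h1 := congrArg (fun f => coeff f ((l + 1) + (l + 1))) h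
    simp only [coeff_add, coeff_mul_conjPoly hP', coeff_one] at h1
    have h2 : (X * (1 - X) * (Q * conjPoly Q)).coeff ((l + 1) + (l + 1)) =
        - (Q.coeff l * star (Q.coeff l)) := by
      have hz : (Q * conjPoly Q).coeff (l + l + 1) = 0 :=
        coeff_eq_zero_of_natDegree_lt (lt_of_le_of_lt
          (natDegree_mul_le_of_le hQ' (natDegree_map_le.trans hQ')) (by omega))
      rw [show X * (1 - X) * (Q * conjPoly Q) =
        X * (Q * conjPoly Q) - X * (X * (Q * conjPoly Q)) by ring,
        show (l + 1) + (l + 1) = (l + l + 1) + 1 by ring, coeff_sub, coeff_X_mul, coeff_X_mul,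
        coeff_X_mul, hz, coeff_mul_conjPoly hQ', zero_sub]
    rw [h2, if_neg (by omega)] at h1
    linear_combination h1
  obtain ⟨z, hz, hzc⟩ := exists_phase_eq htop
  have hzC : C (star z) * C z = (1 : ℂ[X]) := by rw [← C_mul, hz, C_1]
  have hCdeg : ∀ w : ℂ, (C w : ℂ[X]).degree < ((0 + 1 : ℕ) : WithBot ℕ) := fun w => degree_C_lt
  have hzP : (C (star z) * P).degree < ((l + 2 : ℕ) : WithBot ℕ) :=
    degree_lt_add_of_lt (degree_mul_lt_add (hCdeg _) hP) (by omega)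
  have hzQ : (C z * Q).degree < ((l + 1 : ℕ) : WithBot ℕ) :=
    degree_lt_add_of_lt (degree_mul_lt_add (hCdeg _) hQ) (by omega)
  have hXQ : (X * (C z * Q)).degree < ((l + 2 : ℕ) : WithBot ℕ) :=
    degree_lt_add_of_lt (degree_mul_lt_add degree_X_lt hzQ) (by omega)
  have hq : (C (star z) * P - X * (C z * Q)).degree < ((l + 1 : ℕ) : WithBot ℕ) := by
    refine degree_lt_of_coeff_eq_zero (degree_sub_lt_of_lt hzP hXQ) ?_
    rw [coeff_sub, coeff_C_mul, coeff_X_mul, coeff_C_mul, hzc, sub_self]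
  refine ⟨z, C (star z) * P - X * (C z * Q) + C z * Q, C (star z) * P - X * (C z * Q), hz,
    degree_add_lt hq hzQ, hq, ?_, ?_, ?_⟩
  · simp only [conjPoly, Polynomial.map_add, Polynomial.map_sub, Polynomial.map_mul, map_C, map_X,
      starRingEnd_apply, star_star] at h ⊢
    linear_combination (C (star z) * C z) * h + hzC
  · linear_combination (-P) * hzC
  · linear_combination (-Q) * hzC

/-- As in `exists_even_layer`, with the coefficient of degree 2l + 1 and the update of
`EvenState.apply`; now it is Q = z̄p - zq that loses its top coefficient. -/
lemma exists_odd_layer {l : ℕ} {p q : ℂ[X]} (hp : p.degree < ((l + 1 : ℕ) : WithBot ℕ))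
    (hq : q.degree < ((l + 1 : ℕ) : WithBot ℕ))
    (h : X * (p * conjPoly p) + (1 - X) * (q * conjPoly q) = 1) :
    ∃ (z : ℂ) (P Q : ℂ[X]), star z * z = 1 ∧ P.degree < ((l + 1 : ℕ) : WithBot ℕ) ∧
      Q.degree < (l : WithBot ℕ) ∧ P * conjPoly P + X * (1 - X) * (Q * conjPoly Q) = 1 ∧
      p = C z * (P + (1 - X) * Q) ∧ q = C (star z) * (P - X * Q) := by
  have hp' := natDegree_le_of_degree_lt_succ hp
  have hq' := natDegree_le_of_degree_lt_succ hq
  have htop : p.coeff l * star (p.coeff l) = q.coeff l * star (q.coeff l) := by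
    have h1 := congrArg (fun f => coeff f ((l + l) + 1)) h
    have hz : (q * conjPoly q).coeff (l + l + 1) = 0 :=
      coeff_eq_zero_of_natDegree_lt (lt_of_le_of_lt
        (natDegree_mul_le_of_le hq' (natDegree_map_le.trans hq')) (by omega))
    simp only [coeff_add, coeff_X_mul, sub_mul, one_mul, coeff_sub, coeff_mul_conjPoly hp',
      coeff_mul_conjPoly hq', coeff_one, hz] at h1
    rw [if_neg (by omega)] at h1
    linear_combination h1
  obtain ⟨z, hz, hzc⟩ := exists_phase_eq htop
  have hzC : C (star z) * C z = (1 : ℂ[X]) := by rw [← C_mul, hz, C_1]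
  have hCdeg : ∀ w : ℂ, (C w : ℂ[X]).degree < ((0 + 1 : ℕ) : WithBot ℕ) := fun w => degree_C_lt
  have hzp : (C (star z) * p).degree < ((l + 1 : ℕ) : WithBot ℕ) :=
    degree_lt_add_of_lt (degree_mul_lt_add (hCdeg _) hp) (by omega)
  have hzq : (C z * q).degree < ((l + 1 : ℕ) : WithBot ℕ) :=
    degree_lt_add_of_lt (degree_mul_lt_add (hCdeg _) hq) (by omega)
  have hQ : (C (star z) * p - C z * q).degree < (l : WithBot ℕ) := by
    refine degree_lt_of_coeff_eq_zero (degree_sub_lt_of_lt hzp hzq) ?_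
    rw [coeff_sub, coeff_C_mul, coeff_C_mul, hzc, sub_self]
  refine ⟨z, C z * q + X * (C (star z) * p - C z * q), C (star z) * p - C z * q, hz,
    degree_add_lt hzq (degree_lt_add_of_lt (degree_mul_lt_add degree_X_lt hQ) (by omega)),
    hQ, ?_, ?_, ?_⟩
  · simp only [conjPoly, Polynomial.map_add, Polynomial.map_sub, Polynomial.map_mul, map_C, map_X,
      starRingEnd_apply, star_star] at h ⊢
    linear_combination (C (star z) * C z) * h + hzC
  · linear_combination (-p) * hzC
  · linear_combination (-q) * hzC

/-! ### Composition of routines -/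

section Perform

variable {ι R Q : Type} [Fintype R] [DecidableEq R] [Fintype Q] [DecidableEq Q]

lemma performs_iff_mulVec {c : Routine ι R Q} {O : ι → UOp R} {V : Op Q} :
    c.Performs O V ↔ ∀ y, c.circuit.eval O *ᵥ ket (Sum.elim y (zeroBits _)) =
      ∑ x, V x y • ket (Sum.elim x (zeroBits (Fin c.work))) := by
  classical
  have key : ∀ (x y : Bits Q) (z : Bits (Fin c.work)),
      (∑ x', V x' y • ket (Sum.elim x' (zeroBits (Fin c.work)))) (Sum.elim x z) =
        if z = zeroBits _ then V x y else 0 := by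
    intro x y z
    simp only [Finset.sum_apply, Pi.smul_apply, ket, smul_eq_mul, mul_ite, mul_one, mul_zero,
      Sum.elim_eq_iff, ite_and]
    rw [Finset.sum_ite_eq]
    simp
  constructor
  · intro h y
    rw [mulVec_ket]
    funext w
    rw [← Sum.elim_comp_inl_inr w, key]
    exact h _ _ _
  · intro h x y z
    have := congrFun (h y) (Sum.elim x z)
    rwa [mulVec_ket, key] at this

/-- Since the first circuit returns the work qubits to zero, the second may reuse them. -/
lemma Routine.Performs.append {w : ℕ} {c c' : QCircuit ι R (Q ⊕ Fin w)} {O : ι → UOp R} {V V' : Op Q}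
    (h : Routine.Performs ⟨w, c⟩ O V) (h' : Routine.Performs ⟨w, c'⟩ O V') :
    Routine.Performs ⟨w, c ++ c'⟩ O (V' * V) := by
  rw [performs_iff_mulVec] at *
  intro y
  simp only at h h' ⊢
  rw [QCircuit.eval_append, ← mulVec_mulVec, h y, mulVec_sum]
  simp only [mulVec_smul, h', Finset.smul_sum, smul_smul, Matrix.mul_apply, Finset.sum_smul]
  rw [Finset.sum_comm]
  simp only [mul_comm]

lemma performs_mapWires (w : ℕ) (O : ι → UOp R) (g : Instr ι R Q) :
    Routine.Performs ⟨w, [g.mapWires Function.Embedding.inl]⟩ O (g.op O) := by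
  classical
  intro x y z
  simp only [QCircuit.eval_singleton, Instr.op_mapWires]
  simp only [onWires, of_apply, Function.Embedding.inl_apply, Sum.elim_inl]
  refine if_congr ⟨fun h => ?_, fun h => ?_⟩ rfl rfl
  · funext k
    simpa using h (Sum.inr k) (by simp)
  · rintro (q | k) hq
    · exact absurd ⟨q, rfl⟩ hq
    · simp [h]

lemma performs_diagonal {w : ℕ} {c : QCircuit ι R (Q ⊕ Fin w)} {O : ι → UOp R} {d : Bits Q → ℂ}
    (h : ∀ y, c.eval O *ᵥ ket (Sum.elim y (zeroBits _)) = d y • ket (Sum.elim y (zeroBits _))) :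
    Routine.Performs ⟨w, c⟩ O (diagonal d) := by
  classical
  rw [performs_iff_mulVec]
  intro y
  rw [Finset.sum_eq_single y]
  · rw [diagonal_apply_eq]
    exact h y
  · intro x _ hx
    rw [diagonal_apply_ne _ hx, zero_smul]
  · simp

end Perform

/-! ### One-qubit gates and controlled one-qubit gates -/

section Gates

lemma submatrix_equiv_mem_unitaryGroup {α β : Type*} [Fintype α] [DecidableEq α] [Fintype β]
    [DecidableEq β] (f : α ≃ β) {M : Matrix β β ℂ} (hM : M ∈ unitaryGroup β ℂ) :
    M.submatrix f f ∈ unitaryGroup α ℂ := by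
  rw [mem_unitaryGroup_iff, star_eq_conjTranspose, conjTranspose_submatrix, submatrix_mul_equiv,
    ← star_eq_conjTranspose, mem_unitaryGroup_iff.1 hM, submatrix_one_equiv]

lemma blockDiagonal_mem_unitaryGroup {α β : Type*} [Fintype α] [DecidableEq α] [Fintype β]
    [DecidableEq β] {M : β → Matrix α α ℂ} (hM : ∀ k, M k ∈ unitaryGroup α ℂ) :
    blockDiagonal M ∈ unitaryGroup (α × β) ℂ := by
  rw [mem_unitaryGroup_iff, star_eq_conjTranspose, blockDiagonal_conjTranspose,
    ← blockDiagonal_mul, ← blockDiagonal_one]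
  exact congrArg blockDiagonal (funext fun k => mem_unitaryGroup_iff.1 (hM k))

/-- The labels of a single qubit. -/
def oneBit : Bits (Fin 1) ≃ Bool := Equiv.funUnique (Fin 1) Bool

/-- The labels of two qubits, the second one first. -/
def twoBits : Bits (Fin 2) ≃ Bool × Bool where
  toFun x := (x 1, x 0)
  invFun p := ![p.2, p.1]
  left_inv x := by funext i; fin_cases i <;> rfl
  right_inv p := rfl

lemma twoBits_apply (x : Bits (Fin 2)) : twoBits x = (x 1, x 0) := rfl

lemma twoBits_symm_apply (p : Bool × Bool) : twoBits.symm p = ![p.2, p.1] := rfl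

/-- A one-qubit gate. -/
def bitGate (D : unitaryGroup Bool ℂ) : UOp (Fin 1) :=
  ⟨D.1.submatrix oneBit oneBit, submatrix_equiv_mem_unitaryGroup _ D.2⟩

/-- The two-qubit gate that applies `D c` to the second qubit if the first one is in state `c`. -/
def ctrlGate (D : Bool → unitaryGroup Bool ℂ) : UOp (Fin 2) :=
  ⟨(blockDiagonal fun c => (D c).1).submatrix twoBits twoBits,
    submatrix_equiv_mem_unitaryGroup _ (blockDiagonal_mem_unitaryGroup fun c => (D c).2)⟩

variable {Q : Type} [Fintype Q] [DecidableEq Q]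

/-- The state whose qubit `t` is in the state `v`, the others being as in the basis state `x`. -/
def qubitState (x : Bits Q) (t : Q) (v : Bool → ℂ) : Bits Q → ℂ :=
  ∑ s, v s • ket (Function.update x t s)

omit [Fintype Q] in
lemma qubitState_single (x : Bits Q) (t : Q) (s : Bool) :
    qubitState x t (Pi.single s 1) = ket (Function.update x t s) := by
  rw [qubitState, Finset.sum_eq_single s]
  · simp
  · intro r _ hr
    simp [hr]
  · simp

lemma onWires_bitGate_mulVec_ket (e : Fin 1 ↪ Q) (D : unitaryGroup Bool ℂ) (x : Bits Q) :
    onWires e (bitGate D).1 *ᵥ ket x = ∑ s, D.1 s (x (e 0)) • ket (Function.update x (e 0) s) := by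
  rw [onWires_mulVec_ket, ← Equiv.sum_comp oneBit.symm]
  refine Finset.sum_congr rfl fun s _ => ?_
  have h : overwrite e x (oneBit.symm s) = Function.update x (e 0) s := by
    funext q
    by_cases hq : q = e 0
    · subst hq
      rw [overwrite_apply, Function.update_self]
      rfl
    · rw [overwrite_of_notMem, Function.update_of_ne hq]
      rintro ⟨r, rfl⟩
      exact hq (by rw [Subsingleton.elim r 0])
  rw [h]
  rfl

lemma onWires_ctrlGate_mulVec_ket (e : Fin 2 ↪ Q) (D : Bool → unitaryGroup Bool ℂ) (x : Bits Q) :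
    onWires e (ctrlGate D).1 *ᵥ ket x =
      ∑ s, (D (x (e 0))).1 s (x (e 1)) • ket (Function.update x (e 1) s) := by
  rw [onWires_mulVec_ket, ← Equiv.sum_comp twoBits.symm, Fintype.sum_prod_type]
  refine Finset.sum_congr rfl fun s _ => ?_
  rw [Finset.sum_eq_single (x (e 0))]
  · have h : overwrite e x (twoBits.symm (s, x (e 0))) = Function.update x (e 1) s := by
      funext q
      by_cases hq : q ∈ Set.range e
      · obtain ⟨r, rfl⟩ := hq
        rw [overwrite_apply]
        fin_cases r
        · have : e 0 ≠ e 1 := e.injective.ne (by decide)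
          simp [twoBits_symm_apply, this]
        · simp [twoBits_symm_apply]
      · rw [overwrite_of_notMem _ _ _ hq, Function.update_of_ne]
        rintro rfl
        exact hq ⟨1, rfl⟩
    rw [h]
    simp [ctrlGate, blockDiagonal_apply, twoBits_apply]
  · intro c _ hc
    simp [ctrlGate, blockDiagonal_apply, twoBits_apply, hc]
  · simp

/-- Consecutive controlled gates with a common target leave their controls alone, so they reduce to
a product of 2 × 2 matrices on the target. -/
lemma onWires_ctrlGate_mulVec_qubitState (e : Fin 2 ↪ Q) (D : Bool → unitaryGroup Bool ℂ)
    (x : Bits Q) (v : Bool → ℂ) :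
    onWires e (ctrlGate D).1 *ᵥ qubitState x (e 1) v =
      qubitState x (e 1) ((D (x (e 0))).1 *ᵥ v) := by
  have hne : e 0 ≠ e 1 := e.injective.ne (by decide)
  rw [qubitState, mulVec_sum, qubitState]
  simp only [mulVec_smul, onWires_ctrlGate_mulVec_ket, Function.update_self,
    Function.update_of_ne hne, Function.update_idem, Finset.smul_sum, smul_smul, mulVec,
    dotProduct, Finset.sum_smul]
  rw [Finset.sum_comm]
  simp only [mul_comm]

/-- The two wires `s ≠ t`. -/
def wirePair {s t : Q} (h : s ≠ t) : Fin 2 ↪ Q where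
  toFun j := if j = 0 then s else t
  inj' j k hjk := by fin_cases j <;> fin_cases k <;> simp_all

/-- A single wire. -/
def singleWire {Q : Type} (s : Q) : Fin 1 ↪ Q := ⟨fun _ => s, fun _ _ _ => Subsingleton.elim _ _⟩

/-- The Hadamard gate. -/
def hadamard : unitaryGroup Bool ℂ :=
  ⟨of fun s t => ((√2 : ℝ) : ℂ)⁻¹ * if s && t then -1 else 1, by
    have h2 : ((√2 : ℝ) : ℂ) ^ 2 = 2 := by
      rw [← Complex.ofReal_pow, Real.sq_sqrt zero_le_two]; norm_num
    have h0 : ((√2 : ℝ) : ℂ) ≠ 0 := fun h => by rw [h] at h2; norm_num at h2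
    rw [mem_unitaryGroup_iff]
    ext s t
    simp only [mul_apply, star_apply, of_apply, Fintype.sum_bool, one_apply, star_mul', star_inv₀]
    cases s <;> cases t <;> simp <;> field_simp <;> linear_combination -h2⟩

/-- The bit flip. -/
def pauliX : unitaryGroup Bool ℂ :=
  ⟨of fun s t => if s = !t then 1 else 0, by
    rw [mem_unitaryGroup_iff]
    ext s t
    simp only [mul_apply, star_apply, of_apply, Fintype.sum_bool, one_apply]
    cases s <;> cases t <;> simp⟩

/-- The diagonal gate with the phase `z` on `|1⟩` and `w` on `|0⟩`. -/
def diagGate (z w : ℂ) (hz : star z * z = 1) (hw : star w * w = 1) : unitaryGroup Bool ℂ :=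
  ⟨diagonal fun t => if t then z else w, by
    rw [mem_unitaryGroup_iff, star_eq_conjTranspose, diagonal_conjTranspose, diagonal_mul_diagonal,
      ← diagonal_one]
    congr 1
    funext t
    cases t
    · simpa [mul_comm] using hw
    · simpa [mul_comm] using hz⟩

end Gates

/-! ### The phase circuit -/

section PhaseCircuit

variable {b a : ℕ}

/-- The wires of the subroutine: system, ancillas, flag (the last ancilla) and work qubits. -/
abbrev SignWires (b a : ℕ) : Type := (Fin b ⊕ Fin (a + 1)) ⊕ Fin (a + 1)

/-- One step of the computation of the conjunction: if `w_{k+1}` is `0`, it is set to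
`w_k ∧ ¬ (ancilla k)`. -/
def ladderStep (b : ℕ) {a : ℕ} (k : Fin a) :
    QCircuit Unit (Fin b ⊕ Fin a) (SignWires b a) :=
  [.gate2 (wirePair (s := Sum.inr k.castSucc) (t := Sum.inr k.succ)
      (fun h => (Fin.castSucc_lt_succ (i := k)).ne (Sum.inr_injective h)))
      (ctrlGate fun c => if c then hadamard else 1),
    .gate2 (wirePair (s := Sum.inl (Sum.inr k.castSucc)) (t := Sum.inr k.succ) Sum.inl_ne_inr)
      (ctrlGate fun c => if c then 1 else diagGate (-1) 1 (by simp) (by simp)),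
    .gate2 (wirePair (s := Sum.inr k.castSucc) (t := Sum.inr k.succ)
      (fun h => (Fin.castSucc_lt_succ (i := k)).ne (Sum.inr_injective h)))
      (ctrlGate fun c => if c then hadamard else 1)]

lemma hadamard_mul_self_mulVec (v : Bool → ℂ) : hadamard.1 *ᵥ (hadamard.1 *ᵥ v) = v := by
  have h : star hadamard.1 = hadamard.1 := by
    ext s t
    cases s <;> cases t <;> simp [hadamard, star_apply]
  have := mem_unitaryGroup_iff.1 hadamard.2
  rw [h] at this
  rw [mulVec_mulVec, this, one_mulVec]

lemma hadamard_diag_hadamard_mulVec :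
    hadamard.1 *ᵥ ((diagGate (-1) 1 (by simp) (by simp)).1 *ᵥ
      (hadamard.1 *ᵥ Pi.single false 1)) = Pi.single true 1 := by
  have h2 : ((√2 : ℝ) : ℂ) ^ 2 = 2 := by
    rw [← Complex.ofReal_pow, Real.sq_sqrt zero_le_two]; norm_num
  have h0 : ((√2 : ℝ) : ℂ) ≠ 0 := fun h => by rw [h] at h2; norm_num at h2
  funext s
  cases s <;> simp [hadamard, diagGate, mulVec, dotProduct, diagonal_apply]
  field_simp
  linear_combination -h2

/-- A Toffoli gate restricted to the target |0⟩, from two-qubit gates only. If w_k = 1, the target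
undergoes HZH = X when the ancilla is 0 and HH = 1 otherwise; if w_k = 0, at most Z acts, and Z
fixes |0⟩. -/
lemma eval_ladderStep (O : Unit → UOp (Fin b ⊕ Fin a)) (k : Fin a) {x : Bits (SignWires b a)}
    (hx : x (Sum.inr k.succ) = false) :
    (ladderStep b k).eval O *ᵥ ket x = ket (Function.update x (Sum.inr k.succ)
      (x (Sum.inr k.castSucc) && !x (Sum.inl (Sum.inr k.castSucc)))) := by
  have h0 : ket x = qubitState x (Sum.inr k.succ) (Pi.single false 1) := by
    rw [qubitState_single, ← hx, Function.update_eq_self]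
  rw [h0, ← qubitState_single]
  simp only [ladderStep, QCircuit.eval, Instr.op, Matrix.one_mul, ← mulVec_mulVec]
  have key : ∀ {s : SignWires b a} (h : s ≠ Sum.inr k.succ) (D : Bool → unitaryGroup Bool ℂ)
      (v : Bool → ℂ), onWires (wirePair h) (ctrlGate D).1 *ᵥ qubitState x (Sum.inr k.succ) v =
        qubitState x (Sum.inr k.succ) ((D (x s)).1 *ᵥ v) := fun h D v =>
    onWires_ctrlGate_mulVec_qubitState (wirePair h) D x v
  rw [key, key, key]
  congr 1
  have hd : (diagGate (-1) 1 (by simp) (by simp)).1 *ᵥ (Pi.single false 1 : Bool → ℂ) =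
      Pi.single false 1 := by
    funext s
    cases s <;> simp [diagGate]
  cases x (Sum.inr k.castSucc) <;> cases x (Sum.inl (Sum.inr k.castSucc))
  all_goals simp only [if_true, if_false, Bool.false_eq_true, OneMemClass.coe_one, one_mulVec,
    Bool.not_false, Bool.not_true, Bool.and_true, Bool.and_false]
  · exact hd
  · exact hadamard_diag_hadamard_mulVec
  · exact hadamard_mul_self_mulVec _

/-- The computation of the conjunction of the first `k` negated ancillas. -/
def ladder (b : ℕ) {a : ℕ} : (k : ℕ) → k ≤ a → QCircuit Unit (Fin b ⊕ Fin a) (SignWires b a)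
  | 0, _ => [.gate1 (singleWire (Sum.inr 0)) (bitGate pauliX)]
  | k + 1, h => ladder b k (by omega) ++ ladderStep b ⟨k, h⟩

/-- The basis state after `k` steps. -/
def ladderBits (y : Bits (Fin b ⊕ Fin (a + 1))) (k : ℕ) : Bits (SignWires b a) :=
  Sum.elim y fun j => decide (j.1 ≤ k ∧ ∀ i : Fin a, i.1 < j.1 → y (Sum.inr i.castSucc) = false)

lemma eval_ladder (O : Unit → UOp (Fin b ⊕ Fin a)) (y : Bits (Fin b ⊕ Fin (a + 1))) :
    ∀ (k : ℕ) (hk : k ≤ a), (ladder b k hk).eval O *ᵥ ket (Sum.elim y (zeroBits _)) =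
      ket (ladderBits y k)
  | 0, _ => by
    -- The bit flip sets work qubit 0 to true, the value of the empty conjunction.
    rw [ladder, QCircuit.eval_singleton, Instr.op, onWires_bitGate_mulVec_ket]
    have h1 : (singleWire (Sum.inr 0 : SignWires b a)) 0 = Sum.inr 0 := rfl
    have h2 : Function.update (Sum.elim y (zeroBits (Fin (a + 1)))) (Sum.inr 0) true =
        ladderBits y 0 := by
      rw [← Sum.elim_update_right]
      refine congrArg (Sum.elim y) (funext fun j => ?_)
      by_cases hj : j = 0
      · subst hj
        simp
      · rw [Function.update_of_ne hj, zeroBits, eq_comm, decide_eq_false_iff_not]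
        exact fun h => hj (Fin.ext (by simpa using h.1))
    have h3 : ∀ s : Bool, pauliX.1 s false = if s = true then 1 else 0 := by
      intro s
      cases s <;> simp [pauliX]
    rw [h1, Finset.sum_eq_single true, h2, Sum.elim_inr, zeroBits, h3, if_pos rfl, one_smul]
    · intro s _ hs
      rw [Sum.elim_inr, zeroBits, h3, if_neg hs, zero_smul]
    · intro h
      exact absurd (Finset.mem_univ _) h
  | k + 1, hk => by
    rw [ladder, QCircuit.eval_append, ← mulVec_mulVec, eval_ladder O y k (by omega),
      eval_ladderStep _ _ (by simp [ladderBits])]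
    congr 1
    rw [ladderBits, ← Sum.elim_update_right]
    refine congrArg (Sum.elim y) (funext fun j => ?_)
    by_cases hj : j = Fin.succ ⟨k, hk⟩
    · subst hj
      rw [Function.update_self]
      simp only [Sum.elim_inr, Sum.elim_inl, Fin.val_castSucc, Fin.val_succ, le_refl, true_and]
      rw [Bool.eq_iff_iff]
      simp only [Bool.and_eq_true, decide_eq_true_eq, Bool.not_eq_true']
      constructor
      · rintro ⟨h1, h2⟩ i hi
        rcases Nat.lt_succ_iff_lt_or_eq.1 hi with h | h
        · exact h1 i h
        · rwa [show i = ⟨k, hk⟩ from Fin.ext h]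
      · exact fun h => ⟨fun i hi => h i (by omega), h ⟨k, hk⟩ (by simp)⟩
    · rw [Function.update_of_ne hj]
      have : j.1 ≠ k + 1 := fun h => hj (Fin.ext h)
      refine decide_eq_decide.2 (and_congr_left fun _ => ?_)
      omega

lemma queries_ladder : ∀ (k : ℕ) (hk : k ≤ a), (ladder b k hk).queries = 0
  | 0, _ => rfl
  | k + 1, _ => by
    rw [ladder, QCircuit.queries_append, queries_ladder k]
    rfl

lemma gates_ladder : ∀ (k : ℕ) (hk : k ≤ a), (ladder b k hk).gates = 3 * k + 1
  | 0, _ => rfl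
  | k + 1, _ => by
    rw [ladder, QCircuit.gates_append, gates_ladder k]
    have : (ladderStep b ⟨k, by omega⟩ : QCircuit Unit (Fin b ⊕ Fin a) (SignWires b a)).gates = 3 :=
      rfl
    omega

/-- The circuit for the flag-dependent phase: `z` if either all ancillas are zero or the flag
is set, but not both, and `z̄` otherwise. -/
def phaseCircuit (b a : ℕ) (z : ℂ) (hz : star z * z = 1) :
    QCircuit Unit (Fin b ⊕ Fin a) (SignWires b a) :=
  ladder b a le_rfl ++
    [.gate2 (wirePair (s := Sum.inl (Sum.inr (Fin.last a))) (t := Sum.inr (Fin.last a))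
      Sum.inl_ne_inr) (ctrlGate fun c => if c then
        diagGate (star z) z (by rwa [star_star, mul_comm]) hz else
        diagGate z (star z) hz (by rwa [star_star, mul_comm]))] ++
    (ladder b a le_rfl).inverse

lemma queries_phaseCircuit (z : ℂ) (hz : star z * z = 1) : (phaseCircuit b a z hz).queries = 0 := by
  rw [phaseCircuit, QCircuit.queries_append, QCircuit.queries_append, QCircuit.queries_inverse,
    queries_ladder]
  rfl

lemma gates_phaseCircuit (z : ℂ) (hz : star z * z = 1) :
    (phaseCircuit b a z hz).gates = 6 * a + 3 := by
  rw [phaseCircuit, QCircuit.gates_append, QCircuit.gates_append, QCircuit.gates_inverse,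
    gates_ladder]
  have : QCircuit.gates [(Instr.gate2 (wirePair (s := Sum.inl (Sum.inr (Fin.last a)))
    (t := Sum.inr (Fin.last a)) Sum.inl_ne_inr) (ctrlGate fun c => if c then
        diagGate (star z) z (by rwa [star_star, mul_comm]) hz else
        diagGate z (star z) hz (by rwa [star_star, mul_comm])) :
        Instr Unit (Fin b ⊕ Fin a) (SignWires b a))] = 1 := rfl
  rw [this]
  ring

/-- The phases applied by the phase circuit. -/
def phaseFun (z : ℂ) (y : Bits (Fin b ⊕ Fin (a + 1))) : ℂ :=
  if (decide (∀ i : Fin a, y (Sum.inr i.castSucc) = false)) = y (Sum.inr (Fin.last a)) then star z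
  else z

/-- Compute, apply a phase, uncompute: after the ladder the last work qubit tells whether all
ancillas vanish. The middle gate is diagonal and multiplies the basis state by a scalar, so the
inverse ladder restores the work qubits. -/
lemma performs_phaseCircuit (O : Unit → UOp (Fin b ⊕ Fin a)) (z : ℂ) (hz : star z * z = 1) :
    Routine.Performs ⟨a + 1, phaseCircuit b a z hz⟩ O (diagonal (phaseFun z)) := by
  refine performs_diagonal fun y => ?_
  rw [phaseCircuit, QCircuit.eval_append, QCircuit.eval_append, ← mulVec_mulVec, ← mulVec_mulVec,
    eval_ladder, QCircuit.eval_singleton, Instr.op, onWires_ctrlGate_mulVec_ket,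
    QCircuit.eval_inverse]
  have h0 : (wirePair (Q := SignWires b a) (s := Sum.inl (Sum.inr (Fin.last a)))
    (t := Sum.inr (Fin.last a)) Sum.inl_ne_inr) 0 = Sum.inl (Sum.inr (Fin.last a)) := rfl
  have h1 : (wirePair (Q := SignWires b a) (s := Sum.inl (Sum.inr (Fin.last a)))
    (t := Sum.inr (Fin.last a)) Sum.inl_ne_inr) 1 = Sum.inr (Fin.last a) := rfl
  rw [h0, h1, Finset.sum_eq_single (ladderBits y a (Sum.inr (Fin.last a))),
    Function.update_eq_self, mulVec_smul]
  · rw [← eval_ladder O y a le_rfl, mulVec_mulVec, ← star_eq_conjTranspose,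
      mem_unitaryGroup_iff'.1 (QCircuit.eval_mem_unitary O _), one_mulVec]
    congr 1
    have h2 : ladderBits y a (Sum.inr (Fin.last a)) =
        decide (∀ i : Fin a, y (Sum.inr i.castSucc) = false) := by
      simp [ladderBits]
    have h3 : ladderBits y a (Sum.inl (Sum.inr (Fin.last a))) = y (Sum.inr (Fin.last a)) := rfl
    rw [h2, h3, phaseFun]
    cases decide (∀ i : Fin a, y (Sum.inr i.castSucc) = false) <;>
      cases y (Sum.inr (Fin.last a)) <;> simp [diagGate]
  · intro s _ hs
    cases ladderBits y a (Sum.inl (Sum.inr (Fin.last a))) <;> simp [diagGate, diagonal_apply_ne _ hs]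
  · simp

end PhaseCircuit

/-! ### Singular value transformation by a circuit -/

section QSVT

variable {b a : ℕ}

/-- The wires of the queried unitary among those of the subroutine. -/
def sysWires (b a : ℕ) : Fin b ⊕ Fin a ↪ Fin b ⊕ Fin (a + 1) where
  toFun := Sum.map id Fin.castSucc
  inj' := Function.Injective.sumMap Function.injective_id (Fin.castSucc_injective a)

/-- The splitting into the bits of the queried register and the flag. -/
def flagSplit (b a : ℕ) : Bits (Fin b ⊕ Fin (a + 1)) ≃ Bits (Fin b ⊕ Fin a) × Bool where
  toFun x := (fun r => x (sysWires b a r), x (Sum.inr (Fin.last a)))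
  invFun p := Sum.elim (fun i => p.1 (Sum.inl i)) (Fin.snoc (fun i => p.1 (Sum.inr i)) p.2)
  left_inv x := by
    funext q
    rcases q with i | i
    · rfl
    · refine Fin.lastCases ?_ (fun i => ?_) i
      · simp
      · simp [sysWires]
  right_inv p := by
    refine Prod.ext (funext fun r => ?_) (by simp)
    rcases r with i | i <;> simp [sysWires]

/-- The operator that acts as `G` if the flag is not set, and as `G'` if it is set. -/
def flagged (G G' : Op (Fin b ⊕ Fin a)) : Op (Fin b ⊕ Fin (a + 1)) :=
  (blockDiagonal fun f => if f then G' else G).submatrix (flagSplit b a) (flagSplit b a)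

lemma flagged_mul (G G' H H' : Op (Fin b ⊕ Fin a)) :
    flagged G G' * flagged H H' = flagged (G * H) (G' * H') := by
  rw [flagged, flagged, flagged, submatrix_mul_equiv, ← blockDiagonal_mul]
  congr 2
  funext f
  cases f <;> rfl

lemma flagged_mem_unitary {G G' : Op (Fin b ⊕ Fin a)} (hG : G ∈ unitaryGroup _ ℂ)
    (hG' : G' ∈ unitaryGroup _ ℂ) : flagged G G' ∈ unitaryGroup _ ℂ :=
  submatrix_equiv_mem_unitaryGroup _ (blockDiagonal_mem_unitaryGroup fun f => by
    cases f <;> assumption)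

lemma onWires_sysWires (U : Op (Fin b ⊕ Fin a)) : onWires (sysWires b a) U = flagged U U := by
  classical
  ext x y
  have h : (∀ q, q ∉ Set.range (sysWires b a) → x q = y q) ↔
      x (Sum.inr (Fin.last a)) = y (Sum.inr (Fin.last a)) := by
    refine ⟨fun h => h _ ?_, fun h q hq => ?_⟩
    · rintro ⟨i | i, hi⟩
      · exact absurd hi Sum.inl_ne_inr
      · exact (Fin.castSucc_lt_last i).ne (Sum.inr_injective hi)
    · rcases q with i | i
      · exact absurd ⟨Sum.inl i, rfl⟩ hq
      · induction i using Fin.lastCases with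
        | last => exact h
        | cast i => exact absurd ⟨Sum.inr i, rfl⟩ hq
  simp only [onWires, flagged, of_apply, submatrix_apply, blockDiagonal_apply, flagSplit,
    Equiv.coe_fn_mk, ite_self, h]

/-- The projector onto the all-zero state of the ancillas. -/
def zeroProj (b a : ℕ) : Op (Fin b ⊕ Fin a) :=
  diagonal fun x => if ∀ i, x (Sum.inr i) = false then 1 else 0

lemma zeroProj_mul_self : zeroProj b a * zeroProj b a = zeroProj b a := by
  rw [zeroProj, diagonal_mul_diagonal]
  congr 1
  funext x
  split_ifs <;> simp

lemma phaseOp_zeroProj (z w : ℂ) :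
    phaseOp (zeroProj b a) z w = diagonal fun x => if ∀ i, x (Sum.inr i) = false then z else w := by
  rw [phaseOp, zeroProj, ← diagonal_one, diagonal_sub, ← diagonal_smul, ← diagonal_smul,
    diagonal_add]
  congr 1
  funext x
  by_cases h : ∀ i, x (Sum.inr i) = false <;> simp [h]

/-- The flag exchanges z and z̄, so a single circuit runs a phase sequence and its conjugate in the
two branches. -/
lemma diagonal_phaseFun (z : ℂ) : diagonal (phaseFun z) =
    flagged (phaseOp (zeroProj b a) z (star z)) (phaseOp (zeroProj b a) (star z) z) := by
  ext x y
  rw [flagged, submatrix_apply, blockDiagonal_apply, phaseOp_zeroProj, phaseOp_zeroProj]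
  by_cases hxy : x = y
  · subst hxy
    rw [diagonal_apply_eq, if_pos rfl, phaseFun]
    have h1 : (flagSplit b a x).2 = x (Sum.inr (Fin.last a)) := rfl
    have h2 : ∀ i, (flagSplit b a x).1 (Sum.inr i) = x (Sum.inr i.castSucc) := fun i => rfl
    rw [h1]
    by_cases h : ∀ i : Fin a, x (Sum.inr i.castSucc) = false <;>
      cases x (Sum.inr (Fin.last a)) <;> simp [h2, h]
  · rw [diagonal_apply_ne _ hxy]
    split_ifs with h2 h3
    · rw [diagonal_apply_ne]
      exact fun h1 => hxy ((flagSplit b a).injective (Prod.ext h1 h2))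
    · rw [diagonal_apply_ne]
      exact fun h1 => hxy ((flagSplit b a).injective (Prod.ext h1 h2))
    · rfl

lemma phaseOp_mem_unitary {z w : ℂ} (hz : star z * z = 1) (hw : star w * w = 1) :
    phaseOp (zeroProj b a) z w ∈ unitaryGroup _ ℂ := by
  rw [phaseOp_zeroProj, mem_unitaryGroup_iff, star_eq_conjTranspose, diagonal_conjTranspose,
    diagonal_mul_diagonal, ← diagonal_one]
  congr 1
  funext x
  rw [Pi.star_apply]
  split_ifs
  · rwa [mul_comm]
  · rwa [mul_comm]

/-- There is a circuit with `k` queries that performs `flagged G H` for operators `G`, `H` (which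
depend on the queried unitary `U`) such that `S U G` and `T U H`. -/
def Realizable (b a k : ℕ) (S T : UOp (Fin b ⊕ Fin a) → Op (Fin b ⊕ Fin a) → Prop) : Prop :=
  ∃ c : QCircuit Unit (Fin b ⊕ Fin a) (SignWires b a), c.queries = k ∧
    c.gates ≤ (k + 1) * (6 * a + 3) ∧ ∀ U : UOp (Fin b ⊕ Fin a),
      ∃ G ∈ unitaryGroup (Bits (Fin b ⊕ Fin a)) ℂ, ∃ H ∈ unitaryGroup (Bits (Fin b ⊕ Fin a)) ℂ,
        Routine.Performs ⟨a + 1, c⟩ (fun _ => U) (flagged G H) ∧ S U G ∧ T U H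

/-- The circuits for `(P, Q)` after an even number of queries. -/
def EvenRealizable (b a k : ℕ) (P Q : ℂ[X]) : Prop :=
  Realizable b a k (fun U G => EvenState U.1 (star U.1) (zeroProj b a) G P Q)
    (fun U G => EvenState U.1 (star U.1) (zeroProj b a) G (conjPoly P) (conjPoly Q))

/-- The circuits for `(p, q)` after an odd number of queries. -/
def OddRealizable (b a k : ℕ) (p q : ℂ[X]) : Prop :=
  Realizable b a k (fun U G => OddState U.1 (star U.1) (zeroProj b a) G p q)
    (fun U G => OddState U.1 (star U.1) (zeroProj b a) G (conjPoly p) (conjPoly q))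

/-- One more layer is a query, which acts alike in both branches, and a phase circuit of 6a + 3
gates, which acts with conjugate phases. -/
lemma Realizable.phase {k : ℕ} {S S' T T' : UOp (Fin b ⊕ Fin a) → Op (Fin b ⊕ Fin a) → Prop}
    (z : ℂ) (hz : star z * z = 1) (inv : Bool)
    (hST : ∀ U G, S U G → T U (phaseOp (zeroProj b a) z (star z) * ((if inv then star U.1 else U.1) * G)))
    (hST' : ∀ U G, S' U G →
      T' U (phaseOp (zeroProj b a) (star z) z * ((if inv then star U.1 else U.1) * G)))
    (h : Realizable b a k S S') : Realizable b a (k + 1) T T' := by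
  obtain ⟨c, hq, hg, hc⟩ := h
  refine ⟨c ++ [Instr.mapWires Function.Embedding.inl (.query () inv (sysWires b a))] ++
    phaseCircuit b a z hz, ?_, ?_, fun U => ?_⟩
  · rw [QCircuit.queries_append, QCircuit.queries_append, queries_phaseCircuit, hq]
    rfl
  · rw [QCircuit.gates_append, QCircuit.gates_append, gates_phaseCircuit]
    have : QCircuit.gates [(Instr.mapWires Function.Embedding.inl (.query () inv (sysWires b a)) :
      Instr Unit (Fin b ⊕ Fin a) (SignWires b a))] = 0 := rfl
    rw [this]
    calc c.gates + 0 + (6 * a + 3) ≤ (k + 1) * (6 * a + 3) + 0 + (6 * a + 3) := by gcongr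
      _ = _ := by ring
  · obtain ⟨G, hG, G', hG', hp, hS, hS'⟩ := hc U
    have hz' : star (star z) * star z = 1 := by rwa [star_star, mul_comm]
    have hU : (if inv then star U.1 else U.1) ∈ unitaryGroup (Bits (Fin b ⊕ Fin a)) ℂ := by
      cases inv
      · exact U.2
      · exact Unitary.star_mem U.2
    refine ⟨_, mul_mem (phaseOp_mem_unitary hz hz') (mul_mem hU hG), _,
      mul_mem (phaseOp_mem_unitary hz' hz) (mul_mem hU hG'), ?_, hST U G hS, hST' U G' hS'⟩
    have h1 := performs_mapWires (a + 1) (fun _ => U) (.query () inv (sysWires b a))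
    rw [show Instr.op (fun _ => U) (.query () inv (sysWires b a)) =
      flagged (if inv then star U.1 else U.1) (if inv then star U.1 else U.1) from
        onWires_sysWires _] at h1
    have h2 := performs_phaseCircuit (fun _ => U) z hz
    rw [diagonal_phaseFun] at h2
    have := Routine.Performs.append (Routine.Performs.append hp h1) h2
    rwa [flagged_mul, flagged_mul] at this

lemma evenRealizable_zero {z : ℂ} (hz : star z * z = 1) : EvenRealizable b a 0 (C z) 0 := by
  refine ⟨phaseCircuit b a z hz, queries_phaseCircuit z hz, by rw [gates_phaseCircuit]; omega,
    fun U => ?_⟩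
  have hz' : star (star z) * star z = 1 := by rwa [star_star, mul_comm]
  refine ⟨_, phaseOp_mem_unitary hz hz', _, phaseOp_mem_unitary hz' hz, ?_, ?_, ?_⟩
  · rw [← diagonal_phaseFun]
    exact performs_phaseCircuit _ z hz
  · simpa using (EvenState.one (u := U.1) (u' := star U.1)).phase zeroProj_mul_self z (star z)
  · simpa [conjPoly] using
      (EvenState.one (u := U.1) (u' := star U.1)).phase zeroProj_mul_self (star z) z

/-- Layers are removed alternately: an odd sequence ends with a query to U, an even one of positive
length with a query to its inverse. When l = 0 the degree bounds leave Q = 0 and a constant P of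
modulus one, which is a single phase. -/
theorem realizable (b a l : ℕ) :
    (∀ P Q : ℂ[X], P.degree < ((l + 1 : ℕ) : WithBot ℕ) → Q.degree < (l : WithBot ℕ) →
      P * conjPoly P + X * (1 - X) * (Q * conjPoly Q) = 1 → EvenRealizable b a (2 * l) P Q) ∧
    ∀ p q : ℂ[X], p.degree < ((l + 1 : ℕ) : WithBot ℕ) → q.degree < ((l + 1 : ℕ) : WithBot ℕ) →
      X * (p * conjPoly p) + (1 - X) * (q * conjPoly q) = 1 →
        OddRealizable b a (2 * l + 1) p q := by
  have odd_of_even : ∀ l, (∀ P Q : ℂ[X], P.degree < ((l + 1 : ℕ) : WithBot ℕ) →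
      Q.degree < (l : WithBot ℕ) →
      P * conjPoly P + X * (1 - X) * (Q * conjPoly Q) = 1 → EvenRealizable b a (2 * l) P Q) →
      ∀ p q : ℂ[X], p.degree < ((l + 1 : ℕ) : WithBot ℕ) → q.degree < ((l + 1 : ℕ) : WithBot ℕ) →
      X * (p * conjPoly p) + (1 - X) * (q * conjPoly q) = 1 →
        OddRealizable b a (2 * l + 1) p q := by
    intro l ih p q hp hq h
    obtain ⟨z, P, Q, hz, hP, hQ, hPQ, rfl, rfl⟩ := exists_odd_layer hp hq h
    refine (ih P Q hP hQ hPQ).phase z hz false (fun U G hS => ?_) (fun U G hS => ?_)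
    · exact (hS.apply zeroProj_mul_self (mem_unitaryGroup_iff.1 U.2)).phase zeroProj_mul_self _ _
    · have := (hS.apply zeroProj_mul_self (mem_unitaryGroup_iff.1 U.2)).phase zeroProj_mul_self
        (star z) z
      simpa [conjPoly] using this
  induction l with
  | zero =>
    have h0 : ∀ P Q : ℂ[X], P.degree < ((0 + 1 : ℕ) : WithBot ℕ) → Q.degree < ((0 : ℕ) : WithBot ℕ) →
      P * conjPoly P + X * (1 - X) * (Q * conjPoly Q) = 1 → EvenRealizable b a (2 * 0) P Q := by
      intro P Q hP hQ h
      obtain rfl : Q = 0 := by simpa using hQ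
      obtain ⟨z, rfl⟩ := natDegree_eq_zero.1 (Nat.le_zero.1 (natDegree_le_of_degree_lt_succ hP))
      refine evenRealizable_zero ?_
      rw [zero_mul, mul_zero, add_zero, conjPoly_C, ← C_mul, ← C_1] at h
      rw [mul_comm]
      exact C_injective h
    exact ⟨h0, odd_of_even 0 h0⟩
  | succ l ih =>
    have h0 : ∀ P Q : ℂ[X], P.degree < ((l + 1 + 1 : ℕ) : WithBot ℕ) →
      Q.degree < ((l + 1 : ℕ) : WithBot ℕ) →
      P * conjPoly P + X * (1 - X) * (Q * conjPoly Q) = 1 →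
        EvenRealizable b a (2 * (l + 1)) P Q := by
      intro P Q hP hQ h
      obtain ⟨z, p, q, hz, hp, hq, hpq, rfl, rfl⟩ := exists_even_layer hP hQ h
      refine (ih.2 p q hp hq hpq).phase z hz true (fun U G hS => ?_) (fun U G hS => ?_)
      · exact (hS.apply zeroProj_mul_self (mem_unitaryGroup_iff'.1 U.2)).phase
          zeroProj_mul_self _ _
      · have := (hS.apply zeroProj_mul_self (mem_unitaryGroup_iff'.1 U.2)).phase
          zeroProj_mul_self (star z) z
        simpa [conjPoly] using this
    exact ⟨h0, odd_of_even (l + 1) h0⟩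

end QSVT

/-! ### Singular values and the trace norm -/

section SingularValues

variable {α : Type} [Fintype α] [DecidableEq α] (M : Matrix α α ℂ)

/-- The unitary whose columns are the right singular vectors. -/
def singUnitary : unitaryGroup α ℂ := (isHermitian_conjTranspose_mul_self M).eigenvectorUnitary

/-- The operator `∑_j h_j |ξ_j⟩⟨ξ_j|`. -/
def specOp (h : α → ℂ) : Matrix α α ℂ := (singUnitary M).1 * diagonal h * (singUnitary M).1ᴴ

lemma singUnitary_conjTranspose_mul : (singUnitary M).1ᴴ * (singUnitary M).1 = 1 :=
  mem_unitaryGroup_iff'.1 (singUnitary M).2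

lemma singUnitary_mul_conjTranspose : (singUnitary M).1 * (singUnitary M).1ᴴ = 1 :=
  mem_unitaryGroup_iff.1 (singUnitary M).2

lemma specOp_mul (g h : α → ℂ) : specOp M g * specOp M h = specOp M (g * h) := by
  have : (g * h) = fun i => g i * h i := rfl
  rw [specOp, specOp, specOp, this, ← diagonal_mul_diagonal]
  simp only [Matrix.mul_assoc]
  rw [← Matrix.mul_assoc (singUnitary M).1ᴴ, singUnitary_conjTranspose_mul, Matrix.one_mul]

lemma specOp_one : specOp M 1 = 1 := by
  rw [specOp, show (diagonal (1 : α → ℂ)) = 1 from diagonal_one, Matrix.mul_one,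
    singUnitary_mul_conjTranspose]

lemma specOp_add (g h : α → ℂ) : specOp M (g + h) = specOp M g + specOp M h := by
  have : (g + h) = fun i => g i + h i := rfl
  rw [specOp, specOp, specOp, this, ← diagonal_add, Matrix.mul_add, Matrix.add_mul]

lemma specOp_smul (c : ℂ) (h : α → ℂ) : specOp M (c • h) = c • specOp M h := by
  rw [specOp, specOp, diagonal_smul, Matrix.mul_smul, Matrix.smul_mul]

lemma specOp_sub (g h : α → ℂ) : specOp M (g - h) = specOp M g - specOp M h := by
  have : g - h = g + (-1 : ℂ) • h := by rw [neg_one_smul, sub_eq_add_neg]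
  rw [this, specOp_add, specOp_smul, neg_one_smul, sub_eq_add_neg]

lemma specOp_conjTranspose (h : α → ℂ) : (specOp M h)ᴴ = specOp M (star h) := by
  rw [specOp, specOp, conjTranspose_mul, conjTranspose_mul, conjTranspose_conjTranspose,
    diagonal_conjTranspose, Matrix.mul_assoc]

lemma trace_specOp (h : α → ℂ) : (specOp M h).trace = ∑ j, h j := by
  rw [specOp, trace_mul_comm, ← Matrix.mul_assoc, singUnitary_conjTranspose_mul, Matrix.one_mul,
    trace_diagonal]

lemma aeval_specOp (h : α → ℂ) (p : ℂ[X]) :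
    aeval (specOp M h) p = specOp M fun j => p.eval (h j) := by
  induction p using Polynomial.induction_on' with
  | add p q hp hq =>
    rw [map_add, hp, hq, ← specOp_add]
    congr 1
    funext j
    simp
  | monomial n c =>
    rw [aeval_monomial, Algebra.algebraMap_eq_smul_one, smul_mul_assoc, Matrix.one_mul]
    have hpow : specOp M h ^ n = specOp M (h ^ n) := by
      induction n with
      | zero => rw [pow_zero, pow_zero, specOp_one]
      | succ n ih => rw [pow_succ, pow_succ, ih, specOp_mul]
    rw [hpow, ← specOp_smul]
    congr 1
    funext j
    simp

lemma singVal_nonneg (j : α) : 0 ≤ singVal M j := Real.sqrt_nonneg _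

lemma singVal_sq (j : α) :
    singVal M j ^ 2 = (isHermitian_conjTranspose_mul_self M).eigenvalues j :=
  Real.sq_sqrt ((posSemidef_conjTranspose_mul_self M).eigenvalues_nonneg j)

lemma conjTranspose_mul_self_eq_specOp :
    Mᴴ * M = specOp M fun j => (singVal M j : ℂ) * singVal M j := by
  conv_lhs => rw [(isHermitian_conjTranspose_mul_self M).spectral_theorem,
    Unitary.conjStarAlgAut_apply]
  rw [specOp]
  congr 3
  funext j
  rw [← Complex.ofReal_mul, ← sq, singVal_sq]
  rfl

/-- M kills the right singular vectors with s_j = 0, so functions of the singular values matter only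
where s_j ≠ 0. This is what legitimizes the divisions by s_j below. -/
lemma mul_specOp_congr {g h : α → ℂ} (hgh : ∀ j, singVal M j ≠ 0 → g j = h j) :
    M * specOp M g = M * specOp M h := by
  rw [← sub_eq_zero, ← Matrix.mul_sub, ← specOp_sub, ← conjTranspose_mul_self_eq_zero,
    conjTranspose_mul, Matrix.mul_assoc, ← Matrix.mul_assoc Mᴴ, conjTranspose_mul_self_eq_specOp,
    specOp_conjTranspose, specOp_mul, specOp_mul]
  have : star (g - h) * ((fun j => (singVal M j : ℂ) * singVal M j) * (g - h)) = 0 := by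
    funext j
    by_cases hj : singVal M j = 0
    · simp [hj]
    · simp [hgh j hj]
  rw [this, ← zero_smul ℂ (1 : α → ℂ), specOp_smul, zero_smul]

/-- Writing the transform as M times a function of M†M lets later computations use only the
multiplication rule of `specOp`. -/
lemma svTransform_eq (f : ℝ → ℝ) :
    svTransform f M = M * specOp M fun j => (f (singVal M j) : ℂ) * (singVal M j : ℂ)⁻¹ := by
  ext x y
  rw [svTransform, specOp, ← Matrix.mul_assoc, ← Matrix.mul_assoc, mul_apply, Matrix.sum_apply]
  refine Finset.sum_congr rfl fun j _ => ?_
  rw [mul_diagonal, Matrix.smul_apply, vecMulVec_apply, conjTranspose_apply, leftSing, Pi.smul_apply,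
    Pi.star_apply]
  have h1 : (M * (singUnitary M).1) x j = (M *ᵥ rightSing M j) x := rfl
  have h2 : (singUnitary M).1 y j = rightSing M j y := rfl
  rw [h1, h2, smul_eq_mul, smul_eq_mul]
  ring

/-- This links the polynomials in M†M delivered by signal processing to odd functions of the
singular values. -/
lemma mul_aeval_eq_svTransform (p : ℝ[X]) :
    M * aeval (Mᴴ * M) (p.map (algebraMap ℝ ℂ)) =
      svTransform (fun x => x * p.eval (x ^ 2)) M := by
  conv_lhs => rw [conjTranspose_mul_self_eq_specOp, aeval_specOp]
  rw [svTransform_eq]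
  refine mul_specOp_congr M fun j hj => ?_
  have hj' : (singVal M j : ℂ) ≠ 0 := Complex.ofReal_ne_zero.2 hj
  rw [← Complex.ofReal_mul, ← sq, ← Complex.coe_algebraMap, eval_map_apply]
  simp only [Complex.coe_algebraMap, Complex.ofReal_mul]
  field_simp

lemma traceNorm_eq_sum : traceNorm M = ∑ j, singVal M j := by
  rw [traceNorm, sqrtm, (isHermitian_conjTranspose_mul_self M).cfc_eq, IsHermitian.cfc,
    Unitary.conjStarAlgAut_apply, trace_mul_comm, ← Matrix.mul_assoc]
  rw [show star ((isHermitian_conjTranspose_mul_self M).eigenvectorUnitary : Matrix α α ℂ) *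
    ((isHermitian_conjTranspose_mul_self M).eigenvectorUnitary : Matrix α α ℂ) = 1 from
      singUnitary_conjTranspose_mul M, Matrix.one_mul, trace_diagonal, Complex.re_sum]
  rfl

lemma traceNorm_nonneg : 0 ≤ traceNorm M := by
  rw [traceNorm_eq_sum]
  exact Finset.sum_nonneg fun j _ => singVal_nonneg M j

lemma svTransform_conjTranspose_mul (f g : ℝ → ℝ) :
    (svTransform f M)ᴴ * svTransform g M =
      specOp M fun j => if singVal M j = 0 then 0
        else ((f (singVal M j) * g (singVal M j) : ℝ) : ℂ) := by
  rw [svTransform_eq, svTransform_eq, conjTranspose_mul, Matrix.mul_assoc, ← Matrix.mul_assoc Mᴴ,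
    conjTranspose_mul_self_eq_specOp, specOp_conjTranspose, specOp_mul, specOp_mul]
  congr 1
  funext j
  by_cases hj : singVal M j = 0
  · simp [hj]
  · have hj' : (singVal M j : ℂ) ≠ 0 := Complex.ofReal_ne_zero.2 hj
    simp only [Pi.mul_apply, Pi.star_apply, star_mul', Complex.star_def, Complex.conj_ofReal,
      map_inv₀, if_neg hj, Complex.ofReal_mul]
    field_simp

lemma trace_conjTranspose_mul_svTransform (f : ℝ → ℝ) :
    (Mᴴ * svTransform f M).trace = ((∑ j, singVal M j * f (singVal M j) : ℝ) : ℂ) := by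
  rw [svTransform_eq, ← Matrix.mul_assoc, conjTranspose_mul_self_eq_specOp, specOp_mul,
    trace_specOp, Complex.ofReal_sum]
  refine Finset.sum_congr rfl fun j _ => ?_
  by_cases hj : singVal M j = 0
  · simp [hj]
  · have hj' : (singVal M j : ℂ) ≠ 0 := Complex.ofReal_ne_zero.2 hj
    simp only [Pi.mul_apply, Complex.ofReal_mul]
    field_simp

/-- The partial isometry of the polar decomposition. -/
def polarIsometry : Matrix α α ℂ := svTransform Real.sign M

lemma sign_singVal {j : α} (hj : singVal M j ≠ 0) : Real.sign (singVal M j) = 1 :=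
  Real.sign_of_pos ((singVal_nonneg M j).lt_of_ne' hj)

lemma polarIsometry_conjTranspose_mul : (polarIsometry M)ᴴ * polarIsometry M =
    specOp M fun j => if singVal M j = 0 then 0 else 1 := by
  rw [polarIsometry, svTransform_conjTranspose_mul]
  congr 1
  funext j
  split_ifs with hj
  · rfl
  · simp [sign_singVal M hj]

/-- V†V is the projection onto the span of the right singular vectors with s_j ≠ 0, and the
transform vanishes on its complement. -/
lemma svTransform_mul_polar (f : ℝ → ℝ) :
    svTransform f M * ((polarIsometry M)ᴴ * polarIsometry M) = svTransform f M := by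
  rw [polarIsometry_conjTranspose_mul, svTransform_eq, Matrix.mul_assoc, specOp_mul]
  refine mul_specOp_congr M fun j hj => ?_
  simp [hj]

lemma polarIsometry_mul_conjTranspose_mul :
    polarIsometry M * (polarIsometry M)ᴴ * polarIsometry M = polarIsometry M := by
  rw [Matrix.mul_assoc]
  exact svTransform_mul_polar M Real.sign

lemma trace_conjTranspose_mul_polarIsometry :
    (Mᴴ * polarIsometry M).trace = (traceNorm M : ℂ) := by
  rw [polarIsometry, trace_conjTranspose_mul_svTransform, traceNorm_eq_sum]
  congr 1
  refine Finset.sum_congr rfl fun j _ => ?_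
  by_cases hj : singVal M j = 0
  · simp [hj]
  · rw [sign_singVal M hj, mul_one]

lemma polarIsometry_mul_specOp :
    polarIsometry M * specOp M (fun j => (singVal M j : ℂ)) = M := by
  conv_rhs => rw [← Matrix.mul_one M, ← specOp_one M]
  rw [polarIsometry, svTransform_eq, Matrix.mul_assoc, specOp_mul]
  refine mul_specOp_congr M fun j hj => ?_
  have hj' : (singVal M j : ℂ) ≠ 0 := Complex.ofReal_ne_zero.2 hj
  simp [sign_singVal M hj, hj']

end SingularValues

/-! ### The operator norm and its pairing with the trace norm -/

section OperatorNorm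

open scoped Matrix.Norms.L2Operator

variable {α β : Type} [Fintype α] [DecidableEq α] [Fintype β] [DecidableEq β]

omit [DecidableEq β] in
lemma norm_le_of_conjTranspose_mul_self {A : Matrix β α ℂ} {c : ℝ} (hc : 0 ≤ c)
    (h : ‖Aᴴ * A‖ ≤ c ^ 2) : ‖A‖ ≤ c := by
  rw [l2_opNorm_conjTranspose_mul_self] at h
  nlinarith [norm_nonneg A]

omit [DecidableEq β] in
lemma norm_le_one_of_isometry {A : Matrix β α ℂ} (h : Aᴴ * A = 1) : ‖A‖ ≤ 1 := by
  refine norm_le_of_conjTranspose_mul_self zero_le_one ?_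
  rw [h, one_pow, ← diagonal_one, l2_opNorm_diagonal]
  exact (pi_norm_le_iff_of_nonneg zero_le_one).2 fun i => by simp

lemma norm_apply_self_le (A : Matrix α α ℂ) (j : α) : ‖A j j‖ ≤ ‖A‖ := by
  have h := l2_opNorm_mulVec A (EuclideanSpace.single j 1)
  have h1 : ‖EuclideanSpace.single j (1 : ℂ)‖ = 1 := by simp
  rw [h1, mul_one] at h
  refine le_trans ?_ ((PiLp.norm_apply_le _ j).trans h)
  simp

lemma norm_conj_diagonal_le {U : Matrix α α ℂ} (hU : Uᴴ * U = 1) {h : α → ℂ} {c : ℝ} (hc : 0 ≤ c)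
    (hh : ∀ j, ‖h j‖ ≤ c) : ‖U * diagonal h * Uᴴ‖ ≤ c := by
  have h1 : ‖U‖ ≤ 1 := norm_le_one_of_isometry hU
  have h2 : ‖Uᴴ‖ ≤ 1 := by rwa [l2_opNorm_conjTranspose]
  have h3 : ‖(diagonal h : Matrix α α ℂ)‖ ≤ c := by
    rw [l2_opNorm_diagonal]
    exact (pi_norm_le_iff_of_nonneg hc).2 hh
  calc ‖U * diagonal h * Uᴴ‖ ≤ ‖U * diagonal h‖ * ‖Uᴴ‖ := l2_opNorm_mul _ _
    _ ≤ (‖U‖ * ‖(diagonal h : Matrix α α ℂ)‖) * ‖Uᴴ‖ := by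
        gcongr; exact l2_opNorm_mul _ _
    _ ≤ (1 * c) * 1 := by gcongr
    _ = c := by ring

lemma norm_specOp_le (M : Matrix α α ℂ) {h : α → ℂ} {c : ℝ} (hc : 0 ≤ c) (hh : ∀ j, ‖h j‖ ≤ c) :
    ‖specOp M h‖ ≤ c :=
  norm_conj_diagonal_le (singUnitary_conjTranspose_mul M) hc hh

lemma norm_polarIsometry_le (M : Matrix α α ℂ) : ‖polarIsometry M‖ ≤ 1 := by
  refine norm_le_of_conjTranspose_mul_self zero_le_one ?_
  rw [polarIsometry_conjTranspose_mul, one_pow]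
  refine norm_specOp_le M zero_le_one fun j => ?_
  split_ifs <;> simp

/-- Hölder's inequality: with the polar decomposition of M and the trace taken in the basis of right
singular vectors, each s_j is weighted by a diagonal entry of a conjugate of AV, which is at most
‖A‖. -/
lemma norm_trace_mul_le (A M : Matrix α α ℂ) : ‖(A * M).trace‖ ≤ ‖A‖ * traceNorm M := by
  have h1 : ‖(singUnitary M).1‖ ≤ 1 := norm_le_one_of_isometry (singUnitary_conjTranspose_mul M)
  have h2 : ‖(singUnitary M).1ᴴ‖ ≤ 1 := by rwa [l2_opNorm_conjTranspose]
  set B := (singUnitary M).1ᴴ * (A * polarIsometry M) * (singUnitary M).1 with hB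
  have hBn : ‖B‖ ≤ ‖A‖ := by
    calc ‖B‖ ≤ ‖(singUnitary M).1ᴴ * (A * polarIsometry M)‖ * ‖(singUnitary M).1‖ :=
          l2_opNorm_mul _ _
      _ ≤ (‖(singUnitary M).1ᴴ‖ * (‖A‖ * ‖polarIsometry M‖)) * ‖(singUnitary M).1‖ := by
          gcongr
          exact (l2_opNorm_mul _ _).trans (by gcongr; exact l2_opNorm_mul _ _)
      _ ≤ (1 * (‖A‖ * 1)) * 1 := by gcongr; exact norm_polarIsometry_le M
      _ = ‖A‖ := by ring
  have ht : (A * M).trace = ∑ j, B j j * (singVal M j : ℂ) := by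
    conv_lhs => rw [← polarIsometry_mul_specOp M]
    rw [specOp, ← Matrix.mul_assoc, ← Matrix.mul_assoc, trace_mul_comm, ← Matrix.mul_assoc,
      ← Matrix.mul_assoc]
    rw [← hB, trace]
    simp [mul_diagonal]
  rw [ht, traceNorm_eq_sum, Finset.mul_sum]
  refine (norm_sum_le _ _).trans (Finset.sum_le_sum fun j _ => ?_)
  rw [norm_mul, Complex.norm_real, Real.norm_of_nonneg (singVal_nonneg M j)]
  gcongr
  · exact singVal_nonneg M j
  · exact (norm_apply_self_le B j).trans hBn

/-- The trace norm of the difference of two conjugations by isometries. -/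
lemma traceNorm_conj_sub_le {J J' : Matrix β α ℂ} (hJ : Jᴴ * J = 1) (hJ' : J'ᴴ * J' = 1) {ε : ℝ}
    (hε : ‖J - J'‖ ≤ ε) (M : Matrix α α ℂ) :
    traceNorm (J * M * Jᴴ - J' * M * J'ᴴ) ≤ 2 * ε * traceNorm M := by
  set N := J * M * Jᴴ - J' * M * J'ᴴ with hN
  set V := polarIsometry N
  have hV : ‖Vᴴ‖ ≤ 1 := by rw [l2_opNorm_conjTranspose]; exact norm_polarIsometry_le N
  have h1 : ‖Jᴴ‖ ≤ 1 := by rw [l2_opNorm_conjTranspose]; exact norm_le_one_of_isometry hJ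
  have h2 : ‖J'‖ ≤ 1 := norm_le_one_of_isometry hJ'
  have h3 : ‖(J - J')ᴴ‖ ≤ ε := by rwa [l2_opNorm_conjTranspose]
  have hε0 : 0 ≤ ε := (norm_nonneg _).trans hε
  have htr : (Vᴴ * N).trace = (traceNorm N : ℂ) := by
    have := congrArg star (trace_conjTranspose_mul_polarIsometry N)
    rw [← trace_conjTranspose, conjTranspose_mul, conjTranspose_conjTranspose] at this
    rw [this]
    exact Complex.conj_ofReal _
  -- Telescoping: JMJ† - J'MJ'† = (J - J')MJ† + J'M(J - J')†. Cyclicity then moves M to the end,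
  -- ready for the trace inequality.
  have hdec : (Vᴴ * N).trace =
      (Jᴴ * Vᴴ * (J - J') * M).trace + ((J - J')ᴴ * Vᴴ * J' * M).trace := by
    have e1 : (Jᴴ * Vᴴ * (J - J') * M).trace = (Vᴴ * ((J - J') * M * Jᴴ)).trace := by
      rw [Matrix.mul_assoc, Matrix.mul_assoc, trace_mul_comm, Matrix.mul_assoc]
    have e2 : ((J - J')ᴴ * Vᴴ * J' * M).trace = (Vᴴ * (J' * M * (J - J')ᴴ)).trace := by
      rw [Matrix.mul_assoc, Matrix.mul_assoc, trace_mul_comm, Matrix.mul_assoc]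
    rw [e1, e2, ← trace_add, ← Matrix.mul_add]
    congr 2
    rw [hN, conjTranspose_sub, Matrix.sub_mul, Matrix.sub_mul, Matrix.mul_sub]
    abel
  have b1 : ‖Jᴴ * Vᴴ * (J - J')‖ ≤ ε := by
    calc ‖Jᴴ * Vᴴ * (J - J')‖ ≤ ‖Jᴴ * Vᴴ‖ * ‖J - J'‖ := l2_opNorm_mul _ _
      _ ≤ (‖Jᴴ‖ * ‖Vᴴ‖) * ‖J - J'‖ := by gcongr; exact l2_opNorm_mul _ _
      _ ≤ (1 * 1) * ε := by gcongr
      _ = ε := by ring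
  have b2 : ‖(J - J')ᴴ * Vᴴ * J'‖ ≤ ε := by
    calc ‖(J - J')ᴴ * Vᴴ * J'‖ ≤ ‖(J - J')ᴴ * Vᴴ‖ * ‖J'‖ := l2_opNorm_mul _ _
      _ ≤ (‖(J - J')ᴴ‖ * ‖Vᴴ‖) * ‖J'‖ := by gcongr; exact l2_opNorm_mul _ _
      _ ≤ (ε * 1) * 1 := by gcongr
      _ = ε := by ring
  have hM := traceNorm_nonneg M
  calc traceNorm N = ‖(Vᴴ * N).trace‖ := by
        rw [htr, Complex.norm_real, Real.norm_of_nonneg (traceNorm_nonneg N)]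
    _ ≤ ‖Jᴴ * Vᴴ * (J - J')‖ * traceNorm M + ‖(J - J')ᴴ * Vᴴ * J'‖ * traceNorm M := by
        rw [hdec]
        exact (norm_add_le _ _).trans (add_le_add (norm_trace_mul_le _ _) (norm_trace_mul_le _ _))
    _ ≤ ε * traceNorm M + ε * traceNorm M := by gcongr
    _ = 2 * ε * traceNorm M := by ring

end OperatorNorm

/-! ### The sign subroutine -/

section SignRoutine

/-- The isometry `|y⟩ ↦ |y⟩|0⟩`. -/
def zeroEmb (S D : Type) : Matrix (Bits (S ⊕ D)) (Bits S) ℂ :=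
  of fun x y => open Classical in if x = Sum.elim y (zeroBits D) then 1 else 0

section ZeroEmb

variable {S D : Type} [Fintype S] [DecidableEq S] [Fintype D] [DecidableEq D]

lemma mul_zeroEmb_apply {γ : Type*} (A : Matrix γ (Bits (S ⊕ D)) ℂ) (x : γ) (y : Bits S) :
    (A * zeroEmb S D) x y = A x (Sum.elim y (zeroBits D)) := by
  simp [mul_apply, zeroEmb]

lemma topBlock_eq (A : Op (S ⊕ D)) : topBlock A = (zeroEmb S D)ᴴ * A * zeroEmb S D := by
  ext x y
  rw [mul_zeroEmb_apply, topBlock, of_apply]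
  simp [mul_apply, zeroEmb]

lemma zeroEmb_conjTranspose_mul : (zeroEmb S D)ᴴ * zeroEmb S D = 1 := by
  ext x y
  rw [mul_zeroEmb_apply, conjTranspose_apply, zeroEmb, of_apply, one_apply]
  simp [Sum.elim_eq_iff, eq_comm, apply_ite (starRingEnd ℂ)]

end ZeroEmb

lemma zeroEmb_mul_conjTranspose (b a : ℕ) :
    zeroEmb (Fin b) (Fin a) * (zeroEmb (Fin b) (Fin a))ᴴ = zeroProj b a := by
  classical
  ext x y
  rw [mul_apply]
  simp only [zeroEmb, conjTranspose_apply, of_apply, zeroProj, diagonal_apply]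
  have key : ∀ z : Bits (Fin b), x = Sum.elim z (zeroBits (Fin a)) ↔
      (x ∘ Sum.inl = z ∧ ∀ i, x (Sum.inr i) = false) := fun z => by
    constructor
    · rintro rfl
      exact ⟨rfl, fun i => rfl⟩
    · rintro ⟨rfl, h⟩
      funext q
      rcases q with i | i
      · rfl
      · exact h i
  by_cases h : ∀ i, x (Sum.inr i) = false
  · simp only [key, h, implies_true, and_true, if_true, ite_mul, one_mul, zero_mul,
      Finset.sum_ite_eq, Finset.mem_univ]
    have hx : Sum.elim (x ∘ Sum.inl) (zeroBits (Fin a)) = x := ((key _).2 ⟨rfl, h⟩).symm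
    rw [hx]
    by_cases hxy : x = y
    · simp [hxy]
    · simp [hxy, Ne.symm hxy]
  · simp [key, h]

/-- On states with zero ancillas the signal eU†eUe acts as M†M, where M is the block of U;
polynomials follow. -/
lemma signal_mul_zeroEmb {b a : ℕ} (U : UOp (Fin b ⊕ Fin a)) (p : ℂ[X]) :
    aeval (signal U.1 (star U.1) (zeroProj b a)) p * zeroEmb (Fin b) (Fin a) =
      zeroEmb (Fin b) (Fin a) * aeval ((topBlock U.1)ᴴ * topBlock U.1) p := by
  set E := zeroEmb (Fin b) (Fin a)
  have hE : Eᴴ * E = 1 := zeroEmb_conjTranspose_mul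
  have h1 : signal U.1 (star U.1) (zeroProj b a) * E =
      E * ((topBlock U.1)ᴴ * topBlock U.1) := by
    rw [signal, ← zeroEmb_mul_conjTranspose, topBlock_eq, conjTranspose_mul, conjTranspose_mul,
      conjTranspose_conjTranspose, star_eq_conjTranspose]
    simp only [Matrix.mul_assoc]
    rw [hE, Matrix.mul_one]
  induction p using Polynomial.induction_on' with
  | add p q hp hq => rw [map_add, map_add, Matrix.add_mul, Matrix.mul_add, hp, hq]
  | monomial n c =>
    rw [aeval_monomial, aeval_monomial, Algebra.algebraMap_eq_smul_one,
      Algebra.algebraMap_eq_smul_one, smul_mul_assoc, smul_mul_assoc, Matrix.one_mul,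
      Matrix.one_mul, Matrix.smul_mul, Matrix.mul_smul]
    congr 1
    induction n with
    | zero => rw [pow_zero, pow_zero, Matrix.one_mul, Matrix.mul_one]
    | succ n ih => rw [pow_succ, pow_succ, Matrix.mul_assoc, h1, ← Matrix.mul_assoc, ih,
        Matrix.mul_assoc]

/-- The summand with 1 - e is invisible in the block, so the complementary polynomial q drops out.
-/
lemma OddState.topBlock_eq {b a : ℕ} {U : UOp (Fin b ⊕ Fin a)} {G : Op (Fin b ⊕ Fin a)}
    {p q : ℂ[X]} (h : OddState U.1 (star U.1) (zeroProj b a) G p q) :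
    topBlock G = topBlock U.1 * aeval ((topBlock U.1)ᴴ * topBlock U.1) p := by
  have hE : (zeroEmb (Fin b) (Fin a))ᴴ * zeroEmb (Fin b) (Fin a) = 1 := zeroEmb_conjTranspose_mul
  have hpE : zeroProj b a * zeroEmb (Fin b) (Fin a) = zeroEmb (Fin b) (Fin a) := by
    rw [← zeroEmb_mul_conjTranspose, Matrix.mul_assoc, hE, Matrix.mul_one]
  have hEp : (zeroEmb (Fin b) (Fin a))ᴴ * zeroProj b a = (zeroEmb (Fin b) (Fin a))ᴴ := by
    rw [← zeroEmb_mul_conjTranspose, ← Matrix.mul_assoc, hE, Matrix.one_mul]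
  have hG : G * zeroEmb (Fin b) (Fin a) = (G * zeroProj b a) * zeroEmb (Fin b) (Fin a) := by
    rw [Matrix.mul_assoc, hpE]
  unfold OddState at h
  rw [Uhlmann.topBlock_eq, Matrix.mul_assoc, hG, h, Matrix.add_mul, Matrix.mul_add,
    Matrix.mul_assoc (_ * _ * _), Matrix.mul_assoc (_ * _ * _), signal_mul_zeroEmb,
    signal_mul_zeroEmb]
  have h0 : (zeroEmb (Fin b) (Fin a))ᴴ * (1 - zeroProj b a) = 0 := by
    rw [Matrix.mul_sub, Matrix.mul_one, hEp, sub_self]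
  simp only [← Matrix.mul_assoc, h0, hEp, Matrix.zero_mul, add_zero]
  rw [Matrix.mul_assoc (_ * U.1), hpE, ← Uhlmann.topBlock_eq]

/-- The Hadamard gate on the flag. -/
def flagHadamard (b a : ℕ) : Instr Unit (Fin b ⊕ Fin a) (Fin b ⊕ Fin (a + 1)) :=
  .gate1 (singleWire (Sum.inr (Fin.last a))) (bitGate hadamard)

lemma flagHadamard_op {b a : ℕ} (O : Unit → UOp (Fin b ⊕ Fin a)) :
    (flagHadamard b a).op O =
      ((1 : Op (Fin b ⊕ Fin a)) ⊗ₖ hadamard.1).submatrix (flagSplit b a) (flagSplit b a) := by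
  classical
  ext x y
  have h : (∀ q, q ∉ Set.range (singleWire (Sum.inr (Fin.last a) : Fin b ⊕ Fin (a + 1))) →
      x q = y q) ↔ (flagSplit b a x).1 = (flagSplit b a y).1 := by
    constructor
    · intro h
      funext r
      refine h _ ?_
      rintro ⟨i, hi⟩
      rcases r with r | r
      · exact absurd hi.symm Sum.inl_ne_inr
      · exact (Fin.castSucc_lt_last r).ne' (Sum.inr_injective hi)
    · intro h q hq
      rcases q with i | i
      · exact congrFun h (Sum.inl i)
      · induction i using Fin.lastCases with
        | last => exact absurd ⟨0, rfl⟩ hq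
        | cast i => exact congrFun h (Sum.inr i)
  simp only [flagHadamard, Instr.op, onWires, of_apply, h, submatrix_apply, kroneckerMap_apply,
    one_apply, ite_mul, one_mul, zero_mul]
  rfl

/-- The outer Hadamards prepare and detect an equal superposition of the flag, so the block becomes
the average of the two branches. -/
lemma topBlock_flagHadamard_conj {b a : ℕ} (O : Unit → UOp (Fin b ⊕ Fin a))
    (G G' : Op (Fin b ⊕ Fin a)) :
    topBlock ((flagHadamard b a).op O * (flagged G G' * (flagHadamard b a).op O)) =
      (2⁻¹ : ℂ) • (topBlock G + topBlock G') := by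
  have h2 : ((√2 : ℝ) : ℂ)⁻¹ * ((√2 : ℝ) : ℂ)⁻¹ = 2⁻¹ := by
    rw [← mul_inv, ← Complex.ofReal_mul, Real.mul_self_sqrt zero_le_two]; norm_num
  rw [flagHadamard_op, flagged, submatrix_mul_equiv, submatrix_mul_equiv]
  ext x y
  have hs : ∀ x : Bits (Fin b), flagSplit b a (Sum.elim x (zeroBits (Fin (a + 1)))) =
      (Sum.elim x (zeroBits (Fin a)), false) := fun x => by
    refine Prod.ext (funext fun r => ?_) rfl
    rcases r with i | i <;> rfl
  simp only [topBlock, of_apply, submatrix_apply, hs, Matrix.smul_apply, Matrix.add_apply,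
    mul_apply, Fintype.sum_prod_type, Fintype.sum_bool, kroneckerMap_apply, blockDiagonal_apply,
    one_apply]
  simp [hadamard, Finset.sum_add_distrib]
  linear_combination (G (Sum.elim x (zeroBits (Fin a))) (Sum.elim y (zeroBits (Fin a))) +
    G' (Sum.elim x (zeroBits (Fin a))) (Sum.elim y (zeroBits (Fin a)))) * h2

/-- With x = √y, boundedness of x p(x²) says that 1 - y p(y)² is non-negative on [0, 1]. Its formal
degree is odd, so Lukács' theorem gives exactly the weights y and 1 - y of an odd phase sequence. -/
lemma exists_complement {p : ℝ[X]} (hp : ∀ x : ℝ, |x| ≤ 1 → |x * p.eval (x ^ 2)| ≤ 1) :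
    ∃ B D : ℝ[X], B.degree < ((p.natDegree + 1 : ℕ) : WithBot ℕ) ∧
      D.degree < ((p.natDegree + 1 : ℕ) : WithBot ℕ) ∧
      X * (p ^ 2 + B ^ 2) + (1 - X) * D ^ 2 = 1 := by
  have hdeg : (1 - X * p ^ 2 : ℝ[X]).natDegree ≤ 2 * p.natDegree + 1 := by
    refine (natDegree_sub_le _ _).trans (max_le (by simp) (natDegree_mul_le.trans ?_))
    have h1 := natDegree_X_le (R := ℝ)
    have h2 := natDegree_pow_le (p := p) (n := 2)
    omega
  obtain ⟨l, hl, -⟩ | ⟨l, hl, B, D, hB, hD, h⟩ :=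
    weightedSquares_of_nonneg (2 * p.natDegree + 1) (1 - X * p ^ 2) hdeg fun y hy => by
      have h1 := hp (√y) (by
        rw [abs_of_nonneg (Real.sqrt_nonneg y)]
        exact Real.sqrt_le_one.2 hy.2)
      rw [Real.sq_sqrt hy.1] at h1
      have h2 := (sq_le_one_iff_abs_le_one _).2 h1
      rw [mul_pow, Real.sq_sqrt hy.1] at h2
      simpa using h2
  · omega
  · obtain rfl : l = p.natDegree := by omega
    exact ⟨B, D, hB, hD, by linear_combination -h⟩

/-- A QSVT with the sign function with `O(1/β log(1/δ))` queries, `O(a + 1)` gates per query and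
`a + 1` work qubits. -/
theorem exists_signRoutine (b a : ℕ) {δ β : ℝ} (hδ : 0 < δ) (hδ2 : δ < 1 / 2) (hβ : 0 < β)
    (hβ1 : β ≤ 1) :
    ∃ c : SignRoutine b a, IsSignQSVT δ β c ∧ 1 ≤ c.circuit.queries ∧
      (c.circuit.queries : ℝ) ≤ 100 * (1 / β * Real.log (1 / δ)) ∧
      c.circuit.gates ≤ (c.circuit.queries + 1) * (6 * a + 3) + 2 ∧ c.work = a + 1 := by
  obtain ⟨p, hp0, hdeg, hbound, hsign⟩ := exists_sign_polynomial hδ hδ2 hβ hβ1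
  obtain ⟨B, D, hB, hD, hBD⟩ := exists_complement hbound
  set φ := algebraMap ℝ ℂ with hφ
  have hconj : ∀ q : ℝ[X], conjPoly (q.map φ) = q.map φ := fun q => by
    rw [conjPoly, Polynomial.map_map]
    congr 1
    ext x
    simp [hφ]
  have hdegC : ∀ q : ℝ[X], q.degree < ((p.natDegree + 1 : ℕ) : WithBot ℕ) →
      (q.map φ).degree < ((p.natDegree + 1 : ℕ) : WithBot ℕ) := fun q hq =>
    degree_map_le.trans_lt hq
  have hpdeg : p.degree < ((p.natDegree + 1 : ℕ) : WithBot ℕ) :=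
    degree_le_natDegree.trans_lt (by exact_mod_cast Nat.lt_succ_self _)
  have hI : (C Complex.I * C Complex.I : ℂ[X]) = -1 := by
    rw [← C_mul, Complex.I_mul_I, C_neg, C_1]
  have hcp : conjPoly (p.map φ + C Complex.I * B.map φ) = p.map φ - C Complex.I * B.map φ := by
    have := hconj p
    have := hconj B
    simp_all [conjPoly, sub_eq_add_neg]
  -- Since p and B are real, |p + iB|² = p² + B², so the complex normalization is the real identity
  -- `hBD`.
  obtain ⟨c, hq, hg, hc⟩ := (realizable b a p.natDegree).2 (p.map φ + C Complex.I * B.map φ)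
    (D.map φ) (degree_add_lt (hdegC p hpdeg) (degree_lt_add_of_lt
      (degree_mul_lt_add (a := 0) degree_C_lt (hdegC B hB)) (by omega))) (hdegC D hD) (by
      rw [hcp, hconj]
      have := congrArg (Polynomial.map φ) hBD
      simp only [Polynomial.map_add, Polynomial.map_mul, Polynomial.map_sub, Polynomial.map_pow,
        Polynomial.map_X, Polynomial.map_one] at this
      linear_combination this - X * (B.map φ) ^ 2 * hI)
  have hq1 : QCircuit.queries [(Instr.mapWires Function.Embedding.inl (flagHadamard b a) :
      Instr Unit (Fin b ⊕ Fin a) (SignWires b a))] = 0 := rfl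
  have hg1 : QCircuit.gates [(Instr.mapWires Function.Embedding.inl (flagHadamard b a) :
      Instr Unit (Fin b ⊕ Fin a) (SignWires b a))] = 1 := rfl
  have hqf : QCircuit.queries ([(flagHadamard b a).mapWires Function.Embedding.inl] ++ c ++
      [(flagHadamard b a).mapWires Function.Embedding.inl] :
        QCircuit Unit (Fin b ⊕ Fin a) (SignWires b a)) = 2 * p.natDegree + 1 := by
    rw [QCircuit.queries_append, QCircuit.queries_append, hq1, hq, zero_add, add_zero]
  have heval : ∀ x, (X * p.comp (X ^ 2)).eval x = x * p.eval (x ^ 2) := fun x => by simp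
  refine ⟨⟨a + 1, [(flagHadamard b a).mapWires Function.Embedding.inl] ++ c ++
    [(flagHadamard b a).mapWires Function.Embedding.inl]⟩,
    ⟨X * p.comp (X ^ 2), ?_, ?_, ?_, ?_, fun U => ?_⟩, ?_, ?_, ?_, rfl⟩
  · have hne : p.comp (X ^ 2) ≠ 0 := by
      rw [Ne, comp_eq_zero_iff, not_or]
      refine ⟨hp0, fun h => ?_⟩
      have := congrArg natDegree h.2
      rw [natDegree_X_pow, natDegree_C] at this
      omega
    rw [hqf, natDegree_mul X_ne_zero hne, natDegree_X, natDegree_comp, natDegree_X_pow]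
    ring
  · rw [mul_comp, X_comp, comp_assoc]
    simp
  · intro x hx
    rw [heval]
    exact hbound x hx
  · intro x hx hx1
    rw [heval]
    exact hsign x hx hx1
  · obtain ⟨G, hG, G', hG', hperf, hS, hS'⟩ := hc U
    have hH : (flagHadamard b a).op (fun _ => U) ∈ unitaryGroup _ ℂ :=
      Instr.op_mem_unitary _ _
    refine ⟨⟨_, mul_mem hH (mul_mem (flagged_mem_unitary hG hG') hH)⟩, ?_, ?_⟩
    · have h1 := performs_mapWires (a + 1) (fun _ => U) (flagHadamard b a)
      exact Routine.Performs.append (Routine.Performs.append h1 hperf) h1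
    -- The average of p + iB and p - iB is p: B was needed only for unitarity.
    · rw [topBlock_flagHadamard_conj, hS.topBlock_eq, hS'.topBlock_eq, hcp, ← Matrix.mul_add,
        ← map_add, show p.map φ + C Complex.I * B.map φ + (p.map φ - C Complex.I * B.map φ) =
          (2 : ℂ) • p.map φ by rw [two_smul]; ring, map_smul, Matrix.mul_smul, smul_smul,
        inv_mul_cancel₀ two_ne_zero, one_smul, mul_aeval_eq_svTransform]
      simp only [heval]
  · simp only [hqf]
    omega
  · simp only [hqf]
    exact_mod_cast hdeg
  · simp only [hqf]
    rw [QCircuit.gates_append, QCircuit.gates_append, hg1]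
    omega

end SignRoutine

/-! ### The block-encoding of `tr_A |σ⟩⟨ρ|` -/

section WCircuit

variable {n m : ℕ}

lemma onWires_swapGate_mulVec_ket {Q : Type} [Fintype Q] [DecidableEq Q] (e : Fin 2 ↪ Q)
    (x : Bits Q) :
    onWires e swapGate.1 *ᵥ ket x = ket (x ∘ Equiv.swap (e 0) (e 1)) := by
  rw [onWires_mulVec_ket, Finset.sum_eq_single ![x (e 1), x (e 0)]]
  · have h : overwrite e x ![x (e 1), x (e 0)] = x ∘ Equiv.swap (e 0) (e 1) := by
      funext q
      by_cases hq : q ∈ Set.range e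
      · obtain ⟨r, rfl⟩ := hq
        rw [overwrite_apply]
        fin_cases r
        · simp
        · simp
      · rw [overwrite_of_notMem _ _ _ hq, Function.comp_apply, Equiv.swap_apply_of_ne_of_ne]
        · rintro rfl
          exact hq ⟨0, rfl⟩
        · rintro rfl
          exact hq ⟨1, rfl⟩
    rw [h]
    simp [swapGate]
  · intro u _ hu
    have : ¬ (u 0 = x (e 1) ∧ u 1 = x (e 0)) := fun h => hu (by
      funext i
      fin_cases i
      · exact h.1
      · exact h.2)
    simp [swapGate, this]
  · simp

/-- The bits after the registers `B` and `B̂` have been swapped on the qubits in `l`. -/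
lemma eval_swaps (O : Prep → UOp (Fin (n + m))) (l : List (Fin m)) (hl : l.Nodup)
    (x : Bits (Fin m ⊕ Fin (n + m))) :
    ∃ x' : Bits (Fin m ⊕ Fin (n + m)),
      QCircuit.eval O (l.map fun i => Instr.gate2 (swapWires n m i) swapGate) *ᵥ ket x = ket x' ∧
      (∀ i ∈ l, x' (Sum.inl i) = x (Sum.inr (Fin.natAdd n i))) ∧
      (∀ i ∈ l, x' (Sum.inr (Fin.natAdd n i)) = x (Sum.inl i)) ∧
      (∀ i ∉ l, x' (Sum.inl i) = x (Sum.inl i)) ∧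
      (∀ i ∉ l, x' (Sum.inr (Fin.natAdd n i)) = x (Sum.inr (Fin.natAdd n i))) ∧
      ∀ k, x' (Sum.inr (Fin.castAdd m k)) = x (Sum.inr (Fin.castAdd m k)) := by
  induction l generalizing x with
  | nil => exact ⟨x, by simp [QCircuit.eval], by simp, by simp, by simp, by simp, by simp⟩
  | cons j l ih =>
    obtain ⟨hj, hl⟩ := List.nodup_cons.1 hl
    have hw0 : swapWires n m j 0 = Sum.inl j := rfl
    have hw1 : swapWires n m j 1 = Sum.inr (Fin.natAdd n j) := rfl
    set y := x ∘ Equiv.swap (Sum.inl j) (Sum.inr (Fin.natAdd n j)) with hy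
    have y1 : y (Sum.inl j) = x (Sum.inr (Fin.natAdd n j)) := by simp [hy]
    have y2 : y (Sum.inr (Fin.natAdd n j)) = x (Sum.inl j) := by simp [hy]
    have y3 : ∀ i, i ≠ j → y (Sum.inl i) = x (Sum.inl i) := fun i hi => by
      rw [hy, Function.comp_apply, Equiv.swap_apply_of_ne_of_ne] <;> simp [hi]
    have y4 : ∀ i, i ≠ j → y (Sum.inr (Fin.natAdd n i)) = x (Sum.inr (Fin.natAdd n i)) :=
      fun i hi => by
        rw [hy, Function.comp_apply, Equiv.swap_apply_of_ne_of_ne] <;> simp [hi]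
    have y5 : ∀ k, y (Sum.inr (Fin.castAdd m k)) = x (Sum.inr (Fin.castAdd m k)) := fun k => by
      rw [hy, Function.comp_apply, Equiv.swap_apply_of_ne_of_ne]
      · simp
      · intro h
        have := congrArg Fin.val (Sum.inr_injective h)
        simp at this
        omega
    obtain ⟨x', h0, h1, h2, h3, h4, h5⟩ := ih hl y
    refine ⟨x', ?_, ?_, ?_, ?_, ?_, ?_⟩
    · rw [List.map_cons, QCircuit.eval, ← mulVec_mulVec, Instr.op, onWires_swapGate_mulVec_ket,
        hw0, hw1, h0]
    · intro i hi
      rcases List.mem_cons.1 hi with rfl | hi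
      · rw [h3 _ hj, y1]
      · rw [h1 i hi, y4 i (fun h => hj (h ▸ hi))]
    · intro i hi
      rcases List.mem_cons.1 hi with rfl | hi
      · rw [h4 _ hj, y2]
      · rw [h2 i hi, y3 i (fun h => hj (h ▸ hi))]
    · intro i hi
      rw [List.mem_cons, not_or] at hi
      rw [h3 i hi.2, y3 i hi.1]
    · intro i hi
      rw [List.mem_cons, not_or] at hi
      rw [h4 i hi.2, y4 i hi.1]
    · intro k
      rw [h5, y5]

lemma eval_allSwaps (O : Prep → UOp (Fin (n + m))) (x : Bits (Fin m)) (s : Bits (Fin n))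
    (t : Bits (Fin m)) :
    QCircuit.eval O (List.ofFn fun i : Fin m => Instr.gate2 (swapWires n m i) swapGate) *ᵥ
      ket (Sum.elim x (Fin.append s t)) = ket (Sum.elim t (Fin.append s x)) := by
  obtain ⟨x', h0, h1, h2, -, -, h5⟩ := eval_swaps O (List.finRange m) (List.nodup_finRange m)
    (Sum.elim x (Fin.append s t))
  rw [List.ofFn_eq_map, h0]
  congr 1
  funext q
  rcases q with i | i
  · rw [h1 i (List.mem_finRange i)]
    simp
  · refine Fin.addCases (fun k => ?_) (fun k => ?_) i
    · rw [h5]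
      simp
    · rw [h2 k (List.mem_finRange k)]
      simp

lemma onWires_inr_apply {Q R : Type} [Fintype Q] [DecidableEq Q] [Fintype R] [DecidableEq R]
    (M : Op R) (x y : Bits Q) (u v : Bits R) :
    onWires (Function.Embedding.inr : R ↪ Q ⊕ R) M (Sum.elim x u) (Sum.elim y v) =
      if x = y then M u v else 0 := by
  classical
  simp only [onWires, of_apply, Function.Embedding.inr_apply, Sum.elim_inr]
  refine if_congr ⟨fun h => funext fun q => ?_, fun h q hq => ?_⟩ rfl rfl
  · simpa using h (Sum.inl q) (by simp)
  · rcases q with q | r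
    · simp [h]
    · exact absurd ⟨r, rfl⟩ hq

lemma onWires_inr_mulVec_ket {Q R : Type} [Fintype Q] [DecidableEq Q] [Fintype R] [DecidableEq R]
    (M : Op R) (x : Bits Q) (v : Bits R) :
    onWires (Function.Embedding.inr : R ↪ Q ⊕ R) M *ᵥ ket (Sum.elim x v) =
      ∑ u, M u v • ket (Sum.elim x u) := by
  rw [onWires_mulVec_ket]
  refine Finset.sum_congr rfl fun u _ => ?_
  have : overwrite (Function.Embedding.inr : R ↪ Q ⊕ R) (Sum.elim x v) u = Sum.elim x u := by
    funext q
    rcases q with q | r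
    · rw [overwrite_of_notMem]
      · rfl
      · simp
    · exact overwrite_apply (Function.Embedding.inr : R ↪ Q ⊕ R) _ u r
  rw [this]
  rfl

/-- The splitting of the bits of `AB`. -/
def appendBits (n m : ℕ) : Bits (Fin n) × Bits (Fin m) ≃ Bits (Fin (n + m)) :=
  Fin.appendEquiv n m

/-- On |y⟩|0⟩ the first query creates |σ⟩ on ÂB̂; the swaps put the B̂ part of σ into B and y into
B̂. Projecting onto |x⟩|0⟩ after the inverse of U_ρ pairs ÂB̂ with |ρ⟩, and only the sum over Â
survives. -/
lemma topBlock_wCircuit (Uρ Uσ : UOp (Fin (n + m))) :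
    topBlock ((wCircuit n m).eval (prepOracles Uρ Uσ)) =
      traceFst (ketbra (prepared n m Uσ) (prepared n m Uρ)) := by
  ext x y
  have hcol : topBlock ((wCircuit n m).eval (prepOracles Uρ Uσ)) x y =
      ((wCircuit n m).eval (prepOracles Uρ Uσ) *ᵥ ket (Sum.elim y (zeroBits _)))
        (Sum.elim x (zeroBits _)) := by
    rw [mulVec_ket]
    rfl
  rw [hcol, wCircuit, QCircuit.eval_append, QCircuit.eval_append, QCircuit.eval_singleton,
    QCircuit.eval_singleton, ← mulVec_mulVec, ← mulVec_mulVec]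
  have h1 : Instr.op (prepOracles Uρ Uσ) (.query .sigma false Function.Embedding.inr) *ᵥ
      ket (Sum.elim y (zeroBits (Fin (n + m)))) =
      ∑ p : Bits (Fin n) × Bits (Fin m), prepared n m Uσ p •
        ket (Sum.elim y (Fin.append p.1 p.2)) := by
    rw [Instr.op, onWires_inr_mulVec_ket, ← Equiv.sum_comp (appendBits n m)]
    rfl
  rw [h1, mulVec_sum, mulVec_sum, Finset.sum_apply]
  simp only [mulVec_smul, eval_allSwaps]
  simp only [mulVec_ket, Pi.smul_apply, Instr.op, onWires_inr_apply, if_true, smul_ite, smul_zero]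
  rw [Fintype.sum_prod_type]
  simp only [Finset.sum_ite_eq, Finset.mem_univ, if_true]
  rfl

end WCircuit

/-! ### Comparison of singular values -/

section Compare

variable {α β : Type} [Fintype α] [DecidableEq α] [Fintype β] [DecidableEq β]

/-- The matrices may differ in size. Equality up to powers of X means equal non-zero roots with
multiplicity, and g 0 = 0 makes the extra zeros invisible. Applied to suitable g, it transfers trace
norm, rank and the set of non-zero singular values. -/
lemma sum_singVal_eq {M : Matrix α α ℂ} {N : Matrix β β ℂ} {k l : ℕ}
    (h : X ^ k * (Mᴴ * M).charpoly = X ^ l * (Nᴴ * N).charpoly) {g : ℝ → ℝ} (hg : g 0 = 0) :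
    ∑ j, g (singVal M j) = ∑ j, g (singVal N j) := by
  have key : ∀ {γ : Type} [Fintype γ] [DecidableEq γ] (A : Matrix γ γ ℂ) (k : ℕ),
      ((X ^ k * (Aᴴ * A).charpoly).roots.map fun z : ℂ => g √z.re).sum = ∑ j, g (singVal A j) := by
    intro γ _ _ A k
    rw [roots_mul (mul_ne_zero (pow_ne_zero _ X_ne_zero) (charpoly_monic _).ne_zero),
      roots_X_pow, (isHermitian_conjTranspose_mul_self A).roots_charpoly_eq_eigenvalues,
      Multiset.map_add, Multiset.sum_add, Multiset.map_nsmul, Multiset.map_singleton,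
      Multiset.map_map]
    simp [hg, singVal, Function.comp_def, Multiset.sum_nsmul]
  rw [← key M k, ← key N l, h]

lemma singVal_exists_iff {M : Matrix α α ℂ} {N : Matrix β β ℂ} {k l : ℕ}
    (h : X ^ k * (Mᴴ * M).charpoly = X ^ l * (Nᴴ * N).charpoly) {s : ℝ} (hs : s ≠ 0) :
    (∃ j, singVal M j = s) ↔ ∃ j, singVal N j = s := by
  have key : ∀ {γ : Type} [Fintype γ] [DecidableEq γ] (A : Matrix γ γ ℂ),
      (∃ j, singVal A j = s) ↔ ∑ j, (if singVal A j = s then (1 : ℝ) else 0) ≠ 0 := by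
    intro γ _ _ A
    rw [Finset.sum_boole, Ne, Nat.cast_eq_zero, Finset.card_eq_zero,
      Finset.filter_eq_empty_iff]
    simp
  rw [key, key, sum_singVal_eq h (g := fun t => if t = s then (1 : ℝ) else 0) (by simp [hs.symm])]

lemma rank_eq_sum_singVal (M : Matrix α α ℂ) :
    (M.rank : ℝ) = ∑ j, if singVal M j = 0 then (0 : ℝ) else 1 := by
  rw [← rank_conjTranspose_mul_self,
    (isHermitian_conjTranspose_mul_self M).rank_eq_card_non_zero_eigs, Fintype.card_subtype,
    ← Finset.sum_boole]
  refine Finset.sum_congr rfl fun j _ => ?_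
  rw [← singVal_sq]
  by_cases h : singVal M j = 0 <;> simp [h]

lemma traceNorm_eq_of_charpoly {M : Matrix α α ℂ} {N : Matrix β β ℂ} {k l : ℕ}
    (h : X ^ k * (Mᴴ * M).charpoly = X ^ l * (Nᴴ * N).charpoly) : traceNorm M = traceNorm N := by
  rw [traceNorm_eq_sum, traceNorm_eq_sum]
  exact sum_singVal_eq h (g := id) rfl

lemma traceNorm_conjTranspose (M : Matrix α α ℂ) : traceNorm Mᴴ = traceNorm M := by
  refine traceNorm_eq_of_charpoly (k := 0) (l := 0) ?_
  rw [conjTranspose_conjTranspose, charpoly_mul_comm]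

lemma isHermitian_sqrtm (M : Matrix α α ℂ) : (sqrtm M)ᴴ = sqrtm M :=
  (cfc_predicate (R := ℝ) Real.sqrt M : IsSelfAdjoint _)

lemma sqrtm_mul_self {M : Matrix α α ℂ} (hM : M.PosSemidef) : sqrtm M * sqrtm M = M := by
  have hM' : IsSelfAdjoint M := hM.1
  rw [sqrtm, ← cfc_mul Real.sqrt Real.sqrt M]
  conv_rhs => rw [← cfc_id ℝ M]
  refine cfc_congr fun x hx => ?_
  rw [hM.1.spectrum_real_eq_range_eigenvalues] at hx
  obtain ⟨i, rfl⟩ := hx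
  exact Real.mul_self_sqrt (hM.eigenvalues_nonneg i)

lemma sqrtm_mul_self_of_posSemidef {N : Matrix α α ℂ} (hN : N.PosSemidef) :
    sqrtm (N * N) = N := by
  have hN' : IsSelfAdjoint N := hN.1
  have h2 : N * N = cfc (fun x : ℝ => x * x) N := by
    rw [cfc_mul (fun x : ℝ => x) (fun x : ℝ => x) N, cfc_id' ℝ N]
  rw [sqrtm, h2, ← cfc_comp' Real.sqrt (fun x : ℝ => x * x) N]
  conv_rhs => rw [← cfc_id ℝ N]
  refine cfc_congr fun x hx => ?_
  rw [hN.1.spectrum_real_eq_range_eigenvalues] at hx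
  obtain ⟨i, rfl⟩ := hx
  exact Real.sqrt_mul_self (hN.eigenvalues_nonneg i)

end Compare

/-! ### Pure bipartite states as matrices, and the overlap operator -/

section Overlap

variable {n m : ℕ}

/-- A state on `AB` as a matrix. -/
def stateMatrix (ψ : Bits (Fin n) × Bits (Fin m) → ℂ) : Matrix (Bits (Fin n)) (Bits (Fin m)) ℂ :=
  of fun s t => ψ (s, t)

lemma reducedA_eq (ψ : Bits (Fin n) × Bits (Fin m) → ℂ) :
    reducedA ψ = stateMatrix ψ * (stateMatrix ψ)ᴴ := by
  ext s t
  simp [reducedA, traceSnd, ketbra, vecMulVec_apply, stateMatrix, mul_apply]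

lemma posSemidef_reducedA (ψ : Bits (Fin n) × Bits (Fin m) → ℂ) : (reducedA ψ).PosSemidef := by
  rw [reducedA_eq]
  exact posSemidef_self_mul_conjTranspose _

lemma traceFst_ketbra_eq (ρ σ : Bits (Fin n) × Bits (Fin m) → ℂ) :
    traceFst (ketbra σ ρ) = (stateMatrix σ)ᵀ * (stateMatrix ρ)ᴴᵀ := by
  ext s t
  simp [traceFst, ketbra, vecMulVec_apply, stateMatrix, mul_apply]

/-- With R and S the states as matrices, the Gram matrix of M is the transpose of R†SS†R, while that
of √σ√ρ has the characteristic polynomial of SS†RR†. Exchanging the factors of a rectangular product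
changes the characteristic polynomial only by a power of X. -/
lemma charpoly_overlap (ρ σ : Bits (Fin n) × Bits (Fin m) → ℂ) :
    X ^ Fintype.card (Bits (Fin n)) *
        ((traceFst (ketbra σ ρ))ᴴ * traceFst (ketbra σ ρ)).charpoly =
      X ^ Fintype.card (Bits (Fin m)) * ((overlapA ρ σ)ᴴ * overlapA ρ σ).charpoly := by
  set R := stateMatrix ρ
  set S := stateMatrix σ
  have h1 : (traceFst (ketbra σ ρ))ᴴ * traceFst (ketbra σ ρ) =
      ((Rᴴ * (S * Sᴴ * R)))ᵀ := by
    have hR : Rᴴᵀᴴ = Rᵀ := by ext; simp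
    have hS : Sᵀᴴ = Sᴴᵀ := rfl
    rw [traceFst_ketbra_eq, conjTranspose_mul, hR, hS, transpose_mul, transpose_mul, transpose_mul]
    simp only [R, S, Matrix.mul_assoc]
  have h2 : ((overlapA ρ σ)ᴴ * overlapA ρ σ).charpoly = (S * Sᴴ * R * Rᴴ).charpoly := by
    rw [overlapA, conjTranspose_mul, isHermitian_sqrtm, isHermitian_sqrtm, charpoly_mul_comm,
      Matrix.mul_assoc, ← Matrix.mul_assoc (sqrtm (reducedA ρ)),
      sqrtm_mul_self (posSemidef_reducedA ρ), charpoly_mul_comm, Matrix.mul_assoc,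
      sqrtm_mul_self (posSemidef_reducedA σ), reducedA_eq, reducedA_eq, charpoly_mul_comm]
    simp only [R, S, Matrix.mul_assoc]
  rw [h1, charpoly_transpose, h2, ← charpoly_mul_comm']

end Overlap

/-! ### Fidelity with a pure state -/

section Fidelity

variable {γ : Type} [Fintype γ] [DecidableEq γ]

omit [DecidableEq γ] in
lemma posSemidef_ketbra (ψ : γ → ℂ) : (ketbra ψ ψ).PosSemidef :=
  posSemidef_vecMulVec_self_star ψ

omit [DecidableEq γ] in
lemma mul_ketbra {δ : Type} (A : Matrix δ γ ℂ) (ψ φ : γ → ℂ) :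
    A * ketbra ψ φ = vecMulVec (A *ᵥ ψ) (star φ) :=
  mul_vecMulVec A ψ (star φ)

omit [DecidableEq γ] in
lemma ketbra_mul_mul_ketbra (ψ : γ → ℂ) (A : Matrix γ γ ℂ) :
    ketbra ψ ψ * A * ketbra ψ ψ = (star ψ ⬝ᵥ A *ᵥ ψ) • ketbra ψ ψ := by
  rw [Matrix.mul_assoc, mul_ketbra, ketbra, vecMulVec_mul_vecMulVec, vecMulVec_smul]

/-- For a pure state K = |σ⟩⟨σ| is its own square root, and (√τ K)†(√τ K) = cK = (√c K)² with c =
⟨σ|τ|σ⟩. So the trace norm is √c. -/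
lemma fidelity_ketbra {τ : Matrix γ γ ℂ} (hτ : τ.PosSemidef) {σ : γ → ℂ} (hσ : star σ ⬝ᵥ σ = 1) :
    fidelity τ (ketbra σ σ) = (star σ ⬝ᵥ τ *ᵥ σ).re := by
  set K := ketbra σ σ with hK
  have hKK : K * K = K := by
    have := ketbra_mul_mul_ketbra σ 1
    rwa [Matrix.mul_one, one_mulVec, hσ, one_smul] at this
  have hKp : K.PosSemidef := posSemidef_ketbra σ
  have hsK : sqrtm K = K := by
    have := sqrtm_mul_self_of_posSemidef hKp
    rwa [hKK] at this
  set c := (star σ ⬝ᵥ τ *ᵥ σ) with hc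
  have hc0 : 0 ≤ c := hτ.dotProduct_mulVec_nonneg σ
  have hcr : 0 ≤ c.re := (Complex.le_def.1 hc0).1
  have hcc : (c.re : ℂ) = c := (Complex.eq_re_of_ofReal_le hc0).symm
  have hN : (sqrtm τ * K)ᴴ * (sqrtm τ * K) = ((√c.re : ℝ) : ℂ) • K * (((√c.re : ℝ) : ℂ) • K) := by
    rw [conjTranspose_mul, isHermitian_sqrtm, hKp.1.eq, Matrix.mul_assoc,
      ← Matrix.mul_assoc (sqrtm τ), sqrtm_mul_self hτ, ← Matrix.mul_assoc,
      ketbra_mul_mul_ketbra, ← hc, Matrix.smul_mul, Matrix.mul_smul, smul_smul, hKK,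
      ← Complex.ofReal_mul, Real.mul_self_sqrt hcr, hcc]
  have hKs : (((√c.re : ℝ) : ℂ) • K).PosSemidef :=
    hKp.smul (by exact_mod_cast Real.sqrt_nonneg _)
  have htr : K.trace = 1 := by
    rw [hK, ketbra, trace_vecMulVec, dotProduct_comm, hσ]
  rw [fidelity, hsK, traceNorm, hN, sqrtm_mul_self_of_posSemidef hKs, trace_smul, htr, smul_eq_mul,
    mul_one, Complex.ofReal_re, Real.sq_sqrt hcr]

end Fidelity

/-! ### Local operations -/

section Local

open scoped Matrix.Norms.L2Operator

variable {γ α β : Type} [Fintype γ] [DecidableEq γ] [Fintype α] [DecidableEq α] [Fintype β]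
  [DecidableEq β]

/-- The operator `I ⊗ K`. -/
def localOp (γ : Type) [DecidableEq γ] (K : Matrix β α ℂ) : Matrix (γ × β) (γ × α) ℂ :=
  (1 : Matrix γ γ ℂ) ⊗ₖ K

omit [Fintype α] [DecidableEq α] [DecidableEq β] in
lemma localOp_conjTranspose_mul (K L : Matrix β α ℂ) :
    (localOp γ K)ᴴ * localOp γ L = localOp γ (Kᴴ * L) := by
  rw [localOp, localOp, localOp, conjTranspose_kronecker, conjTranspose_one, ← mul_kronecker_mul,
    Matrix.one_mul]

omit [Fintype γ] [Fintype α] [DecidableEq α] [Fintype β] [DecidableEq β] in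
lemma localOp_sub (K L : Matrix β α ℂ) : localOp γ (K - L) = localOp γ K - localOp γ L := by
  ext p q
  simp [localOp, kroneckerMap_apply, mul_sub]

omit [Fintype γ] [Fintype α] in
lemma localOp_one : localOp γ (1 : Matrix α α ℂ) = 1 := one_kronecker_one

/-- Tensoring with the identity only repeats the eigenvalues, so the bound does not depend on the
reference system. -/
lemma norm_localOp_specOp_le (M : Matrix α α ℂ) {h : α → ℂ} {c : ℝ} (hc : 0 ≤ c)
    (hh : ∀ j, ‖h j‖ ≤ c) : ‖localOp γ (specOp M h)‖ ≤ c := by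
  have h1 : localOp γ (specOp M h) = localOp γ (singUnitary M).1 *
      diagonal (fun p : γ × α => h p.2) * (localOp γ (singUnitary M).1)ᴴ := by
    have h2 : diagonal (fun p : γ × α => h p.2) = (1 : Matrix γ γ ℂ) ⊗ₖ diagonal h := by
      rw [← diagonal_one, diagonal_kronecker_diagonal]
      simp
    rw [h2, localOp, localOp, conjTranspose_kronecker, conjTranspose_one, ← mul_kronecker_mul,
      ← mul_kronecker_mul, Matrix.one_mul, Matrix.one_mul, specOp]
  rw [h1]
  refine norm_conj_diagonal_le ?_ hc fun p => hh p.2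
  rw [localOp_conjTranspose_mul, singUnitary_conjTranspose_mul, localOp_one]

omit [DecidableEq α] [Fintype β] [DecidableEq β] in
lemma idTensor_conj (K : Matrix β α ℂ) (T : Matrix α α ℂ →ₗ[ℂ] Matrix β β ℂ)
    (hT : ∀ A, T A = K * A * Kᴴ) (N : Matrix (γ × α) (γ × α) ℂ) :
    idTensor γ T N = localOp γ K * N * (localOp γ K)ᴴ := by
  ext p q
  simp only [idTensor, of_apply, hT, mul_apply, conjTranspose_apply, localOp, kroneckerMap_apply,
    one_apply, Fintype.sum_prod_type, ite_mul, one_mul, zero_mul]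
  simp [Finset.sum_ite_irrel, apply_ite (starRingEnd ℂ)]

/-- Tensoring both isometries with the identity keeps them isometries and keeps their distance at
most ε, since (J-J')†(J-J') is diagonal in a known basis. The factor 2 of `traceNorm_conj_sub_le`
cancels the 1/2. -/
lemma diamondNorm_le {J J' : Matrix β α ℂ} (hJ : Jᴴ * J = 1) (hJ' : J'ᴴ * J' = 1) {ε : ℝ}
    (hε : 0 ≤ ε) {M : Matrix α α ℂ} {h : α → ℂ} (hΔ : (J - J')ᴴ * (J - J') = specOp M h)
    (hh : ∀ j, ‖h j‖ ≤ ε ^ 2) (T T' : Matrix α α ℂ →ₗ[ℂ] Matrix β β ℂ)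
    (hT : ∀ A, T A = J * A * Jᴴ) (hT' : ∀ A, T' A = J' * A * J'ᴴ) :
    (1 / 2) * diamondNorm (T - T') ≤ ENNReal.ofReal ε := by
  have key : diamondNorm (T - T') ≤ ENNReal.ofReal (2 * ε) := by
    refine iSup_le fun d => iSup_le fun N => iSup_le fun hN => ENNReal.ofReal_le_ofReal ?_
    have h1 : idTensor (Fin d) (T - T') N =
        localOp (Fin d) J * N * (localOp (Fin d) J)ᴴ -
          localOp (Fin d) J' * N * (localOp (Fin d) J')ᴴ := by
      rw [← idTensor_conj J T hT, ← idTensor_conj J' T' hT']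
      rfl
    rw [h1]
    refine (traceNorm_conj_sub_le (by rw [localOp_conjTranspose_mul, hJ, localOp_one])
      (by rw [localOp_conjTranspose_mul, hJ', localOp_one]) (ε := ε) ?_ N).trans ?_
    · rw [← localOp_sub]
      refine norm_le_of_conjTranspose_mul_self hε ?_
      rw [localOp_conjTranspose_mul, hΔ]
      exact norm_localOp_specOp_le M (by positivity) hh
    · nlinarith [traceNorm_nonneg N]
  calc (1 / 2) * diamondNorm (T - T') ≤ (1 / 2) * ENNReal.ofReal (2 * ε) := by gcongr
    _ = ENNReal.ofReal ε := by
      rw [show (1 / 2 : ℝ≥0∞) = ENNReal.ofReal (1 / 2) by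
        rw [ENNReal.ofReal_div_of_pos two_pos]; simp, ← ENNReal.ofReal_mul (by norm_num)]
      congr 1
      ring

omit [DecidableEq α] [Fintype β] [DecidableEq β] in
lemma localOp_mul_ketbra_mul (K : Matrix β α ℂ) (ψ : γ × α → ℂ) :
    localOp γ K * ketbra ψ ψ * (localOp γ K)ᴴ =
      ketbra (localOp γ K *ᵥ ψ) (localOp γ K *ᵥ ψ) := by
  rw [mul_ketbra, ketbra, vecMulVec_mul, star_mulVec]

omit [DecidableEq α] in
lemma dotProduct_localOp_mulVec (K : Matrix α α ℂ) (ρ σ : γ × α → ℂ) :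
    star σ ⬝ᵥ (localOp γ K *ᵥ ρ) = ((traceFst (ketbra σ ρ))ᴴ * K).trace := by
  simp only [dotProduct, mulVec, localOp, kroneckerMap_apply, one_apply, Fintype.sum_prod_type,
    ite_mul, one_mul, zero_mul, trace, diag_apply, mul_apply, conjTranspose_apply, traceFst,
    ketbra, vecMulVec_apply, of_apply, Pi.star_apply]
  simp only [Finset.sum_ite_irrel, Finset.sum_const_zero, Finset.sum_ite_eq, Finset.mem_univ,
    if_true, star_sum, star_mul', star_star, Finset.mul_sum, Finset.sum_mul]
  rw [Finset.sum_congr rfl fun g _ => Finset.sum_comm, Finset.sum_comm]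
  refine Finset.sum_congr rfl fun y _ => ?_
  rw [Finset.sum_comm]
  refine Finset.sum_congr rfl fun x _ => Finset.sum_congr rfl fun g _ => ?_
  ring

end Local

/-! ### Channels built from a block-encoding -/

section BlockEncoding

variable {S D : Type} [Fintype S] [DecidableEq S] [Fintype D] [DecidableEq D]

omit [Fintype S] [DecidableEq S] [Fintype D] [DecidableEq D] in
lemma eq_elim_zeroBits_iff {x : Bits (S ⊕ D)} {z : Bits S} :
    x = Sum.elim z (zeroBits D) ↔ x ∘ Sum.inl = z ∧ x ∘ Sum.inr = zeroBits D := by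
  constructor
  · rintro rfl
    exact ⟨rfl, rfl⟩
  · rintro ⟨rfl, h⟩
    rw [← h, Sum.elim_comp_inl_inr]

lemma prepZero_eq (X : Op S) : prepZero S D X = zeroEmb S D * X * (zeroEmb S D)ᴴ := by
  classical
  ext x y
  simp only [prepZero, LinearMap.coe_mk, AddHom.coe_mk, of_apply, mul_apply, zeroEmb,
    conjTranspose_apply, eq_elim_zeroBits_iff]
  by_cases hx : x ∘ Sum.inr = zeroBits D <;> by_cases hy : y ∘ Sum.inr = zeroBits D <;>
    simp [hx, hy, apply_ite (starRingEnd ℂ)]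

lemma conjChannel_comp_prepZero (W : Op (S ⊕ D)) (X : Op S) :
    (conjChannel W ∘ₗ prepZero S D) X = W * zeroEmb S D * X * (W * zeroEmb S D)ᴴ := by
  rw [LinearMap.comp_apply, prepZero_eq, conjTranspose_mul]
  simp only [conjChannel, LinearMap.coe_mk, AddHom.coe_mk, Matrix.mul_assoc]

lemma mul_zeroEmb_isometry (W : UOp (S ⊕ D)) :
    (W.1 * zeroEmb S D)ᴴ * (W.1 * zeroEmb S D) = 1 := by
  have h : W.1ᴴ * W.1 = 1 := mem_unitaryGroup_iff'.1 W.2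
  rw [conjTranspose_mul, Matrix.mul_assoc, ← Matrix.mul_assoc W.1ᴴ, h, Matrix.one_mul,
    zeroEmb_conjTranspose_mul]

/-- Every isometry that adds the register `D` is the restriction of a unitary to `|0⟩` on `D`. -/
lemma exists_unitary_mul_zeroEmb {J : Matrix (Bits (S ⊕ D)) (Bits S) ℂ} (hJ : Jᴴ * J = 1) :
    ∃ U : UOp (S ⊕ D), U.1 * zeroEmb S D = J := by
  -- The family is meaningful only on labels with zero D-bits, where it is orthonormal; the
  -- remaining columns come from extending it to an orthonormal basis.
  set v : Bits (S ⊕ D) → EuclideanSpace ℂ (Bits (S ⊕ D)) :=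
    fun x => WithLp.toLp 2 fun z => J z (x ∘ Sum.inl) with hv
  set s : Set (Bits (S ⊕ D)) := {x | x ∘ Sum.inr = zeroBits D} with hs
  have hinner : ∀ x y, inner ℂ (v x) (v y) = (Jᴴ * J) (x ∘ Sum.inl) (y ∘ Sum.inl) := fun x y => by
    simp [hv, PiLp.inner_apply, mul_apply, mul_comm]
  have ho : Orthonormal ℂ (s.domRestrict v) := by
    rw [orthonormal_iff_ite]
    rintro ⟨x, hx⟩ ⟨y, hy⟩
    rw [Set.domRestrict_apply, Set.domRestrict_apply, hinner, hJ, one_apply]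
    refine if_congr ?_ rfl rfl
    rw [Subtype.mk.injEq]
    exact ⟨fun h => (eq_elim_zeroBits_iff.2 ⟨h, hx⟩).trans (eq_elim_zeroBits_iff.2 ⟨rfl, hy⟩).symm,
      fun h => congrArg (· ∘ Sum.inl) h⟩
  obtain ⟨b, hb⟩ := ho.exists_orthonormalBasis_extension_of_card_eq (by simp)
  refine ⟨⟨of fun x y => b y x, mem_unitaryGroup_iff'.2 ?_⟩, ?_⟩
  · ext x y
    have := orthonormal_iff_ite.1 b.orthonormal x y
    rw [one_apply, ← this, star_eq_conjTranspose, mul_apply, PiLp.inner_apply]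
    simp [mul_comm]
  · ext x y
    have h : b (Sum.elim y (zeroBits D)) = v (Sum.elim y (zeroBits D)) := hb _ (by simp [hs])
    rw [mul_zeroEmb_apply]
    change b (Sum.elim y (zeroBits D)) x = _
    rw [h]
    simp [hv]

/-- Let p = V†V. The ideal isometry J' sends the range of p to V with ancilla |0⟩ and copies J on
the complement, so no error arises there. It is an isometry because the block A of J satisfies A =
Ap, which kills the cross terms. The Gram operator of J - J' then has eigenvalues 2(1 - f(s_j))
where s_j ≠ 0 and 0 elsewhere: an error in f enters the distance through its square root. -/
lemma exists_unitary_diamondNorm_le {M : Op S} {f : ℝ → ℝ} {ε : ℝ} (hε : 0 ≤ ε)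
    (W : UOp (S ⊕ D)) (hW : topBlock W.1 = svTransform f M)
    (hf : ∀ j, singVal M j ≠ 0 → 2 * |f (singVal M j) - 1| ≤ ε ^ 2) :
    ∃ U : UOp (S ⊕ D), topBlock U.1 = polarIsometry M ∧
      (1 / 2) * diamondNorm (conjChannel W.1 ∘ₗ prepZero S D - conjChannel U.1 ∘ₗ prepZero S D)
        ≤ ENNReal.ofReal ε := by
  set V := polarIsometry M with hV
  set A := svTransform f M with hA
  set E := zeroEmb S D with hE
  set J := W.1 * E with hJdef
  have hEE : Eᴴ * E = 1 := zeroEmb_conjTranspose_mul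
  have hJ : Jᴴ * J = 1 := mul_zeroEmb_isometry W
  have hEJ : Eᴴ * J = A := by rw [← hW, topBlock_eq, Matrix.mul_assoc]
  have hJE : Jᴴ * E = Aᴴ := by
    rw [← hEJ, conjTranspose_mul Eᴴ, conjTranspose_conjTranspose]
  set p := Vᴴ * V with hp
  have hpH : pᴴ = p := by rw [hp, conjTranspose_mul, conjTranspose_conjTranspose]
  have hVp : V * p = V := by
    rw [hp, ← Matrix.mul_assoc, hV, polarIsometry_mul_conjTranspose_mul]
  have hpV : p * Vᴴ = Vᴴ := by
    rw [← hpH, ← conjTranspose_mul, hVp]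
  have hpp : p * p = p := by
    conv_lhs => rw [hp, Matrix.mul_assoc, ← hp, hVp]
  have hAp : A * p = A := svTransform_mul_polar M f
  have hpA : p * Aᴴ = Aᴴ := by rw [← hpH, ← conjTranspose_mul, hAp]
  set J' := E * V + J * (1 - p) with hJ'def
  have hEJ' : Eᴴ * J' = V := by
    rw [hJ'def, Matrix.mul_add, ← Matrix.mul_assoc, hEE, ← Matrix.mul_assoc, hEJ, Matrix.one_mul,
      Matrix.mul_sub, Matrix.mul_one, hAp, sub_self, add_zero]
  have hJJ' : Jᴴ * J' = Aᴴ * V + (1 - p) := by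
    rw [hJ'def, Matrix.mul_add, ← Matrix.mul_assoc, hJE, ← Matrix.mul_assoc, hJ, Matrix.one_mul]
  have hJ'H : J'ᴴ = Vᴴ * Eᴴ + (1 - p) * Jᴴ := by
    rw [hJ'def, conjTranspose_add, conjTranspose_mul, conjTranspose_mul, conjTranspose_sub, hpH,
      conjTranspose_one]
  have hJ' : J'ᴴ * J' = 1 := by
    rw [hJ'H, Matrix.add_mul, Matrix.mul_assoc, hEJ', Matrix.mul_assoc, hJJ', ← hp]
    have : (1 - p) * (Aᴴ * V + (1 - p)) = 1 - p := by
      rw [Matrix.mul_add, ← Matrix.mul_assoc, Matrix.sub_mul, Matrix.mul_sub, hpA, Matrix.sub_mul 1 p p,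
        hpp]
      simp
    rw [this]
    abel
  have hJ'J : J'ᴴ * J = Vᴴ * A + (1 - p) := by
    have := congrArg conjTranspose hJJ'
    simpa [conjTranspose_mul, hpH] using this
  have hΔ : (J - J')ᴴ * (J - J') =
      specOp M fun j => if singVal M j = 0 then 0 else ((2 * (1 - f (singVal M j)) : ℝ) : ℂ) := by
    have h1 : (J - J')ᴴ * (J - J') = p + p - Aᴴ * V - Vᴴ * A := by
      rw [conjTranspose_sub, Matrix.sub_mul, Matrix.mul_sub, Matrix.mul_sub, hJ, hJ', hJJ', hJ'J]
      abel
    rw [h1, hp, hV, hA, polarIsometry, svTransform_conjTranspose_mul,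
      svTransform_conjTranspose_mul, svTransform_conjTranspose_mul, ← specOp_add, ← specOp_sub,
      ← specOp_sub]
    congr 1
    funext j
    simp only [Pi.sub_apply, Pi.add_apply]
    split_ifs with h
    · simp
    · rw [Real.sign_of_pos (lt_of_le_of_ne (singVal_nonneg M j) (Ne.symm h))]
      push_cast
      ring
  obtain ⟨U, hU⟩ := exists_unitary_mul_zeroEmb hJ'
  refine ⟨U, by rw [topBlock_eq, Matrix.mul_assoc, hU, hEJ'], ?_⟩
  refine diamondNorm_le hJ hJ' hε hΔ (fun j => ?_) _ _ (conjChannel_comp_prepZero W.1) fun X => ?_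
  · split_ifs with h
    · simpa using sq_nonneg ε
    · rw [Complex.norm_real, Real.norm_eq_abs, abs_mul, abs_two, abs_sub_comm]
      exact hf j h
  · rw [conjChannel_comp_prepZero, hU]

/-- The Kraus operators of `X ↦ tr_D (W (X ⊗ |0⟩⟨0|) W†)`. -/
def kraus (W : Op (S ⊕ D)) (d : Bits D) : Op S :=
  of fun x y => W (Sum.elim x d) (Sum.elim y (zeroBits D))

lemma traceOut_conjChannel_prepZero (W : Op (S ⊕ D)) :
    traceOut S D ∘ₗ conjChannel W ∘ₗ prepZero S D = ∑ d, conjChannel (kraus W d) := by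
  refine LinearMap.ext fun X => ?_
  rw [LinearMap.comp_apply, conjChannel_comp_prepZero]
  ext x y
  simp only [traceOut, LinearMap.coe_mk, AddHom.coe_mk, of_apply, LinearMap.sum_apply,
    Matrix.sum_apply, conjChannel]
  refine Finset.sum_congr rfl fun d _ => ?_
  simp only [mul_apply, conjTranspose_apply, ← mul_zeroEmb_apply, kraus, of_apply]

omit [Fintype D] [DecidableEq D] in
lemma idTensor_sum_conjChannel {γ κ : Type} [Fintype γ] [DecidableEq γ] [Fintype κ]
    (K : κ → Op S) (N : Matrix (γ × Bits S) (γ × Bits S) ℂ) :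
    idTensor γ (∑ d, conjChannel (K d)) N =
      ∑ d, localOp γ (K d) * N * (localOp γ (K d))ᴴ := by
  have h : ∀ d, localOp γ (K d) * N * (localOp γ (K d))ᴴ = idTensor γ (conjChannel (K d)) N :=
    fun d => (idTensor_conj (K d) _ (fun A => rfl) N).symm
  simp only [h]
  ext p q
  simp [idTensor, LinearMap.sum_apply, Matrix.sum_apply]

lemma star_dotProduct_ketbra_mulVec {γ : Type} [Fintype γ] (σ ψ : γ → ℂ) :
    (star σ ⬝ᵥ ketbra ψ ψ *ᵥ σ).re = ‖star σ ⬝ᵥ ψ‖ ^ 2 := by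
  rw [ketbra, vecMulVec_mulVec, dotProduct_smul]
  have : star ψ ⬝ᵥ σ = star (star σ ⬝ᵥ ψ) := by
    rw [star_dotProduct]
  rw [this, op_smul_eq_mul, Complex.star_def, Complex.mul_conj, Complex.ofReal_re,
    Complex.normSq_eq_norm_sq]

lemma fidelity_idTensor_conjChannel {γ : Type} [Fintype γ] [DecidableEq γ] (V : Op S)
    (ρ : γ × Bits S → ℂ) {σ : γ × Bits S → ℂ} (hσ : star σ ⬝ᵥ σ = 1) :
    fidelity (idTensor γ (conjChannel V) (ketbra ρ ρ)) (ketbra σ σ) =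
      ‖((traceFst (ketbra σ ρ))ᴴ * V).trace‖ ^ 2 := by
  rw [idTensor_conj V _ (fun A => rfl), localOp_mul_ketbra_mul,
    fidelity_ketbra (posSemidef_ketbra _) hσ, star_dotProduct_ketbra_mulVec,
    dotProduct_localOp_mulVec]

/-- The fidelity with a pure state is the sum of the squared overlaps over all Kraus operators; only
the term of the outcome |0⟩ of D, whose Kraus operator is the block, is kept. -/
lemma sq_norm_trace_le_fidelity {γ : Type} [Fintype γ] [DecidableEq γ] (W : Op (S ⊕ D))
    (ρ : γ × Bits S → ℂ) {σ : γ × Bits S → ℂ} (hσ : star σ ⬝ᵥ σ = 1) :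
    ‖((traceFst (ketbra σ ρ))ᴴ * topBlock W).trace‖ ^ 2 ≤
      fidelity (idTensor γ (traceOut S D ∘ₗ conjChannel W ∘ₗ prepZero S D) (ketbra ρ ρ))
        (ketbra σ σ) := by
  rw [traceOut_conjChannel_prepZero, idTensor_sum_conjChannel]
  simp only [localOp_mul_ketbra_mul]
  rw [fidelity_ketbra (posSemidef_sum _ fun d _ => posSemidef_ketbra _) hσ, sum_mulVec,
    dotProduct_sum, Complex.re_sum]
  simp only [star_dotProduct_ketbra_mulVec, dotProduct_localOp_mulVec]
  exact Finset.single_le_sum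
    (f := fun d => ‖((traceFst (ketbra σ ρ))ᴴ * kraus W d).trace‖ ^ 2)
    (fun d _ => sq_nonneg _) (Finset.mem_univ (zeroBits D))

-- The trace norm equals ⟨σ|(I ⊗ V)|ρ⟩ with V the polar isometry, a contraction; Cauchy–Schwarz
-- finishes. This keeps all singular values in [0, 1], where P is controlled.
open scoped Matrix.Norms.L2Operator in
lemma traceNorm_traceFst_le_one {γ α : Type} [Fintype γ] [DecidableEq γ] [Fintype α]
    [DecidableEq α] {ρ σ : γ × α → ℂ} (hρ : star ρ ⬝ᵥ ρ = 1) (hσ : star σ ⬝ᵥ σ = 1) :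
    traceNorm (traceFst (ketbra σ ρ)) ≤ 1 := by
  set M := traceFst (ketbra σ ρ)
  set V := polarIsometry M
  have h1 : (traceNorm M : ℂ) = star σ ⬝ᵥ (localOp γ V *ᵥ ρ) := by
    rw [dotProduct_localOp_mulVec, trace_conjTranspose_mul_polarIsometry]
  have hV : ‖localOp γ V‖ ≤ 1 := by
    refine norm_le_of_conjTranspose_mul_self zero_le_one ?_
    rw [localOp_conjTranspose_mul, polarIsometry_conjTranspose_mul, one_pow]
    refine norm_localOp_specOp_le M zero_le_one fun j => ?_
    split_ifs <;> simp
  have hn : ∀ ψ : γ × α → ℂ, star ψ ⬝ᵥ ψ = 1 → ‖WithLp.toLp 2 ψ‖ = 1 := fun ψ h => by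
    have h2 : inner ℂ (WithLp.toLp 2 ψ) (WithLp.toLp 2 ψ) = (1 : ℂ) := by
      rw [EuclideanSpace.inner_toLp_toLp, dotProduct_comm, h]
    rw [inner_self_eq_norm_sq_to_K] at h2
    have h3 : ‖WithLp.toLp 2 ψ‖ ^ 2 = 1 := Complex.ofReal_injective (by simpa using h2)
    exact (pow_eq_one_iff_of_nonneg (norm_nonneg _) two_ne_zero).1 h3
  have h2 : ‖(traceNorm M : ℂ)‖ ≤ 1 := by
    have h3 : (traceNorm M : ℂ) = inner ℂ (WithLp.toLp 2 σ) (WithLp.toLp 2 (localOp γ V *ᵥ ρ)) := by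
      rw [h1, EuclideanSpace.inner_toLp_toLp, dotProduct_comm]
    rw [h3]
    refine (norm_inner_le_norm _ _).trans ?_
    rw [hn σ hσ, one_mul]
    have h4 := l2_opNorm_mulVec (localOp γ V) (WithLp.toLp 2 ρ)
    rw [hn ρ hρ, mul_one] at h4
    exact h4.trans hV
  rw [Complex.norm_real] at h2
  exact (le_abs_self _).trans h2

end BlockEncoding

/-! ### Singular values of the overlap -/

section Overlap

section MinSingVal

variable {α : Type} [Fintype α] [DecidableEq α] {M : Matrix α α ℂ}

lemma exists_singVal_ne_zero (h : M ≠ 0) : ∃ j, singVal M j ≠ 0 := by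
  by_contra! hc
  refine h (conjTranspose_mul_self_eq_zero.1 ?_)
  rw [conjTranspose_mul_self_eq_specOp]
  simp [hc, specOp, show (fun _ : α => (0 : ℂ)) = 0 from rfl]

lemma minSingVal_mem (h : M ≠ 0) : minSingVal M ≠ 0 ∧ ∃ j, singVal M j = minSingVal M := by
  have hfin : {s | s ≠ 0 ∧ ∃ j, singVal M j = s}.Finite :=
    (Set.finite_range (singVal M)).subset fun s hs => hs.2
  obtain ⟨j, hj⟩ := exists_singVal_ne_zero h
  have hne : {s | s ≠ 0 ∧ ∃ j, singVal M j = s}.Nonempty := ⟨_, hj, j, rfl⟩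
  exact hne.csInf_mem hfin

lemma minSingVal_le {j : α} (h : singVal M j ≠ 0) : minSingVal M ≤ singVal M j := by
  refine csInf_le ⟨0, ?_⟩ ⟨h, j, rfl⟩
  rintro _ ⟨-, i, rfl⟩
  exact singVal_nonneg M i

end MinSingVal

variable {n m : ℕ}

lemma star_dotProduct_prepared (U : UOp (Fin (n + m))) :
    star (prepared n m U) ⬝ᵥ prepared n m U = 1 := by
  have h : (U.1ᴴ * U.1) (zeroBits _) (zeroBits _) = 1 := by
    rw [show U.1ᴴ * U.1 = 1 from mem_unitaryGroup_iff'.1 U.2, one_apply_eq]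
  rw [← h, mul_apply, dotProduct]
  exact Fintype.sum_equiv (Fin.appendEquiv n m) _ _ fun p => rfl

variable (ρ σ : Bits (Fin n) × Bits (Fin m) → ℂ)

lemma fidelity_reducedA :
    fidelity (reducedA ρ) (reducedA σ) = traceNorm (traceFst (ketbra σ ρ)) ^ 2 := by
  have h : sqrtm (reducedA ρ) * sqrtm (reducedA σ) = (overlapA ρ σ)ᴴ := by
    rw [overlapA, conjTranspose_mul, isHermitian_sqrtm, isHermitian_sqrtm]
  rw [fidelity, h, traceNorm_conjTranspose, traceNorm_eq_of_charpoly (charpoly_overlap ρ σ)]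

variable {ρ σ}

lemma minSingVal_overlapA_le {j : Bits (Fin m)} (h : singVal (traceFst (ketbra σ ρ)) j ≠ 0) :
    minSingVal (overlapA ρ σ) ≤ singVal (traceFst (ketbra σ ρ)) j := by
  obtain ⟨i, hi⟩ := (singVal_exists_iff (charpoly_overlap ρ σ) h).1 ⟨j, rfl⟩
  rw [← hi] at h ⊢
  exact minSingVal_le h

lemma exists_singVal_eq_minSingVal (h : overlapA ρ σ ≠ 0) :
    ∃ j, singVal (traceFst (ketbra σ ρ)) j = minSingVal (overlapA ρ σ) :=
  (singVal_exists_iff (charpoly_overlap ρ σ) (minSingVal_mem h).1).2 (minSingVal_mem h).2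

lemma rank_overlapA : ((overlapA ρ σ).rank : ℝ) =
    ∑ j, if singVal (traceFst (ketbra σ ρ)) j = 0 then (0 : ℝ) else 1 := by
  rw [rank_eq_sum_singVal]
  exact (sum_singVal_eq (charpoly_overlap ρ σ) (g := fun x => if x = 0 then 0 else 1)
    (by simp)).symm

lemma one_le_rank_overlapA (h : overlapA ρ σ ≠ 0) : 1 ≤ (overlapA ρ σ).rank := by
  obtain ⟨j, hj⟩ := exists_singVal_ne_zero h
  have h1 : (1 : ℝ) ≤ (overlapA ρ σ).rank := by
    rw [rank_eq_sum_singVal]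
    refine le_trans (by rw [if_neg hj]) (Finset.single_le_sum
      (f := fun j => if singVal (overlapA ρ σ) j = 0 then (0 : ℝ) else 1) (fun i _ => ?_)
      (Finset.mem_univ j))
    split_ifs <;> norm_num
  exact_mod_cast h1

lemma singVal_le_one (hρ : star ρ ⬝ᵥ ρ = 1) (hσ : star σ ⬝ᵥ σ = 1) (j : Bits (Fin m)) :
    singVal (traceFst (ketbra σ ρ)) j ≤ 1 := by
  refine le_trans ?_ (traceNorm_traceFst_le_one hρ hσ)
  rw [traceNorm_eq_sum]
  exact Finset.single_le_sum (fun i _ => singVal_nonneg _ i) (Finset.mem_univ j)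

end Overlap

/-! ### Approximate sign of small singular values -/

/-- Singular values above β lose at most the fraction δ, in total at most δ since they sum to at
most 1. A non-zero one below β loses at most 2β because |P| ≤ 1; either there are none, or all
together cost at most another δ. -/
lemma sum_sub_le_sum_mul {ι : Type*} [Fintype ι] {s : ι → ℝ} {P : ℝ → ℝ} {δ β : ℝ}
    (hδ : 0 ≤ δ) (hs0 : ∀ j, 0 ≤ s j) (hs1 : ∑ j, s j ≤ 1)
    (hP : ∀ x : ℝ, |x| ≤ 1 → |P x| ≤ 1)
    (hPs : ∀ x : ℝ, β ≤ |x| → |x| ≤ 1 → |P x - Real.sign x| ≤ δ)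
    (hβ : (∀ j, s j ≠ 0 → β ≤ s j) ∨
      0 ≤ β ∧ 2 * β * ∑ j, (if s j = 0 then (0 : ℝ) else 1) ≤ δ) :
    ∑ j, s j - 2 * δ ≤ ∑ j, s j * P (s j) := by
  have hs : ∀ j, |s j| ≤ 1 := fun j => by
    rw [abs_of_nonneg (hs0 j)]
    exact (Finset.single_le_sum (fun i _ => hs0 i) (Finset.mem_univ j)).trans hs1
  have hbig : ∀ j, s j ≠ 0 → β ≤ s j → s j - δ * s j ≤ s j * P (s j) := fun j h0 hj => by
    have h1 := hPs (s j) (by rwa [abs_of_nonneg (hs0 j)]) (hs j)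
    rw [Real.sign_of_pos (lt_of_le_of_ne (hs0 j) (Ne.symm h0))] at h1
    nlinarith [(abs_le.1 h1).1, hs0 j]
  have hsum : ∑ j, δ * s j ≤ δ := by
    rw [← Finset.mul_sum]
    nlinarith
  rcases hβ with h | ⟨h0, h⟩
  · have : ∑ j, (s j - δ * s j) ≤ ∑ j, s j * P (s j) := Finset.sum_le_sum fun j _ => by
      by_cases h0 : s j = 0
      · simp [h0]
      · exact hbig j h0 (h j h0)
    rw [Finset.sum_sub_distrib] at this
    linarith
  · have : ∑ j, (s j - δ * s j - 2 * β * if s j = 0 then (0 : ℝ) else 1) ≤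
        ∑ j, s j * P (s j) := Finset.sum_le_sum fun j _ => by
      by_cases hj : s j = 0
      · simp [hj]
      · rw [if_neg hj, mul_one]
        rcases le_total β (s j) with h1 | h1
        · linarith [hbig j hj h1]
        · have h2 := (abs_le.1 (hP (s j) (hs j))).1
          nlinarith [hs0 j, mul_nonneg hδ (hs0 j)]
    rw [Finset.sum_sub_distrib, Finset.sum_sub_distrib, ← Finset.mul_sum _ _ (2 * β)] at this
    linarith

/-! ### The algorithm -/

section Algorithm

variable {n m : ℕ}

lemma queries_wCircuit : (wCircuit n m).queries = 2 := by
  have h : (List.ofFn fun i : Fin m => (Instr.gate2 (swapWires n m i) swapGate :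
      Instr Prep (Fin (n + m)) (Fin m ⊕ Fin (n + m)))).countP (fun g => g.isQuery) = 0 := by
    rw [List.countP_eq_zero]
    intro g hg
    obtain ⟨i, rfl⟩ := (List.mem_ofFn' _ _).1 hg
    simp [Instr.isQuery]
  rw [QCircuit.queries, wCircuit, List.countP_append, List.countP_append, h]
  rfl

lemma gates_wCircuit : (wCircuit n m).gates = m := by
  have h : (List.ofFn fun i : Fin m => (Instr.gate2 (swapWires n m i) swapGate :
      Instr Prep (Fin (n + m)) (Fin m ⊕ Fin (n + m)))).countP (fun g => !g.isQuery) = m := by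
    rw [List.countP_eq_length.2, List.length_ofFn]
    intro g hg
    obtain ⟨i, rfl⟩ := (List.mem_ofFn' _ _).1 hg
    simp [Instr.isQuery]
  rw [QCircuit.gates, wCircuit, List.countP_append, List.countP_append, h]
  simp [Instr.isQuery]

variable {qsvtSign : (b a : ℕ) → ℝ → ℝ → SignRoutine b a} {δ s : ℝ} {r : ℕ} {χ : Criterion}

lemma queries_uhlmannPurifiedQuery :
    (uhlmannPurifiedQuery qsvtSign n m δ χ s r).circuit.queries =
      2 * (qsvtSign m (n + m) (innerError δ χ) (threshold δ s r χ)).circuit.queries := by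
  refine (QCircuit.queries_subst _ _).trans ?_
  rw [queries_wCircuit, mul_comm]
  rfl

lemma gates_uhlmannPurifiedQuery :
    (uhlmannPurifiedQuery qsvtSign n m δ χ s r).circuit.gates =
      (qsvtSign m (n + m) (innerError δ χ) (threshold δ s r χ)).circuit.gates +
        (qsvtSign m (n + m) (innerError δ χ) (threshold δ s r χ)).circuit.queries * m := by
  refine (QCircuit.gates_subst _ _).trans ?_
  rw [gates_wCircuit]
  rfl

lemma exists_performs_uhlmannPurifiedQuery (Uρ Uσ : UOp (Fin (n + m)))
    (h : IsSignQSVT (innerError δ χ) (threshold δ s r χ)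
      (qsvtSign m (n + m) (innerError δ χ) (threshold δ s r χ))) :
    ∃ (P : ℝ → ℝ) (W : UOp (Fin m ⊕ Fin (n + m + 1))),
      (∀ x : ℝ, |x| ≤ 1 → |P x| ≤ 1) ∧
      (∀ x : ℝ, threshold δ s r χ ≤ |x| → |x| ≤ 1 → |P x - Real.sign x| ≤ innerError δ χ) ∧
      (uhlmannPurifiedQuery qsvtSign n m δ χ s r).Performs (prepOracles Uρ Uσ) W.1 ∧
      topBlock W.1 =
        svTransform P (traceFst (ketbra (prepared n m Uσ) (prepared n m Uρ))) := by
  obtain ⟨P, -, -, hP1, hP2, hU⟩ := h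
  obtain ⟨W, hW, htop⟩ := hU ⟨(wCircuit n m).eval (prepOracles Uρ Uσ),
    QCircuit.eval_mem_unitary _ _⟩
  refine ⟨fun x => P.eval x, W, hP1, hP2, fun x y z => ?_, ?_⟩
  · exact (congrFun (congrFun (QCircuit.eval_subst _ _ _) _) _).trans (hW x y z)
  · rw [htop, topBlock_wCircuit]

variable (hδ : 0 < δ) (hδ1 : δ < 1)
include hδ hδ1

lemma innerError_bounds (χ : Criterion) : 0 < innerError δ χ ∧ innerError δ χ < 1 / 2 := by
  cases χ <;> simp only [innerError]
  · exact ⟨by positivity, by nlinarith⟩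
  · exact ⟨by positivity, by linarith⟩

/-- For c ≤ 4 and δ < 1 one has c/δ ≤ (2/δ)², a factor 2 in the logarithm; the square in the diamond
case gives another. With 2/δ the logarithm stays bounded away from 0 as δ approaches 1. -/
lemma log_innerError_le (χ : Criterion) :
    Real.log (1 / innerError δ χ) ≤ 4 * Real.log (2 / δ) := by
  have key : ∀ c : ℝ, 0 < c → c ≤ 4 → Real.log (c / δ) ≤ 2 * Real.log (2 / δ) := by
    intro c hc h
    have h2 : 2 * Real.log (2 / δ) = Real.log ((2 / δ) ^ 2) := by
      rw [Real.log_pow]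
      norm_num
    rw [h2]
    refine Real.log_le_log (by positivity) ?_
    rw [div_pow, div_le_div_iff₀ hδ (by positivity)]
    nlinarith
  have h0 : 0 ≤ Real.log (2 / δ) := Real.log_nonneg (by rw [le_div_iff₀ hδ]; linarith)
  cases χ <;> simp only [innerError]
  · have : 1 / (δ / 3) ^ 2 = (3 / δ) ^ 2 := by field_simp
    rw [this, Real.log_pow]
    push_cast
    linarith [key 3 (by norm_num) (by norm_num)]
  · have : 1 / (δ / 4) = 4 / δ := by field_simp
    rw [this]
    linarith [key 4 (by norm_num) le_rfl]

lemma threshold_bounds (hs : 0 < s) (hs1 : s ≤ 1) (hr : 1 ≤ r) (χ : Criterion) :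
    0 < threshold δ s r χ ∧ threshold δ s r χ ≤ 1 := by
  have hr' : (1 : ℝ) ≤ r := by exact_mod_cast hr
  cases χ <;> simp only [threshold]
  · exact ⟨hs, hs1⟩
  · refine ⟨lt_max_of_lt_left hs, max_le hs1 ?_⟩
    rw [div_le_one (by positivity)]
    linarith [(innerError_bounds hδ hδ1 .fidelity).2]

omit hδ1 in
lemma one_div_threshold_fidelity_le (hs : 0 < s) (hr : 1 ≤ r) :
    1 / threshold δ s r .fidelity ≤ 8 * min (1 / s) (r / δ) := by
  have hr' : (1 : ℝ) ≤ r := by exact_mod_cast hr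
  have h1 : 1 / threshold δ s r .fidelity ≤ 1 / s :=
    one_div_le_one_div_of_le hs (le_max_left _ _)
  have h2 : 1 / threshold δ s r .fidelity ≤ 8 * (r / δ) := by
    have : 8 * (r / δ) = 1 / (innerError δ .fidelity / (2 * r)) := by
      simp only [innerError]
      field_simp
      norm_num
    rw [this]
    refine one_div_le_one_div_of_le ?_ (le_max_right _ _)
    simp only [innerError]
    positivity
  have h3 : 0 < 1 / s := by positivity
  rw [mul_min_of_nonneg _ _ (by norm_num)]
  exact le_min (by linarith) h2

end Algorithm

end

end Uhlmann

/-! ### Choice of the subroutine and the final bounds -/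

open Uhlmann in
theorem mainTheorem1 :
    ∃ (qsvtSign : (b a : ℕ) → ℝ → ℝ → SignRoutine b a) (C : ℝ), 0 < C ∧
      -- the subroutine is a QSVT with the sign function
      (∀ (b a : ℕ) (δ β : ℝ), 0 < δ → δ < 1 / 2 → 0 < β → β ≤ 1 →
        IsSignQSVT δ β (qsvtSign b a δ β)) ∧
      ∀ (n m : ℕ), 0 < n + m → ∀ δ : ℝ, 0 < δ → δ < 1 →
      ∀ (Uρ Uσ : UOp (Fin (n + m))) (ρ σ : Bits (Fin n) × Bits (Fin m) → ℂ),
        ρ = prepared n m Uρ → σ = prepared n m Uσ → overlapA ρ σ ≠ 0 →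
      ∀ (s : ℝ) (r : ℕ), s = minSingVal (overlapA ρ σ) → r = (overlapA ρ σ).rank →
      ∀ alg : Criterion → Routine Prep (Fin (n + m)) (Fin m ⊕ Fin (n + m + 1)),
        (alg = fun χ => uhlmannPurifiedQuery qsvtSign n m δ χ s r) →
        -- `V` is the Uhlmann partial isometry
        (uhlmannIsometry ρ σ * (uhlmannIsometry ρ σ).conjTranspose * uhlmannIsometry ρ σ =
            uhlmannIsometry ρ σ ∧
          fidelity (idTensor (Bits (Fin n)) (conjChannel (uhlmannIsometry ρ σ)) (ketbra ρ ρ))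
            (ketbra σ σ) = fidelity (reducedA ρ) (reducedA σ)) ∧
        -- diamond norm
        (∃ W Uideal : UOp (Fin m ⊕ Fin (n + m + 1)),
          (alg .diamond).Performs (prepOracles Uρ Uσ) W.1 ∧
          topBlock Uideal.1 = uhlmannIsometry ρ σ ∧
          (1 / 2) * diamondNorm (conjChannel W.1 ∘ₗ prepZero (Fin m) (Fin (n + m + 1))
              - conjChannel Uideal.1 ∘ₗ prepZero (Fin m) (Fin (n + m + 1)))
            ≤ ENNReal.ofReal δ) ∧
        ((alg .diamond).circuit.queries : ℝ) ≤ C * ((1 / s) * Real.log (2 / δ)) ∧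
        -- fidelity
        (∃ W : UOp (Fin m ⊕ Fin (n + m + 1)),
          (alg .fidelity).Performs (prepOracles Uρ Uσ) W.1 ∧
          fidelity (reducedA ρ) (reducedA σ) - δ ≤
            fidelity
              (idTensor (Bits (Fin n))
                (traceOut (Fin m) (Fin (n + m + 1)) ∘ₗ conjChannel W.1 ∘ₗ
                  prepZero (Fin m) (Fin (n + m + 1))) (ketbra ρ ρ))
              (ketbra σ σ)) ∧
        ((alg .fidelity).circuit.queries : ℝ) ≤
          C * (min (1 / s) (r / δ) * Real.log (2 / δ)) ∧
        -- gates and auxiliary qubits (the register `D` and the work qubits)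
        ∀ χ : Criterion,
          ((alg χ).circuit.gates : ℝ) ≤
            C * ((alg χ).circuit.queries * Real.log (2 ^ n * 2 ^ m)) ∧
          (((n + m + 1) + (alg χ).work : ℕ) : ℝ) ≤ C * Real.log (2 ^ n * 2 ^ m) := by
  classical
  have hex : ∀ (b a : ℕ) (δ β : ℝ), ∃ c : SignRoutine b a,
      0 < δ → δ < 1 / 2 → 0 < β → β ≤ 1 → IsSignQSVT δ β c ∧ 1 ≤ c.circuit.queries ∧
        (c.circuit.queries : ℝ) ≤ 100 * (1 / β * Real.log (1 / δ)) ∧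
        c.circuit.gates ≤ (c.circuit.queries + 1) * (6 * a + 3) + 2 ∧ c.work = a + 1 := by
    intro b a δ β
    by_cases h : 0 < δ ∧ δ < 1 / 2 ∧ 0 < β ∧ β ≤ 1
    · obtain ⟨c, hc⟩ := exists_signRoutine b a h.1 h.2.1 h.2.2.1 h.2.2.2
      exact ⟨c, fun _ _ _ _ => hc⟩
    -- Outside the admissible parameters the routine is irrelevant; the empty one serves as default.
    · exact ⟨⟨0, []⟩, fun h1 h2 h3 h4 => (h ⟨h1, h2, h3, h4⟩).elim⟩
  choose q hq using hex
  -- The constant is 100 · 2 · 4 · 8: the degree bound, two oracle queries per use of W, the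
  -- comparison of logarithms, and the factor 8 of the fidelity threshold.
  refine ⟨q, 6400, by norm_num, fun b a δ β h1 h2 h3 h4 => (hq b a δ β h1 h2 h3 h4).1, ?_⟩
  rintro n m hnm δ hδ hδ1 Uρ Uσ ρ σ hρ hσ hne s r hs hr alg rfl
  have hρ1 : dotProduct (star ρ) ρ = 1 := by rw [hρ, star_dotProduct_prepared]
  have hσ1 : dotProduct (star σ) σ = 1 := by rw [hσ, star_dotProduct_prepared]
  set M := traceFst (ketbra σ ρ) with hM
  obtain ⟨j₀, hj₀⟩ := exists_singVal_eq_minSingVal hne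
  have hs0 : 0 < s := by
    rw [hs]
    exact lt_of_le_of_ne (hj₀ ▸ singVal_nonneg _ _) (minSingVal_mem hne).1.symm
  have hs1 : s ≤ 1 := by
    rw [hs, ← hj₀]
    exact singVal_le_one hρ1 hσ1 j₀
  have hsle : ∀ j, singVal M j ≠ 0 → s ≤ singVal M j := fun j hj => by
    rw [hs]
    exact minSingVal_overlapA_le hj
  have hr1 : 1 ≤ r := by rw [hr]; exact one_le_rank_overlapA hne
  have hspec : ∀ χ, _ := fun χ => hq m (n + m) (innerError δ χ) (threshold δ s r χ)
    (innerError_bounds hδ hδ1 χ).1 (innerError_bounds hδ hδ1 χ).2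
    (threshold_bounds hδ hδ1 hs0 hs1 hr1 χ).1 (threshold_bounds hδ hδ1 hs0 hs1 hr1 χ).2
  have hlog : 0 ≤ Real.log (2 / δ) := Real.log_nonneg (by rw [le_div_iff₀ hδ]; linarith)
  have hquery : ∀ χ, ((uhlmannPurifiedQuery q n m δ χ s r).circuit.queries : ℝ) ≤
      800 * (1 / threshold δ s r χ * Real.log (2 / δ)) := fun χ => by
    have h1 := (hspec χ).2.2.1
    have h2 : 1 / threshold δ s r χ * Real.log (1 / innerError δ χ) ≤
        1 / threshold δ s r χ * (4 * Real.log (2 / δ)) :=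
      mul_le_mul_of_nonneg_left (log_innerError_le hδ hδ1 χ)
        (one_div_pos.2 (threshold_bounds hδ hδ1 hs0 hs1 hr1 χ).1).le
    rw [queries_uhlmannPurifiedQuery]
    push_cast
    linarith
  have hlogd : ((n + m : ℕ) : ℝ) ≤ 2 * Real.log (2 ^ n * 2 ^ m) := by
    rw [← pow_add, Real.log_pow]
    nlinarith [Real.log_two_gt_d9, Nat.cast_nonneg (α := ℝ) (n + m)]
  have hnm1 : (1 : ℝ) ≤ ((n + m : ℕ) : ℝ) := by exact_mod_cast hnm
  have hsign : ∀ j, singVal M j ≠ 0 → (singVal M j).sign = 1 := fun j hj =>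
    Real.sign_of_pos (lt_of_le_of_ne (singVal_nonneg M j) hj.symm)
  refine ⟨⟨polarIsometry_mul_conjTranspose_mul M, ?_⟩, ?_, ?_, ?_, ?_, fun χ => ⟨?_, ?_⟩⟩
  · rw [fidelity_idTensor_conjChannel _ _ hσ1, fidelity_reducedA]
    change ‖(M.conjTranspose * polarIsometry M).trace‖ ^ 2 = _
    rw [trace_conjTranspose_mul_polarIsometry, Complex.norm_real, Real.norm_eq_abs, sq_abs]
  · obtain ⟨P, W, -, hP, hperf, htop⟩ :=
      exists_performs_uhlmannPurifiedQuery Uρ Uσ (hspec .diamond).1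
    rw [← hρ, ← hσ] at htop
    obtain ⟨U, hU, hdia⟩ := exists_unitary_diamondNorm_le hδ.le W htop fun j hj => by
      have h1 := hP (singVal M j) (by rw [abs_of_nonneg (singVal_nonneg M j)]; exact hsle j hj)
        (by rw [abs_of_nonneg (singVal_nonneg M j)]; exact singVal_le_one hρ1 hσ1 j)
      rw [hsign j hj] at h1
      simp only [innerError] at h1
      nlinarith
    exact ⟨W, U, hperf, hU, hdia⟩
  · refine (hquery .diamond).trans ?_
    have : 0 ≤ 1 / s * Real.log (2 / δ) := by positivity
    simp only [threshold]
    linarith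
  · obtain ⟨P, W, hP1, hP, hperf, htop⟩ :=
      exists_performs_uhlmannPurifiedQuery Uρ Uσ (hspec .fidelity).1
    rw [← hρ, ← hσ] at htop
    refine ⟨W, hperf, le_trans ?_ (sq_norm_trace_le_fidelity W.1 ρ hσ1)⟩
    have hT1 := traceNorm_traceFst_le_one hρ1 hσ1
    have hT0 := traceNorm_nonneg M
    rw [htop, trace_conjTranspose_mul_svTransform, Complex.norm_real, Real.norm_eq_abs, sq_abs,
      fidelity_reducedA, traceNorm_eq_sum]
    rw [traceNorm_eq_sum] at hT0 hT1
    have h := sum_sub_le_sum_mul (innerError_bounds hδ hδ1 .fidelity).1.le (singVal_nonneg M) hT1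
      hP1 hP (by
        -- If the threshold is s, no non-zero singular value lies below it. Otherwise it is δ₁/(2r),
        -- and 2βr = δ₁ exactly.
        rcases le_total (innerError δ .fidelity / (2 * r)) s with h | h
        · exact Or.inl fun j hj => (max_eq_left h).trans_le (hsle j hj)
        · refine Or.inr ⟨(threshold_bounds hδ hδ1 hs0 hs1 hr1 _).1.le, ?_⟩
          have hr0 : (0 : ℝ) < r := by exact_mod_cast hr1
          rw [← rank_overlapA, ← hr, threshold, max_eq_right h]
          apply le_of_eq
          field_simp)
    simp only [innerError] at h
    -- With T = ∑ s_j ≤ 1, the sum with P is at least T - δ/2. If T ≥ δ/2, squaring loses at most δT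
    -- ≤ δ; if T ≤ δ/2, then T² ≤ δ and the claim is trivial.
    rcases le_total (2 * (δ / 4)) (∑ j, singVal M j) with h2 | h2
    · nlinarith
    · nlinarith [sq_nonneg (∑ j, singVal M j * P (singVal M j))]
  · refine (hquery .fidelity).trans ?_
    have := mul_le_mul_of_nonneg_right (one_div_threshold_fidelity_le (r := r) hδ hs0 hr1) hlog
    have h0 : 0 ≤ min (1 / s) (r / δ) * Real.log (2 / δ) := by positivity
    linarith
  · obtain ⟨-, h1, -, h2, -⟩ := hspec χ
    -- For k uses of W the gate count is at most (k+1)(6(n+m)+3) + 2 + km. As k ≥ 1 and n + m ≥ 1,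
    -- the additive constants are absorbed: at most 21k(n+m), and the number of queries is 2k.
    have h3 : (uhlmannPurifiedQuery q n m δ χ s r).circuit.gates ≤
        11 * ((uhlmannPurifiedQuery q n m δ χ s r).circuit.queries * (n + m)) := by
      rw [gates_uhlmannPurifiedQuery, queries_uhlmannPurifiedQuery]
      generalize (q m (n + m) (innerError δ χ) (threshold δ s r χ)).circuit.queries = k at *
      obtain ⟨l, rfl⟩ : ∃ l, k = l + 1 := ⟨k - 1, by omega⟩
      obtain ⟨a, ha⟩ : ∃ a, n + m = a + 1 := ⟨n + m - 1, by omega⟩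
      have hm : m ≤ a + 1 := by omega
      rw [ha] at h2 ⊢
      nlinarith [Nat.mul_le_mul_left (l + 1) hm, Nat.zero_le (l * a)]
    calc ((uhlmannPurifiedQuery q n m δ χ s r).circuit.gates : ℝ)
        ≤ 11 * ((uhlmannPurifiedQuery q n m δ χ s r).circuit.queries * ((n + m : ℕ) : ℝ)) := by
          exact_mod_cast h3
      _ ≤ 11 * ((uhlmannPurifiedQuery q n m δ χ s r).circuit.queries *
            (2 * Real.log (2 ^ n * 2 ^ m))) := by gcongr
      _ = 22 * ((uhlmannPurifiedQuery q n m δ χ s r).circuit.queries *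
            Real.log (2 ^ n * 2 ^ m)) := by ring
      _ ≤ 6400 * ((uhlmannPurifiedQuery q n m δ χ s r).circuit.queries *
            Real.log (2 ^ n * 2 ^ m)) := by
          have h4 : 0 ≤ Real.log (2 ^ n * 2 ^ m) := by linarith
          gcongr
          norm_num
  · have h1 : (uhlmannPurifiedQuery q n m δ χ s r).work = n + m + 1 := (hspec χ).2.2.2.2
    simp only [h1]
    push_cast at hlogd hnm1 ⊢
    linarith
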